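/- Let $A,B,C$ be finite alphabets. A *one-way non-deterministic transducer* from $A$ to $B$ consists of a finite set $Q$ of states, sets $I,F\subseteq Q$ of initial and final states, a transition relation $\Delta\subseteq Q\times A\times Q$ and an output function $\lambda:\Delta\to B^*$. A run on $x=x_1x_2\cdots\in A^\omega$ is a sequence of states $(q_i)_{i\ge 0}$ with $(q_{i},x_{i+1},q_{i+1})\in\Delta$ for all $i$; it is accepting if $q_0\in I$ and $q_i\in F$ for infinitely many $i$; its output is the concatenation of the words $\lambda(q_{i},x_{i+1},q_{i+1})$, $i\ge0$. The transducer is *restricted* if $F=Q$. A restricted transducer computes the partial function $f:A^\omega\rightharpoonup B^\omega$ that is defined at $x$ exactly when there is a unique accepting run on $x$ and the output of this run is infinite, and $f(x)$ is then this output. A *deterministic two-way transducer* from $A$ to $B$ consists of a finite set $Q$ of states, an initial state $q_0$, and partial functions $\delta:Q\times(A\uplus\{\vdash\})\rightharpoonup Q\times\{\triangleleft,\triangleright\}$ and $\lambda:Q\times(A\uplus\{\vdash\})\rightharpoonup B^*$ with the same domain. On $x\in A^\omega$ it reads the word $\vdash x$, whose positions are $0,1,2,\dots$; from the configuration $(q,i)$,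 where the letter $s$ is in position $i$ and $\delta(q,s)=(q',\star)$, it outputs $\lambda(q,s)$ and goes to $(q',i-1)$ if $\star=\triangleleft$ (impossible if $i=0$) and to $(q',i+1)$ if $\star=\triangleright$. It computes the partial function $A^\omega\rightharpoonup B^\omega$ that is defined at $x$ exactly when the run from $(q_0,0)$ is infinite, its positions tend to infinity and the concatenation of all its outputs is infinite, and whose value is then this concatenation. A partial function $A^\omega\rightharpoonup B^\omega$ is *deterministic regular* if it is computed by a deterministic two-way transducer. **Theorem.** If $f:A^\omega\rightharpoonup B^\omega$ is computed by a restricted one-way non-deterministic transducer and $g:B^\omega\rightharpoonup C^\omega$ is deterministic regular, then $g\circ f:A^\omega\rightharpoonup C^\omega$ (defined at $x$ exactly when $f$ is defined at $x$ and $g$ at $f(x)$) is deterministic regular. This is effective: there is an algorithm which, given a restricted one-way non-deterministic transducer computing $f$ and a deterministic two-way transducer computing $g$, constructs a deterministic two-way transducer computing $g\circ f$. -/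

import Mathlib

/-! Infinite words over `A` are functions `ℕ → A` (the letter in position `i + 1` is the value at
`i`), partial functions of infinite words are Mathlib's `PFun`. -/

/-- The finite word `w 0 ++ w 1 ++ ... ++ w (n - 1)`. -/
def concatPrefix {B : Type*} (w : ℕ → List B) (n : ℕ) : List B :=
  ((List.range n).map w).flatten

/-- The infinite concatenation `w 0 ++ w 1 ++ ...` is infinite and equal to the word `y`. -/
def IsInfConcat {B : Type*} (w : ℕ → List B) (y : ℕ → B) : Prop :=
  ∀ i, ∃ n, (concatPrefix w n)[i]? = some (y i)

theorem concatPrefix_prefix {B : Type*} (w : ℕ → List B) {m n : ℕ} (h : m ≤ n) :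
    concatPrefix w m <+: concatPrefix w n := by
  induction n, h using Nat.le_induction with
  | base => exact List.prefix_rfl
  | succ n _ ih =>
    refine ih.trans ?_
    simp [concatPrefix, List.range_succ]

theorem IsInfConcat.unique {B : Type*} {w : ℕ → List B} {y z : ℕ → B}
    (hy : IsInfConcat w y) (hz : IsInfConcat w z) : y = z := by
  funext i
  obtain ⟨m, hm⟩ := hy i
  obtain ⟨n, hn⟩ := hz i
  have key : ∀ {k l : ℕ} {c : B}, k ≤ l → (concatPrefix w k)[i]? = some c →
      (concatPrefix w l)[i]? = some c := by
    intro k l c hkl hk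
    obtain ⟨t, ht⟩ := concatPrefix_prefix w hkl
    rw [← ht]
    obtain ⟨hlt, -⟩ := List.getElem?_eq_some_iff.1 hk
    rw [List.getElem?_append_left hlt, hk]
  exact Option.some.inj ((key (le_max_left m n) hm).symm.trans (key (le_max_right m n) hn))

/-- The partial function whose graph is the (functional) relation `R`. -/
noncomputable def partialOfRel {X Y : Type*} (R : X → Y → Prop) : X →. Y :=
  fun x => ⟨∃ y, R x y, fun h => h.choose⟩

theorem mem_partialOfRel {X Y : Type*} {R : X → Y → Prop}
    (hR : ∀ x y z, R x y → R x z → y = z) (x : X) (y : Y) :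
    y ∈ partialOfRel R x ↔ R x y := by
  constructor
  · rintro ⟨h, rfl⟩
    exact h.choose_spec
  · intro h
    exact ⟨⟨y, h⟩, hR _ _ _ (Exists.choose_spec (⟨y, h⟩ : ∃ y, R x y)) h⟩

/-- One-way non-deterministic transducers with input alphabet `A`, output alphabet `B` and set of
states `Q`. -/
structure OneNT (A B Q : Type*) where
  /-- initial states -/
  initial : Set Q
  /-- final states -/
  final : Set Q
  /-- The transition relation together with its output function: `trans q a q' = some α` if
  `(q, a, q')` is a transition, with output `α`; `trans q a q' = none` if it is not one. -/
  trans : Q → A → Q → Option (List B)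

namespace OneNT

variable {A B Q : Type*}

/-- The sequence of states `ρ` is an infinite run labelled by `x`. -/
def IsRun (N : OneNT A B Q) (x : ℕ → A) (ρ : ℕ → Q) : Prop :=
  ∀ i, (N.trans (ρ i) (x i) (ρ (i + 1))).isSome

/-- Accepting runs: they start in an initial state and visit final states infinitely often. -/
def IsAccepting (N : OneNT A B Q) (x : ℕ → A) (ρ : ℕ → Q) : Prop :=
  N.IsRun x ρ ∧ ρ 0 ∈ N.initial ∧ ∀ i, ∃ j, i ≤ j ∧ ρ j ∈ N.final

/-- The output of the transition number `i` of the run `ρ`. -/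
def runOutput (N : OneNT A B Q) (x : ℕ → A) (ρ : ℕ → Q) (i : ℕ) : List B :=
  (N.trans (ρ i) (x i) (ρ (i + 1))).getD []

/-- A restricted transducer: all states are final. -/
def IsRestricted (N : OneNT A B Q) : Prop :=
  ∀ q, q ∈ N.final

/-- There is a unique accepting run labelled by `x`, and its output is the infinite word `y`. -/
def RestrictedRel (N : OneNT A B Q) (x : ℕ → A) (y : ℕ → B) : Prop :=
  (∃! ρ, N.IsAccepting x ρ) ∧ ∃ ρ, N.IsAccepting x ρ ∧ IsInfConcat (N.runOutput x ρ) y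

/-- The partial function computed by a restricted transducer. -/
noncomputable def restrictedFun (N : OneNT A B Q) : (ℕ → A) →. (ℕ → B) :=
  partialOfRel N.RestrictedRel

theorem mem_restrictedFun (N : OneNT A B Q) (x : ℕ → A) (y : ℕ → B) :
    y ∈ N.restrictedFun x ↔ N.RestrictedRel x y := by
  refine mem_partialOfRel ?_ x y
  rintro x y z ⟨hu, ρ, hρ, hy⟩ ⟨-, ρ', hρ', hz⟩
  obtain rfl := hu.unique hρ hρ'
  exact hy.unique hz

end OneNT

/-- Deterministic two-way transducers with input alphabet `A`, output alphabet `B` and set of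
states `Q`. The letter `none` is the left end marker. -/
structure TwoDT (A B Q : Type*) where
  /-- the initial state -/
  start : Q
  /-- The partial transition function together with the output function, which has the same domain:
  `step q s = some (q', d, α)` means that in state `q` on letter `s` the machine goes to state `q'`,
  moves its head right if `d = true` and left if `d = false`, and outputs `α`. -/
  step : Q → Option A → Option (Q × Bool × List B)

namespace TwoDT

variable {A B Q : Type*}

/-- The input tape: the left end marker in position `0`, then `x`. -/
def tape (x : ℕ → A) : ℕ → Option A
  | 0 => none
  | i + 1 => some (x i)

/-- The configuration `c` (a state and a position) has a transition to the configuration `c'`.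
There is none to the left of position `0`. -/
def Next (T : TwoDT A B Q) (x : ℕ → A) (c c' : Q × ℕ) : Prop :=
  ∃ d α, T.step c.1 (tape x c.2) = some (c'.1, d, α) ∧
    if d then c'.2 = c.2 + 1 else c.2 = c'.2 + 1

/-- Accepting runs: infinite runs from the initial configuration whose positions tend to
infinity. -/
def IsAccepting (T : TwoDT A B Q) (x : ℕ → A) (ρ : ℕ → Q × ℕ) : Prop :=
  ρ 0 = (T.start, 0) ∧ (∀ j, T.Next x (ρ j) (ρ (j + 1))) ∧
    Filter.Tendsto (fun j => (ρ j).2) Filter.atTop Filter.atTop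

/-- The output of the transition number `j` of the run `ρ`. -/
def runOutput (T : TwoDT A B Q) (x : ℕ → A) (ρ : ℕ → Q × ℕ) (j : ℕ) : List B :=
  ((T.step (ρ j).1 (tape x (ρ j).2)).map fun t => t.2.2).getD []

/-- There is a (necessarily unique) accepting run on `x`, and its output is the infinite
word `y`. -/
def Rel (T : TwoDT A B Q) (x : ℕ → A) (y : ℕ → B) : Prop :=
  ∃ ρ, T.IsAccepting x ρ ∧ IsInfConcat (T.runOutput x ρ) y

/-- The partial function computed by a deterministic two-way transducer. -/
noncomputable def toFun (T : TwoDT A B Q) : (ℕ → A) →. (ℕ → B) :=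
  partialOfRel T.Rel

theorem Next.unique {T : TwoDT A B Q} {x : ℕ → A} {c c₁ c₂ : Q × ℕ}
    (h₁ : T.Next x c c₁) (h₂ : T.Next x c c₂) : c₁ = c₂ := by
  obtain ⟨d, α, h, hd⟩ := h₁
  obtain ⟨d', α', h', hd'⟩ := h₂
  rw [h] at h'
  simp only [Option.some.injEq, Prod.mk.injEq] at h'
  obtain ⟨hq, rfl, -⟩ := h'
  refine Prod.ext hq ?_
  cases d <;> simp at hd hd' <;> omega

theorem mem_toFun (T : TwoDT A B Q) (x : ℕ → A) (y : ℕ → B) :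
    y ∈ T.toFun x ↔ T.Rel x y := by
  refine mem_partialOfRel ?_ x y
  rintro x y z ⟨ρ, ⟨h0, hs, -⟩, hy⟩ ⟨ρ', ⟨h0', hs', -⟩, hz⟩
  have : ρ = ρ' := by
    funext j
    induction j with
    | zero => rw [h0, h0']
    | succ j ih => exact (hs j).unique (ih ▸ hs' j)
  subst this
  exact hy.unique hz

end TwoDT

/-- Deterministic regular functions: those computed by a deterministic two-way transducer with
finitely many states. -/
def IsDetRegular {A B : Type*} (f : (ℕ → A) →. (ℕ → B)) : Prop :=
  ∃ (Q : Type) (_ : Finite Q) (T : TwoDT A B Q), T.toFun = f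

/-- Finite descriptions of restricted one-way transducers: the numbers of input letters, output
letters and states, a list of the initial states, a list of the transitions with their outputs. -/
abbrev OneNTCode : Type :=
  (ℕ × ℕ × ℕ) × List ℕ × List ((ℕ × ℕ × ℕ) × List ℕ)

/-- Finite descriptions of two-way transducers: the numbers of input letters, output letters and
states, the initial state, a list of the transitions. -/
abbrev TwoDTCode : Type :=
  (ℕ × ℕ × ℕ) × ℕ × List ((ℕ × Option ℕ) × ℕ × Bool × List ℕ)

/-- `c` is a description of the restricted transducer `N`. -/
def OneNT.IsCode {a b n : ℕ} (N : OneNT (Fin a) (Fin b) (Fin n)) (c : OneNTCode) : Prop :=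
  N.IsRestricted ∧ c.1 = (a, b, n) ∧
  (∀ p : ℕ, p ∈ c.2.1 ↔ ∃ q ∈ N.initial, p = q.val) ∧
  (∀ t, t ∈ c.2.2 ↔ ∃ q s q' α, N.trans q s q' = some α ∧
    t = ((q.val, s.val, q'.val), α.map Fin.val))

/-- `c` is a description of the two-way transducer `T`. -/
def TwoDT.IsCode {a b n : ℕ} (T : TwoDT (Fin a) (Fin b) (Fin n)) (c : TwoDTCode) : Prop :=
  c.1 = (a, b, n) ∧ c.2.1 = T.start.val ∧
  (∀ t, t ∈ c.2.2 ↔ ∃ q s q' d α, T.step q s = some (q', d, α) ∧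
    t = ((q.val, s.map Fin.val), q'.val, d, α.map Fin.val))

/-! All states of a restricted transducer are final, so every infinite run from an initial state is
accepting. Hence `f` is defined at `x` when the graph of runs over `⊢x` has exactly one infinite
path from its root and the output along that path is infinite. A machine for `g ∘ f` runs the
machine of `g` on the outputs along this path; for this it must know the current and the next state
of the path wherever its head is.

The nodes that are reached by exactly one finite path from the root form a tree, since each has a
single predecessor, of the same kind. A deterministic subset automaton computes them layer by layer,
together with the nodes reached by several paths and a breakpoint set of the latter. From some layer
on the breakpoint set is never empty if and only if some infinite path reaches a node of the second
kind. In that case an extra node, the ghost, gives the tree one more infinite branch, as long as the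
tree does not die out. So the graph has a unique infinite path if and only if the forest has one
that avoids the ghost (`LayeredGraph.forest_unique_iff`). A path that ends in the ghost has finite
output and is harmless.

In such a forest the next node on the only infinite path is found by a two-way search: follow the
descendants of the children of the current node, each tagged with its child, until one tag is left.
If the infinite path is unique, König's lemma makes the search end (`Resolver.IsPath.answer_eq`); a
search that does not end produces no output, and the composition is undefined as well. To return
with finite memory the machine takes the nodes of the last layer with two tags and replaces them by
their parents: they first coincide in the starting node. The same search to the left recovers the
state of the subset automaton after a left move (`Mach.accepts_lookbehind_iff`); both searches are
cases of `QMach.accepts_resolve_iff`.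

Every reduction replaces a step by a finite excursion with the same output.
`DetSys.Simulation.acc_iff` transfers acceptance, provided that excursions which start far to the
right stay far to the right. For effectiveness, the step function of the composed machine is
primitive recursive in the codes, and for each pair of codes its states lie in a finite closed set.
An unbounded search finds a closed list of states, whose indices are the states of the result
(`exists_computable_codeOfList`). -/

open Filter

set_option linter.unusedSectionVars false

/-! ### Deterministic transition systems with outputs -/

theorem concatPrefix_succ {B : Type*} (w : ℕ → List B) (n : ℕ) :
    concatPrefix w (n + 1) = concatPrefix w n ++ w n := by
  simp [concatPrefix, List.range_succ]

theorem concatPrefix_add {B : Type*} (w : ℕ → List B) (m n : ℕ) :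
    concatPrefix w (m + n) = concatPrefix w m ++ concatPrefix (fun k => w (m + k)) n := by
  induction n with
  | zero => simp [concatPrefix]
  | succ n ih => rw [← add_assoc, concatPrefix_succ, concatPrefix_succ, ih, List.append_assoc]

theorem getElem?_of_prefix {B : Type*} {u v : List B} (h : u <+: v) {i : ℕ} {b : B}
    (hi : u[i]? = some b) : v[i]? = some b := by
  obtain ⟨t, rfl⟩ := h
  obtain ⟨hlt, -⟩ := List.getElem?_eq_some_iff.1 hi
  rw [List.getElem?_append_left hlt, hi]

theorem IsInfConcat.exists_ne_nil {B : Type*} {w : ℕ → List B} {y : ℕ → B}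
    (h : IsInfConcat w y) (n : ℕ) : ∃ m, n ≤ m ∧ w m ≠ [] := by
  by_contra hc
  push Not at hc
  obtain ⟨k, hk⟩ := h (concatPrefix w n).length
  have hconst : ∀ j, concatPrefix w (n + j) = concatPrefix w n := by
    intro j
    induction j with
    | zero => rfl
    | succ j ih => rw [← add_assoc, concatPrefix_succ, ih, hc _ (by omega), List.append_nil]
  have h2 := getElem?_of_prefix (concatPrefix_prefix w (show k ≤ n + k by omega)) hk
  rw [hconst, List.getElem?_eq_none le_rfl] at h2
  simp at h2

theorem exists_isInfConcat {B : Type*} {w : ℕ → List B}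
    (h : ∀ n, ∃ m, n ≤ m ∧ w m ≠ []) : ∃ y, IsInfConcat w y := by
  have hlen : ∀ i, ∃ n, i < (concatPrefix w n).length := by
    intro i
    induction i with
    | zero =>
      obtain ⟨m, -, hm⟩ := h 0
      refine ⟨m + 1, ?_⟩
      rw [concatPrefix_succ, List.length_append]
      have := List.length_pos_iff.2 hm
      omega
    | succ i ih =>
      obtain ⟨n, hn⟩ := ih
      obtain ⟨m, hnm, hm⟩ := h n
      refine ⟨m + 1, ?_⟩
      rw [concatPrefix_succ, List.length_append]
      have := List.length_pos_iff.2 hm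
      have := (concatPrefix_prefix w hnm).length_le
      omega
  choose n hn using hlen
  exact ⟨fun i => (concatPrefix w (n i))[i]'(hn i), fun i => ⟨n i, List.getElem?_eq_getElem (hn i)⟩⟩

/-- A deterministic transition system with outputs; `none` means that there is no transition. -/
abbrev DetSys (Γ C : Type*) := Γ → Option (Γ × List C)

namespace DetSys

variable {Γ Γ' C : Type*}

def next (σ : DetSys Γ C) (c : Γ) : Γ := ((σ c).map Prod.fst).getD c

def out (σ : DetSys Γ C) (c : Γ) : List C := ((σ c).map Prod.snd).getD []

def conf (σ : DetSys Γ C) (c : Γ) (n : ℕ) : Γ := σ.next^[n] c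

/-- The run from `c` is infinite, its positions tend to infinity and its output is infinite. -/
def Live (σ : DetSys Γ C) (pos : Γ → ℕ) (c : Γ) : Prop :=
  (∀ n, (σ (σ.conf c n)).isSome) ∧ Tendsto (fun n => pos (σ.conf c n)) atTop atTop ∧
    ∀ n, ∃ m, n ≤ m ∧ σ.out (σ.conf c m) ≠ []

/-- The run from `c` is infinite, its positions tend to infinity and its output is `y`. -/
def Acc (σ : DetSys Γ C) (pos : Γ → ℕ) (c : Γ) (y : ℕ → C) : Prop :=
  (∀ n, (σ (σ.conf c n)).isSome) ∧ Tendsto (fun n => pos (σ.conf c n)) atTop atTop ∧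
    IsInfConcat (fun n => σ.out (σ.conf c n)) y

/-- The run from `c` arrives after `n` steps in `c'`, with output `α`, and all positions before
are at least `P`. -/
def Seg (σ : DetSys Γ C) (pos : Γ → ℕ) (P n : ℕ) (c c' : Γ) (α : List C) : Prop :=
  σ.conf c n = c' ∧ (∀ m < n, (σ (σ.conf c m)).isSome ∧ P ≤ pos (σ.conf c m)) ∧
    concatPrefix (fun m => σ.out (σ.conf c m)) n = α

theorem conf_add (σ : DetSys Γ C) (c : Γ) (m n : ℕ) :
    σ.conf c (m + n) = σ.conf (σ.conf c m) n := by
  rw [conf, conf, conf, add_comm, Function.iterate_add_apply]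

theorem conf_succ (σ : DetSys Γ C) (c : Γ) (n : ℕ) :
    σ.conf c (n + 1) = σ.next (σ.conf c n) := Function.iterate_succ_apply' _ _ _

theorem next_eq {σ : DetSys Γ C} {c c' : Γ} {α : List C} (h : σ c = some (c', α)) :
    σ.next c = c' := by simp [next, h]

theorem out_eq {σ : DetSys Γ C} {c c' : Γ} {α : List C} (h : σ c = some (c', α)) :
    σ.out c = α := by simp [out, h]

theorem Acc.live {σ : DetSys Γ C} {pos : Γ → ℕ} {c : Γ} {y : ℕ → C} (h : σ.Acc pos c y) :
    σ.Live pos c := ⟨h.1, h.2.1, h.2.2.exists_ne_nil⟩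

theorem Live.conf {σ : DetSys Γ C} {pos : Γ → ℕ} {c : Γ} (h : σ.Live pos c) (k : ℕ) :
    σ.Live pos (σ.conf c k) := by
  refine ⟨fun n => ?_, ?_, fun n => ?_⟩
  · rw [← conf_add]; exact h.1 _
  · simp only [← conf_add]
    exact h.2.1.comp (tendsto_add_atTop_nat k |>.congr fun n => add_comm n k)
  · obtain ⟨m, hm, hne⟩ := h.2.2 (k + n)
    refine ⟨m - k, by omega, ?_⟩
    rw [← conf_add, show k + (m - k) = m by omega]
    exact hne

theorem Live.exists_step {σ : DetSys Γ C} {pos : Γ → ℕ} {c : Γ} (h : σ.Live pos c) :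
    ∃ c' α, σ c = some (c', α) ∧ σ.Live pos c' := by
  have h0 := h.1 0
  obtain ⟨⟨c', α⟩, hc⟩ := Option.isSome_iff_exists.1 h0
  refine ⟨c', α, hc, ?_⟩
  have := h.conf 1
  rwa [show σ.conf c 1 = c' from next_eq hc] at this

theorem Seg.live {σ : DetSys Γ C} {pos : Γ → ℕ} {P n : ℕ} {c c' : Γ} {α : List C}
    (h : σ.Seg pos P n c c' α) (hl : σ.Live pos c) : σ.Live pos c' := h.1 ▸ hl.conf n

theorem Seg.refl (σ : DetSys Γ C) (pos : Γ → ℕ) (P : ℕ) (c : Γ) : σ.Seg pos P 0 c c [] :=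
  ⟨rfl, by simp, rfl⟩

theorem Seg.trans {σ : DetSys Γ C} {pos : Γ → ℕ} {P m n : ℕ} {c c' c'' : Γ} {α β : List C}
    (h : σ.Seg pos P m c c' α) (h' : σ.Seg pos P n c' c'' β) :
    σ.Seg pos P (m + n) c c'' (α ++ β) := by
  obtain ⟨rfl, h2, rfl⟩ := h
  obtain ⟨rfl, h2', rfl⟩ := h'
  refine ⟨conf_add .., fun k hk => ?_, ?_⟩
  · by_cases hkm : k < m
    · exact h2 k hkm
    · have := h2' (k - m) (by omega)
      rwa [← conf_add, show m + (k - m) = k by omega] at this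
  · rw [concatPrefix_add]
    simp only [conf_add]

theorem Seg.single {σ : DetSys Γ C} {pos : Γ → ℕ} {P : ℕ} {c c' : Γ} {α : List C}
    (h : σ c = some (c', α)) (hP : P ≤ pos c) : σ.Seg pos P 1 c c' α := by
  refine ⟨next_eq h, fun m hm => ?_, ?_⟩
  · obtain rfl : m = 0 := by omega
    exact ⟨by simp [conf, h], hP⟩
  · simp [concatPrefix, conf, out_eq h]

theorem Seg.cons {σ : DetSys Γ C} {pos : Γ → ℕ} {P n : ℕ} {c c' c'' : Γ} {α β : List C}
    (h : σ c = some (c', α)) (hP : P ≤ pos c) (h' : σ.Seg pos P n c' c'' β) :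
    σ.Seg pos P (n + 1) c c'' (α ++ β) := by
  rw [add_comm]
  exact (Seg.single h hP).trans h'

/-- A simulation: every step of `σ` is matched by a nonempty run of `σ'` with the same output. -/
structure Simulation (σ : DetSys Γ C) (pos : Γ → ℕ) (σ' : DetSys Γ' C) (pos' : Γ' → ℕ)
    (R : Γ → Γ' → Prop) (low : Γ' → ℕ) : Prop where
  -- Where `σ` stops, `σ'` need not stop: it may run forever without output, as an endless search
  -- does. It suffices that it cannot accept.
  dead : ∀ c c', R c c' → σ c = none → ¬ σ'.Live pos' c'
  step : ∀ c c' c₁ α, R c c' → σ c = some (c₁, α) →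
    ∃ n c₁', σ'.Seg pos' (low c') (n + 1) c' c₁' α ∧ R c₁ c₁'
  -- `low c'` bounds from below the positions in the excursion that starts at `c'`, so this field
  -- carries the divergence of positions from `σ` to `σ'`; the next one carries it back.
  low_ge : ∀ P, ∃ P', ∀ c c', R c c' → P' ≤ pos c → P ≤ low c'
  pos_ge : ∀ P, ∃ P', ∀ c c', R c c' → P' ≤ pos' c' → P ≤ pos c

namespace Simulation

variable {σ : DetSys Γ C} {pos : Γ → ℕ} {σ' : DetSys Γ' C} {pos' : Γ' → ℕ}
  {R : Γ → Γ' → Prop} {low : Γ' → ℕ}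

/-- `t k` is the time at which `σ'` has simulated `k` steps of `σ`. The recursion carries the
relation along with the time, because the length of the next segment is chosen from it. -/
theorem exists_times (S : Simulation σ pos σ' pos' R low) {c : Γ} {c' : Γ'} (hR : R c c')
    (hs : ∀ n, (σ (σ.conf c n)).isSome) :
    ∃ t : ℕ → ℕ, t 0 = 0 ∧ ∀ k, t k < t (k + 1) ∧ R (σ.conf c k) (σ'.conf c' (t k)) ∧
      σ'.Seg pos' (low (σ'.conf c' (t k))) (t (k + 1) - t k) (σ'.conf c' (t k))
        (σ'.conf c' (t (k + 1))) (σ.out (σ.conf c k)) := by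
  have key : ∀ k t, R (σ.conf c k) (σ'.conf c' t) → ∃ t', t < t' ∧
      R (σ.conf c (k + 1)) (σ'.conf c' t') ∧
      σ'.Seg pos' (low (σ'.conf c' t)) (t' - t) (σ'.conf c' t) (σ'.conf c' t')
        (σ.out (σ.conf c k)) := by
    intro k t hRt
    obtain ⟨⟨c₁, α⟩, hc⟩ := Option.isSome_iff_exists.1 (hs k)
    obtain ⟨n, c₁', hseg, hR1⟩ := S.step _ _ _ _ hRt hc
    have h1 : σ'.conf c' (t + (n + 1)) = c₁' := by rw [conf_add]; exact hseg.1
    refine ⟨t + (n + 1), by omega, ?_, ?_⟩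
    · rw [h1, conf_succ, next_eq hc]; exact hR1
    · rw [h1, out_eq hc, Nat.add_sub_cancel_left]; exact hseg
  choose g hg using key
  let T : (k : ℕ) → {t : ℕ // R (σ.conf c k) (σ'.conf c' t)} := fun k =>
    Nat.rec ⟨0, hR⟩ (fun k t => ⟨g k t.1 t.2, (hg k t.1 t.2).2.1⟩) k
  exact ⟨fun k => (T k).1, rfl, fun k => ⟨(hg k _ (T k).2).1, (T k).2, (hg k _ (T k).2).2.2⟩⟩

/-- Liveness passes along the segments of `σ'`, so a configuration in which `σ` stops would
contradict `dead`. -/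
theorem isSome_of_live (S : Simulation σ pos σ' pos' R low) {c : Γ} {c' : Γ'} (hR : R c c')
    (hl : σ'.Live pos' c') (n : ℕ) : (σ (σ.conf c n)).isSome := by
  suffices h : ∃ c₁', R (σ.conf c n) c₁' ∧ σ'.Live pos' c₁' by
    obtain ⟨c₁', h1, h2⟩ := h
    rw [Option.isSome_iff_ne_none]
    exact fun hn => S.dead _ _ h1 hn h2
  induction n with
  | zero => exact ⟨c', hR, hl⟩
  | succ n ih =>
    obtain ⟨c₁', h1, h2⟩ := ih
    have : σ (σ.conf c n) ≠ none := fun hn => S.dead _ _ h1 hn h2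
    obtain ⟨⟨c₂, α⟩, hc⟩ := Option.ne_none_iff_exists'.1 this
    obtain ⟨m, c₂', hseg, hR2⟩ := S.step _ _ _ _ h1 hc
    rw [conf_succ, next_eq hc]
    exact ⟨c₂', hR2, hseg.live h2⟩

/-- At the times `t k`, which increase strictly, the outputs so far agree, hence so do the infinite
outputs. Any other time lies in exactly one segment between `t k` and `t (k + 1)`, where `low`
controls the position. -/
theorem acc_iff (S : Simulation σ pos σ' pos' R low) {c : Γ} {c' : Γ'} (hR : R c c')
    (y : ℕ → C) : σ.Acc pos c y ↔ σ'.Acc pos' c' y := by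
  have main : (∀ n, (σ (σ.conf c n)).isSome) → ∃ t : ℕ → ℕ, StrictMono t ∧
      (∀ k, R (σ.conf c k) (σ'.conf c' (t k))) ∧
      (∀ k, concatPrefix (fun m => σ'.out (σ'.conf c' m)) (t k) =
        concatPrefix (fun m => σ.out (σ.conf c m)) k) ∧
      ∀ m, ∃ k, t k ≤ m ∧ m < t (k + 1) ∧ (σ' (σ'.conf c' m)).isSome ∧
        low (σ'.conf c' (t k)) ≤ pos' (σ'.conf c' m) := by
    intro hs
    obtain ⟨t, ht0, ht⟩ := S.exists_times hR hs
    have hmono : StrictMono t := strictMono_nat_of_lt_succ fun k => (ht k).1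
    refine ⟨t, hmono, fun k => (ht k).2.1, fun k => ?_, fun m => ?_⟩
    · induction k with
      | zero => rw [ht0]; rfl
      | succ k ih =>
        have h3 := (ht k).2.2.2.2
        have := (ht k).1
        rw [concatPrefix_succ, ← ih, ← h3]
        conv_lhs => rw [show t (k + 1) = t k + (t (k + 1) - t k) by omega, concatPrefix_add]
        simp only [conf_add]
    · have hex : ∃ k, m < t (k + 1) := ⟨m, by
        have := hmono.le_apply (x := m + 1)
        omega⟩
      classical
      have hk := Nat.find_spec hex
      set k := Nat.find hex with hkdef
      have hle : t k ≤ m := by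
        rcases Nat.eq_zero_or_pos k with h0 | h0
        · rw [h0, ht0]; omega
        · have := Nat.find_min hex (m := k - 1) (by omega)
          rw [show k - 1 + 1 = k by omega] at this
          omega
      refine ⟨k, hle, hk, ?_⟩
      have h2 := (ht k).2.2.2.1 (m - t k) (by omega)
      rwa [← conf_add, show t k + (m - t k) = m by omega] at h2
  constructor
  · rintro ⟨hs, hp, ho⟩
    obtain ⟨t, hmono, htR, hout, hm⟩ := main hs
    refine ⟨fun n => ?_, ?_, fun i => ?_⟩
    · obtain ⟨k, -, -, h, -⟩ := hm n
      exact h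
    · refine tendsto_atTop.2 fun P => ?_
      obtain ⟨P', hP'⟩ := S.low_ge P
      obtain ⟨K, hK⟩ := eventually_atTop.1 (tendsto_atTop.1 hp P')
      filter_upwards [eventually_ge_atTop (t K)] with n hn
      obtain ⟨k, h1, h2, -, h3⟩ := hm n
      have hKk : K ≤ k := by
        have := hmono.lt_iff_lt.1 (lt_of_le_of_lt hn h2)
        omega
      exact (hP' _ _ (htR k) (hK k hKk)).trans h3
    · obtain ⟨n, hn⟩ := ho i
      exact ⟨t n, by rw [hout]; exact hn⟩
  · intro hacc
    have hs := S.isSome_of_live hR hacc.live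
    obtain ⟨t, hmono, htR, hout, -⟩ := main hs
    refine ⟨hs, ?_, fun i => ?_⟩
    · refine tendsto_atTop.2 fun P => ?_
      obtain ⟨P', hP'⟩ := S.pos_ge P
      have := tendsto_atTop.1 (hacc.2.1.comp hmono.tendsto_atTop) P'
      filter_upwards [this] with n hn
      exact hP' _ _ (htR n) hn
    · obtain ⟨n, hn⟩ := hacc.2.2 i
      refine ⟨n, ?_⟩
      rw [← hout]
      exact getElem?_of_prefix (concatPrefix_prefix _ hmono.le_apply) hn

end Simulation

end DetSys

/-! ### Machines with stay moves on arbitrary tapes -/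

/-- A deterministic two-way machine on tapes over `L`; the move `none` lets the head stay. -/
structure Mach (L S C : Type*) where
  start : S
  step : S → L → Option (S × Option Bool × List C)

/-- The new position of the head, if there is one. -/
def movePos : Option Bool → ℕ → Option ℕ
  | none, i => some i
  | some true, i => some (i + 1)
  | some false, 0 => none
  | some false, i + 1 => some i

namespace Mach

variable {L S C : Type*}

def sys (M : Mach L S C) (w : ℕ → L) : DetSys (S × ℕ) C := fun c =>
  (M.step c.1 (w c.2)).bind fun r => (movePos r.2.1 c.2).map fun p => ((r.1, p), r.2.2)

theorem sys_eq_some {M : Mach L S C} {w : ℕ → L} {s s' : S} {i p : ℕ} {d : Option Bool}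
    {α : List C} (h : M.step s (w i) = some (s', d, α)) (hp : movePos d i = some p) :
    M.sys w (s, i) = some ((s', p), α) := by
  simp [sys, h, hp]

theorem exists_of_sys {M : Mach L S C} {w : ℕ → L} {c c' : S × ℕ} {α : List C}
    (h : M.sys w c = some (c', α)) :
    ∃ d, M.step c.1 (w c.2) = some (c'.1, d, α) ∧ movePos d c.2 = some c'.2 := by
  simp only [sys, Option.bind_eq_some_iff, Option.map_eq_some_iff, Prod.mk.injEq] at h
  obtain ⟨⟨s, d, β⟩, h1, p, h2, rfl, rfl⟩ := h
  exact ⟨d, h1, h2⟩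

theorem sys_eq_none {M : Mach L S C} {w : ℕ → L} {c : S × ℕ} :
    M.sys w c = none ↔ ∀ s' d α, M.step c.1 (w c.2) = some (s', d, α) → movePos d c.2 = none := by
  simp only [sys, Option.bind_eq_none_iff, Option.map_eq_none_iff]
  exact ⟨fun h s' d α e => h _ e, fun h ⟨s', d, α⟩ e => h _ _ _ e⟩

/-- The machine `M` on the tape `w`, started in state `s` at position `i`, has output `y`. -/
def Accepts (M : Mach L S C) (w : ℕ → L) (y : ℕ → C) : Prop :=
  (M.sys w).Acc Prod.snd (M.start, 0) y

end Mach

/-- A two-way transducer as a machine. -/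
def TwoDT.toMach {A B Q : Type*} (T : TwoDT A B Q) : Mach (Option A) Q B where
  start := T.start
  step q l := (T.step q l).map fun r => (r.1, some r.2.1, r.2.2)

/-- Passes from runs as sequences to orbits of a `DetSys`, where machines can be compared by
simulations. -/
theorem TwoDT.rel_iff {A B Q : Type*} (T : TwoDT A B Q) (x : ℕ → A) (y : ℕ → B) :
    T.Rel x y ↔ T.toMach.Accepts (TwoDT.tape x) y := by
  set σ := T.toMach.sys (TwoDT.tape x) with hσ
  change T.Rel x y ↔ σ.Acc Prod.snd (T.start, 0) y
  have hnext : ∀ c c' : Q × ℕ, T.Next x c c' ↔ ∃ α, σ c = some (c', α) := by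
    intro c c'
    constructor
    · rintro ⟨d, α, h1, h2⟩
      refine ⟨α, ?_⟩
      refine Mach.sys_eq_some (d := some d) (by simp [TwoDT.toMach, h1]) ?_
      cases d
      · simp at h2; rw [h2]; rfl
      · simp at h2; rw [h2]; rfl
    · rintro ⟨α, h⟩
      obtain ⟨d, h1, h2⟩ := Mach.exists_of_sys h
      simp only [TwoDT.toMach, Option.map_eq_some_iff, Prod.mk.injEq] at h1
      obtain ⟨⟨q, b, β⟩, h3, h4, rfl, rfl⟩ := h1
      refine ⟨b, β, by rw [h3, ← h4], ?_⟩
      rcases c with ⟨q1, _ | i⟩ <;> cases b <;> simp [movePos] at h2 ⊢ <;> omega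
  have hout : ∀ c : Q × ℕ, ((T.step c.1 (TwoDT.tape x c.2)).map fun t => t.2.2).getD [] =
      ((T.toMach.step c.1 (TwoDT.tape x c.2)).map fun t => t.2.2).getD [] := by
    intro c
    simp only [TwoDT.toMach]
    cases T.step c.1 (TwoDT.tape x c.2) <;> rfl
  have hout2 : ∀ c : Q × ℕ, (σ c).isSome →
      ((T.step c.1 (TwoDT.tape x c.2)).map fun t => t.2.2).getD [] =
      σ.out c := by
    intro c hc
    obtain ⟨⟨c', α⟩, h⟩ := Option.isSome_iff_exists.1 hc
    obtain ⟨d, h1, h2⟩ := Mach.exists_of_sys h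
    rw [hout, DetSys.out_eq h, h1]
    rfl
  constructor
  · rintro ⟨ρ, ⟨h0, hs, hp⟩, ho⟩
    have hconf : ∀ n, σ.conf (T.start, 0) n = ρ n := by
      intro n
      induction n with
      | zero => exact h0.symm
      | succ n ih =>
        obtain ⟨α, h⟩ := (hnext _ _).1 (hs n)
        rw [DetSys.conf_succ, ih, DetSys.next_eq h]
    have hsome : ∀ n, (σ (ρ n)).isSome := fun n => by
      obtain ⟨α, h⟩ := (hnext _ _).1 (hs n)
      simp [h]
    refine ⟨fun n => ?_, ?_, ?_⟩
    · rw [hconf]; exact hsome n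
    · exact hp.congr fun n => congrArg Prod.snd (hconf n).symm
    · have : T.runOutput x ρ = fun n => σ.out (σ.conf (T.start, 0) n) := by
        funext n
        rw [hconf, ← hout2 _ (hsome n)]
        rfl
      exact this ▸ ho
  · rintro ⟨hs, hp, ho⟩
    refine ⟨fun n => σ.conf (T.start, 0) n, ⟨rfl, fun n => ?_, hp⟩, ?_⟩
    · obtain ⟨⟨c', α⟩, h⟩ := Option.isSome_iff_exists.1 (hs n)
      rw [hnext]
      refine ⟨α, ?_⟩
      beta_reduce
      rw [DetSys.conf_succ, show σ.next (σ.conf (T.start, 0) n) = c' from DetSys.next_eq h]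
      exact h
    · have : T.runOutput x (fun n => σ.conf (T.start, 0) n) =
          fun n => σ.out (σ.conf (T.start, 0) n) := by
        funext n
        rw [← hout2 _ (hs n)]
        rfl
      exact this ▸ ho

/-! ### Machines with queries about the predecessor of a node in a layered forest -/

/-- A machine which in some situations asks for the node from which to go on. -/
structure QMach (L S V C : Type*) extends Mach L S C where
  query : S → L → Option V
  resume : S → V → S

/-- The run of a machine with queries, where the answers are given by an oracle that knows the
position and the argument of the query. -/
def QMach.oracleSys {L S V C : Type*} (M : QMach L S V C) (w : ℕ → L) (ans : ℕ → V → Option V) :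
    DetSys (S × ℕ) C := fun c =>
  match M.query c.1 (w c.2) with
  | some v => (ans c.2 v).map fun t => ((M.resume c.1 t, c.2), [])
  | none => M.toMach.sys w c

/-- A layered forest over a tape: the letters determine the candidate nodes of a layer and the
parents of these nodes in the preceding layer. The layers go to the right if `dir = true` and to
the left if `dir = false`. -/
structure Resolver (L V : Type*) where
  cand : L → List V
  parent : L → V → Option V
  dir : Bool

theorem mem_of_lookup_eq_some {α β : Type*} [DecidableEq α] {l : List (α × β)} {a : α} {b : β}
    (h : l.lookup a = some b) : (a, b) ∈ l := by
  induction l with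
  | nil => simp at h
  | cons z l ih =>
    obtain ⟨a', b'⟩ := z
    rw [List.lookup_cons] at h
    by_cases e : a = a'
    · subst e; simp at h; simp [h]
    · rw [show (a == a') = false by simpa using e] at h
      exact List.mem_cons_of_mem _ (ih h)

theorem exists_lookup_of_mem {α β : Type*} [DecidableEq α] {l : List (α × β)} {a : α} {b : β}
    (h : (a, b) ∈ l) : ∃ b', l.lookup a = some b' := by
  induction l with
  | nil => simp at h
  | cons z l ih =>
    obtain ⟨a', b'⟩ := z
    rw [List.lookup_cons]
    by_cases e : a = a'
    · exact ⟨b', by simp [e]⟩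
    · rw [show (a == a') = false by simpa using e]
      refine ih ?_
      rcases List.mem_cons.1 h with h | h
      · exact absurd (Prod.mk.inj h).1 e
      · exact h

/-- All second components are equal. -/
def Uniform {α V : Type*} (φ : List (α × V)) : Prop := ∀ z ∈ φ, φ.head?.map Prod.snd = some z.2

instance {α V : Type*} [DecidableEq V] (φ : List (α × V)) : Decidable (Uniform φ) :=
  inferInstanceAs (Decidable (∀ z ∈ φ, φ.head?.map Prod.snd = some z.2))

/-- The empty list counts as uniform: a search whose descendants have died out stops and, as `head?`
is `none`, has no answer. -/
theorem uniform_iff {α V : Type*} {φ : List (α × V)} :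
    Uniform φ ↔ ∀ z ∈ φ, ∀ z' ∈ φ, z.2 = z'.2 := by
  cases φ with
  | nil => simp [Uniform]
  | cons a l =>
    constructor
    · intro h z hz z' hz'
      have h1 := h z hz
      have h2 := h z' hz'
      simp only [List.head?_cons, Option.map_some, Option.some.injEq] at h1 h2
      exact h1.symm.trans h2
    · intro h z hz
      simp [h a (by simp) z hz]

namespace Resolver

variable {L V : Type*} [DecidableEq V] (G : Resolver L V)

/-- The children of `v` in the layer of the letter `l`, each with itself as its tag. -/
def init (l : L) (v : V) : List (V × V) :=
  (G.cand l).filterMap fun u => if G.parent l u = some v then some (u, u) else none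

/-- The nodes of the next layer with the tags of their parents. -/
def next (l : L) (φ : List (V × V)) : List (V × V) :=
  (G.cand l).filterMap fun u => ((G.parent l u).bind fun p => φ.lookup p).map fun t => (u, t)

/-- Replace nodes by their parents. -/
def back {α : Type*} (l : L) (ψ : List (α × V)) : List (α × V) :=
  ψ.filterMap fun z => (G.parent l z.2).map fun p => (z.1, p)

/-- The descendants of `v` in layer `n`, each with its ancestor among the children of `v`. -/
def layer (ℓ : ℕ → L) (v : V) : ℕ → List (V × V)
  | 0 => G.init (ℓ 0) v
  | n + 1 => G.next (ℓ (n + 1)) (layer ℓ v n)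

/-- The ancestor in layer `0` of a node in layer `n`. -/
def anc (ℓ : ℕ → L) : ℕ → V → Option V
  | 0, u => some u
  | n + 1, u => (G.parent (ℓ (n + 1)) u).bind (anc ℓ n)

open Classical in
/-- The child of `v` that is the ancestor of all nodes in the first layer where there is at most
one such child. -/
noncomputable def answer (ℓ : ℕ → L) (v : V) : Option V :=
  if h : ∃ n, Uniform (G.layer ℓ v n) then (G.layer ℓ v (Nat.find h)).head?.map Prod.snd else none

open Classical in
/-- The layer in which the search for the answer ends. -/
noncomputable def depth (ℓ : ℕ → L) (v : V) : ℕ :=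
  if h : ∃ n, Uniform (G.layer ℓ v n) then Nat.find h else 0

/-- The position of layer `n` seen from position `i`. -/
def place (i n : ℕ) : ℕ := if G.dir then i + n else i - n

/-- The letters of the layers seen from position `i`. -/
def letters (w : ℕ → L) (i n : ℕ) : L := w (G.place i n)

variable {G}

/-- Tags are inherited from parents, so a tag is the ancestor in layer `0`. In particular a node has
only one tag, and repeated entries are harmless. -/
theorem mem_layer {ℓ : ℕ → L} {v : V} {n : ℕ} {z : V × V} (hz : z ∈ G.layer ℓ v n) :
    G.anc ℓ n z.1 = some z.2 ∧ G.parent (ℓ 0) z.2 = some v := by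
  induction n generalizing z with
  | zero =>
    simp only [layer, init, List.mem_filterMap] at hz
    obtain ⟨u, -, hu⟩ := hz
    split_ifs at hu with h
    · obtain rfl := Option.some.inj hu
      exact ⟨rfl, h⟩
  | succ n ih =>
    simp only [layer, next, List.mem_filterMap, Option.map_eq_some_iff, Option.bind_eq_some_iff]
      at hz
    obtain ⟨u, -, t, ⟨p, hp, hl⟩, rfl⟩ := hz
    obtain ⟨h1, h2⟩ := ih (mem_of_lookup_eq_some hl)
    exact ⟨by simp [anc, hp, h1], h2⟩

theorem mem_layer_cand {ℓ : ℕ → L} {v : V} {n : ℕ} {z : V × V} (hz : z ∈ G.layer ℓ v n) :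
    z.1 ∈ G.cand (ℓ n) := by
  cases n with
  | zero =>
    simp only [layer, init, List.mem_filterMap] at hz
    obtain ⟨u, hu', hu⟩ := hz
    split_ifs at hu with h
    · obtain rfl := Option.some.inj hu
      exact hu'
  | succ n =>
    simp only [layer, next, List.mem_filterMap, Option.map_eq_some_iff, Option.bind_eq_some_iff]
      at hz
    obtain ⟨u, hu, t, ⟨p, hp, hl⟩, rfl⟩ := hz
    exact hu

theorem mem_layer_zero {ℓ : ℕ → L} {v u : V} (hu : u ∈ G.cand (ℓ 0))
    (hp : G.parent (ℓ 0) u = some v) : (u, u) ∈ G.layer ℓ v 0 := by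
  simp only [layer, init, List.mem_filterMap]
  exact ⟨u, hu, by simp [hp]⟩

theorem mem_layer_succ {ℓ : ℕ → L} {v : V} {n : ℕ} {p t u : V} (h : (p, t) ∈ G.layer ℓ v n)
    (hu : u ∈ G.cand (ℓ (n + 1))) (hp : G.parent (ℓ (n + 1)) u = some p) :
    (u, t) ∈ G.layer ℓ v (n + 1) := by
  simp only [layer, next, List.mem_filterMap, Option.map_eq_some_iff, Option.bind_eq_some_iff]
  obtain ⟨t', ht'⟩ := exists_lookup_of_mem h
  have h1 := (mem_layer (mem_of_lookup_eq_some ht')).1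
  have h2 := (mem_layer h).1
  have : t' = t := Option.some.inj (h1.symm.trans h2)
  exact ⟨u, hu, t, ⟨p, hp, this ▸ ht'⟩, rfl⟩

/-- The first uniform layer comes no later than layer `N` and still contains the tag `t`, which is
therefore its common tag. -/
theorem answer_eq_some_of_forall {ℓ : ℕ → L} {v t : V} {N : ℕ} (h : Uniform (G.layer ℓ v N))
    (ht : ∀ n ≤ N, ∃ u, (u, t) ∈ G.layer ℓ v n) : G.answer ℓ v = some t := by
  classical
  unfold answer
  rw [dif_pos ⟨N, h⟩]
  have hex : ∃ n, Uniform (G.layer ℓ v n) := ⟨N, h⟩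
  obtain ⟨u, hu⟩ := ht (Nat.find hex) (Nat.find_min' hex h)
  exact Nat.find_spec hex _ hu

theorem tag_mem_cand {ℓ : ℕ → L} {v : V} {n : ℕ} {z : V × V} (hz : z ∈ G.layer ℓ v n) :
    z.2 ∈ G.cand (ℓ 0) := by
  induction n generalizing z with
  | zero =>
    have h := mem_layer_cand hz
    rwa [show z.1 = z.2 from Option.some.inj (mem_layer hz).1] at h
  | succ n ih =>
    simp only [layer, next, List.mem_filterMap, Option.map_eq_some_iff, Option.bind_eq_some_iff]
      at hz
    obtain ⟨u, -, t, ⟨p, hp, hl⟩, rfl⟩ := hz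
    exact ih (z := (p, t)) (mem_of_lookup_eq_some hl)

/-- The layer `n` in the conclusion serves to show that an answer is forced: an infinite path
through `v` meets this layer and so has passed through `t`. -/
theorem answer_eq_some {ℓ : ℕ → L} {v t : V} (h : G.answer ℓ v = some t) :
    G.parent (ℓ 0) t = some v ∧ t ∈ G.cand (ℓ 0) ∧ ∃ n, ∀ z ∈ G.layer ℓ v n, z.2 = t := by
  classical
  unfold answer at h
  split_ifs at h with hex
  obtain ⟨z, hz, rfl⟩ := Option.map_eq_some_iff.1 h
  have hz' := List.mem_of_mem_head? hz
  refine ⟨(mem_layer hz').2, tag_mem_cand hz', Nat.find hex, fun z' h' => ?_⟩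
  exact uniform_iff.1 (Nat.find_spec hex) _ h' _ hz'

theorem back_mem {α : Type*} {l : L} {ψ : List (α × V)} {z : α × V} :
    z ∈ G.back l ψ ↔ ∃ u, (z.1, u) ∈ ψ ∧ G.parent l u = some z.2 := by
  simp only [back, List.mem_filterMap, Option.map_eq_some_iff]
  constructor
  · rintro ⟨⟨a, u⟩, h, p, hp, rfl⟩
    exact ⟨u, h, hp⟩
  · rintro ⟨u, h, hp⟩
    exact ⟨(z.1, u), h, z.2, hp, rfl⟩

theorem place_zero (i : ℕ) : G.place i 0 = i := by simp [place]

theorem movePos_dir {i m : ℕ} (h : G.dir = true ∨ m + 1 ≤ i) :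
    movePos (some G.dir) (G.place i m) = some (G.place i (m + 1)) := by
  unfold place
  cases hd : G.dir
  · simp only [hd, Bool.false_eq_true, false_or] at h
    obtain ⟨k, hk⟩ : ∃ k, i - m = k + 1 := ⟨i - m - 1, by omega⟩
    simp only [Bool.false_eq_true, if_false]
    rw [hk, movePos]
    congr 1; omega
  · rfl

theorem movePos_not_dir {i m : ℕ} (h : G.dir = true ∨ m + 1 ≤ i) :
    movePos (some !G.dir) (G.place i (m + 1)) = some (G.place i m) := by
  unfold place
  cases hd : G.dir
  · simp only [hd, Bool.false_eq_true, false_or] at h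
    simp only [Bool.false_eq_true, if_false, Bool.not_false, movePos]
    congr 1; omega
  · simp [movePos, ← add_assoc]

/-- On the way to the left a search ends at the latest at position `0`, if there is only one
candidate. -/
theorem uniform_layer_left {w : ℕ → L} (hdir : G.dir = false)
    (h0 : (G.cand (w 0)).length ≤ 1) (i : ℕ) (v : V) :
    Uniform (G.layer (G.letters w i) v i) := by
  have hl : G.letters w i i = w 0 := by simp [letters, place, hdir]
  rw [uniform_iff]
  intro z hz z' hz'
  have h1 := mem_layer_cand hz
  have h2 := mem_layer_cand hz'
  rw [hl] at h1 h2
  have h3 : z.1 = z'.1 := by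
    rcases hc : G.cand (w 0) with _ | ⟨a, _ | ⟨b, l⟩⟩
    · simp [hc] at h1
    · simp only [hc, List.mem_singleton] at h1 h2
      rw [h1, h2]
    · simp [hc] at h0
  have h4 := (mem_layer hz).1
  rw [h3, (mem_layer hz').1] at h4
  exact (Option.some.inj h4).symm

/-- The iterated parent on a tape with layers to the left. -/
def forth (G : Resolver L V) (w : ℕ → L) (P : ℕ) : ℕ → V → Option V
  | 0, u => some u
  | m + 1, u => (forth G w P m u).bind (G.parent (w (P + m)))

theorem forth_succ' (w : ℕ → L) (P m : ℕ) (u : V) :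
    G.forth w P (m + 1) u = (G.parent (w P) u).bind (G.forth w (P + 1) m) := by
  induction m with
  | zero =>
    simp only [forth, Option.bind_some, add_zero]
    cases G.parent (w P) u <;> rfl
  | succ m ih =>
    rw [forth, ih]
    cases G.parent (w P) u with
    | none => rfl
    | some p => simp only [Option.bind_some, forth]; congr 3; omega

/-- Layer `m` of a search from `P + m` to the left lies at position `P`. Expressing ancestors as
iterated parents from `P` lets searches with different starting points be compared at one fixed
position. -/
theorem anc_letters (hdir : G.dir = false) (w : ℕ → L) (P m : ℕ) (u : V) :
    G.anc (G.letters w (P + m)) m u = G.forth w P m u := by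
  induction m generalizing P u with
  | zero => rfl
  | succ m ih =>
    rw [forth_succ', anc]
    have : G.letters w (P + (m + 1)) (m + 1) = w P := by simp [letters, place, hdir]
    rw [this]
    congr 1
    funext p
    rw [← ih, show P + (m + 1) = P + 1 + m by omega]

/-- If two candidates at position `P` have different tags but both descend from `v`, then their
`m`-th parents differ and their `(m + 1)`-st parents agree. Merged nodes stay merged, so each of the
finitely many pairs of candidates does this for at most one `m`. -/
theorem finite_not_uniform (hdir : G.dir = false) (w : ℕ → L) (P : ℕ) :
    {m | ∃ v, ¬ Uniform (G.layer (G.letters w (P + m)) v m)}.Finite := by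
  have hsub : {m | ∃ v, ¬ Uniform (G.layer (G.letters w (P + m)) v m)} ⊆
      ⋃ u ∈ {u | u ∈ G.cand (w P)}, ⋃ u' ∈ {u | u ∈ G.cand (w P)},
        {m | G.forth w P m u ≠ G.forth w P m u' ∧
          (G.forth w P (m + 1) u = G.forth w P (m + 1) u')} := by
    rintro m ⟨v, hm⟩
    rw [uniform_iff] at hm
    push Not at hm
    obtain ⟨z, hz, z', hz', hne⟩ := hm
    have h1 := mem_layer_cand hz
    have h2 := mem_layer_cand hz'
    have hP : G.letters w (P + m) m = w P := by simp [letters, place, hdir]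
    have h0 : G.letters w (P + m) 0 = w (P + m) := by simp [letters, place]
    rw [hP] at h1 h2
    obtain ⟨h3, h4⟩ := mem_layer hz
    obtain ⟨h5, h6⟩ := mem_layer hz'
    rw [anc_letters hdir] at h3 h5
    rw [h0] at h4 h6
    simp only [Set.mem_iUnion]
    refine ⟨z.1, h1, z'.1, h2, ?_, ?_⟩
    · rw [h3, h5]; exact fun e => hne (Option.some.inj e)
    · simp only [forth, h3, h5, Option.bind_some, h4, h6]
  refine Set.Finite.subset ?_ hsub
  refine (List.finite_toSet _).biUnion fun u _ => (List.finite_toSet _).biUnion fun u' _ => ?_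
  refine Set.Subsingleton.finite ?_
  have key : ∀ m m' : ℕ, m < m' → G.forth w P (m + 1) u = G.forth w P (m + 1) u' →
      G.forth w P m' u = G.forth w P m' u' := by
    intro m m' hlt h
    induction m', hlt using Nat.le_induction with
    | base => exact h
    | succ k _ ih => simp only [forth, ih]
  rintro m ⟨h1, h2⟩ m' ⟨h3, h4⟩
  rcases lt_trichotomy m m' with h | h | h
  · exact absurd (key _ _ h h2) h3
  · exact h
  · exact absurd (key _ _ h h4) h1

theorem depth_le {ℓ : ℕ → L} {v : V} {n : ℕ} (h : Uniform (G.layer ℓ v n)) :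
    G.depth ℓ v ≤ n := by
  classical
  unfold depth
  rw [dif_pos ⟨n, h⟩]
  exact Nat.find_min' _ h

/-- Searches to the left that start far to the right end far to the right. -/
theorem exists_le_sub_depth (hdir : G.dir = false) (w : ℕ → L) (P : ℕ) :
    ∃ P', ∀ i v, P' ≤ i → P ≤ i - G.depth (G.letters w i) v := by
  obtain ⟨m, hm⟩ := (finite_not_uniform hdir w P).bddAbove
  refine ⟨P + (m + 1), fun i v hi => ?_⟩
  obtain ⟨k, rfl⟩ : ∃ k, i = P + k := ⟨i - P, by omega⟩
  have : Uniform (G.layer (G.letters w (P + k)) v k) := by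
    by_contra hc
    have := hm (show k ∈ _ from ⟨v, hc⟩)
    omega
  have := depth_le this
  omega

end Resolver

/-! ### Answering queries by a two-way search -/

/-- The machine that computes the answers to the queries of `M` itself: it follows the layers of
`G` until all remaining nodes descend from one child, and then goes back along the parents until
these meet. -/
def QMach.resolve {L S V C : Type*} [DecidableEq V] (M : QMach L S V C) (G : Resolver L V) :
    Mach L (S × ℕ × List (V × V)) C where
  start := (M.start, 0, [])
  step q l :=
    -- Mode `0` runs `M` and starts searches, mode `1` follows the layers, mode `2` goes back.
    if q.2.1 = 0 then
      match M.query q.1 l with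
      | none => (M.step q.1 l).map fun r => ((r.1, 0, []), r.2)
      | some v =>
        if Uniform (G.init l v) then
          (G.init l v).head?.map fun z => ((M.resume q.1 z.2, 0, []), none, [])
        else some ((q.1, 1, G.init l v), some G.dir, [])
    else if q.2.1 = 1 then
      -- The list holds the layer before that of the head, so when the new layer is uniform, the
      -- last layer with two tags is still available.
      if Uniform (G.next l q.2.2) then
        (G.next l q.2.2).head?.map fun z =>
          -- The old tags are dropped. Every node of the last non-uniform layer now carries the
          -- answer, and on the way back only the nodes themselves are compared.
          ((q.1, 2, q.2.2.map fun x => (z.2, x.1)), some !G.dir, [])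
      else some ((q.1, 1, G.next l q.2.2), some G.dir, [])
    else
      -- The parents coincide only when they are the node of the query, that is, when the head is
      -- back where the search began.
      if Uniform (G.back l q.2.2) then
        (G.back l q.2.2).head?.map fun z => ((M.resume q.1 z.1, 0, []), none, [])
      else some ((q.1, 2, G.back l q.2.2), some !G.dir, [])

namespace QMach

variable {L S V C : Type*} [DecidableEq V] {M : QMach L S V C} {G : Resolver L V} {w : ℕ → L}

/-- The configuration of the resolving machine after `n` steps of a search. -/
def searchConf (G : Resolver L V) (w : ℕ → L) (s : S) (i : ℕ) (v : V) :
    ℕ → (S × ℕ × List (V × V)) × ℕ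
  | 0 => ((s, 0, []), i)
  | m + 1 => ((s, 1, G.layer (G.letters w i) v m), G.place i (m + 1))

/-- Going on with the search as long as no layer is uniform. -/
theorem resolve_conf {s : S} {i : ℕ} {v : V} (hq : M.query s (w i) = some v) {n : ℕ}
    (hn : ∀ m < n, ¬ Uniform (G.layer (G.letters w i) v m)) (hle : G.dir = true ∨ n ≤ i) :
    ((M.resolve G).sys w).Seg Prod.snd (min i (G.place i n)) n ((s, 0, []), i)
      (searchConf G w s i v n) [] := by
  induction n with
  | zero => exact DetSys.Seg.refl ..
  | succ n ih =>
    have h1 := ih (fun m hm => hn m (by omega)) (hle.imp id fun h => by omega)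
    have hmin : min i (G.place i (n + 1)) ≤ min i (G.place i n) ∧
        min i (G.place i (n + 1)) ≤ G.place i n := by
      unfold Resolver.place
      cases G.dir
      all_goals (simp; try omega)
    have h1' : ((M.resolve G).sys w).Seg Prod.snd (min i (G.place i (n + 1))) n _ _ _ :=
      ⟨h1.1, fun m hm => ⟨(h1.2.1 m hm).1, hmin.1.trans (h1.2.1 m hm).2⟩, h1.2.2⟩
    have hnu := hn n (by omega)
    have h2 : (M.resolve G).sys w (searchConf G w s i v n) =
        some (searchConf G w s i v (n + 1), []) := by
      cases n with
      | zero =>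
        refine Mach.sys_eq_some (d := some G.dir) ?_ ?_
        · have : G.layer (G.letters w i) v 0 = G.init (w i) v := by
            simp [Resolver.layer, Resolver.letters, Resolver.place_zero]
          rw [this] at hnu ⊢
          simp [resolve, hq, hnu]
        · have := Resolver.movePos_dir (G := G) (i := i) (m := 0) hle
          rwa [Resolver.place_zero] at this
      | succ n =>
        refine Mach.sys_eq_some (d := some G.dir) ?_ (Resolver.movePos_dir hle)
        have : G.layer (G.letters w i) v (n + 1) =
          G.next (w (G.place i (n + 1))) (G.layer (G.letters w i) v n) := rfl
        rw [this] at hnu ⊢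
        simp [resolve, hnu]
    refine h1'.trans (DetSys.Seg.single h2 ?_)
    cases n with
    | zero => rw [Resolver.place_zero] at hmin; exact hmin.2
    | succ n => exact hmin.2

/-- Going back to the start of the search. -/
theorem resolve_back {s : S} {i : ℕ} {v t : V} (m : ℕ) (ψ : List (V × V))
    (hψ : ∀ z ∈ ψ, z.1 = t ∧ ∃ τ, G.anc (G.letters w i) m z.2 = some τ ∧
      G.parent (w i) τ = some v)
    (hne : ∃ z ∈ ψ, ∃ z' ∈ ψ, G.anc (G.letters w i) m z.2 ≠ G.anc (G.letters w i) m z'.2)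
    (hle : G.dir = true ∨ m + 1 ≤ i) :
    ∃ k, ((M.resolve G).sys w).Seg Prod.snd (min i (G.place i (m + 1))) k
      ((s, 2, ψ), G.place i m) ((M.resume s t, 0, []), i) [] := by
  induction m generalizing ψ with
  | zero =>
    -- The nodes of layer `0` are children of `v`, so here the parents coincide and the way back
    -- ends.
    have hmem : ∀ z ∈ G.back (w i) ψ, z = (t, v) := by
      intro z hz
      obtain ⟨u, hu, hp⟩ := Resolver.back_mem.1 hz
      obtain ⟨h1, τ, h2, h3⟩ := hψ _ hu
      obtain rfl : u = τ := Option.some.inj h2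
      exact Prod.ext h1 (Option.some.inj (hp.symm.trans h3))
    have hunif : Uniform (G.back (w i) ψ) := by
      rw [uniform_iff]
      intro z hz z' hz'
      rw [hmem z hz, hmem z' hz']
    obtain ⟨z, hz, -⟩ := hne
    obtain ⟨h1, τ, h2, h3⟩ := hψ z hz
    obtain rfl : z.2 = τ := Option.some.inj h2
    have hin : (t, v) ∈ G.back (w i) ψ :=
      Resolver.back_mem.2 ⟨z.2, by rw [← h1]; exact hz, h3⟩
    have hhead : (G.back (w i) ψ).head? = some (t, v) := by
      rcases hb : G.back (w i) ψ with _ | ⟨a, l⟩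
      · simp [hb] at hin
      · rw [List.head?_cons, hmem a (by simp [hb])]
    refine ⟨1, ?_⟩
    rw [Resolver.place_zero]
    refine DetSys.Seg.single (Mach.sys_eq_some (d := none) ?_ rfl) (min_le_left _ _)
    simp [resolve, hunif, hhead]
  | succ m ih =>
    have hl : G.letters w i (m + 1) = w (G.place i (m + 1)) := rfl
    set l := w (G.place i (m + 1)) with hldef
    have hstep : ∀ z ∈ ψ, ∃ p, (z.1, p) ∈ G.back l ψ ∧
        G.anc (G.letters w i) m p = G.anc (G.letters w i) (m + 1) z.2 := by
      intro z hz
      obtain ⟨-, τ, h2, -⟩ := hψ z hz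
      have h2' := h2
      simp only [Resolver.anc, hl, Option.bind_eq_some_iff] at h2'
      obtain ⟨p, hp, h3⟩ := h2'
      exact ⟨p, Resolver.back_mem.2 ⟨z.2, hz, hp⟩, h3.trans h2.symm⟩
    have hψ' : ∀ z ∈ G.back l ψ, z.1 = t ∧ ∃ τ, G.anc (G.letters w i) m z.2 = some τ ∧
        G.parent (w i) τ = some v := by
      intro z hz
      obtain ⟨u, hu, hp⟩ := Resolver.back_mem.1 hz
      obtain ⟨h1, τ, h2, h3⟩ := hψ _ hu
      refine ⟨h1, τ, ?_, h3⟩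
      simpa [Resolver.anc, hl, hp] using h2
    -- Nodes with different ancestors in layer `0` have different parents in all layers above it, so
    -- the way back does not end too early.
    have hne' : ∃ z ∈ G.back l ψ, ∃ z' ∈ G.back l ψ,
        G.anc (G.letters w i) m z.2 ≠ G.anc (G.letters w i) m z'.2 := by
      obtain ⟨z, hz, z', hz', h⟩ := hne
      obtain ⟨p, hp, e⟩ := hstep z hz
      obtain ⟨p', hp', e'⟩ := hstep z' hz'
      exact ⟨_, hp, _, hp', by rwa [e, e']⟩
    have hnu : ¬ Uniform (G.back l ψ) := by
      rw [uniform_iff]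
      intro h
      obtain ⟨z, hz, z', hz', h'⟩ := hne'
      exact h' (by rw [h z hz z' hz'])
    have hle' : G.dir = true ∨ m + 1 ≤ i := hle.imp id fun h => by omega
    obtain ⟨k, hk⟩ := ih _ hψ' hne' hle'
    have hmin : min i (G.place i (m + 1 + 1)) ≤ min i (G.place i (m + 1)) := by
      unfold Resolver.place
      cases G.dir <;> simp
      omega
    refine ⟨k + 1, DetSys.Seg.cons (α := []) (β := []) (Mach.sys_eq_some (d := some !G.dir) ?_
      (Resolver.movePos_not_dir hle')) ?_
      ⟨hk.1, fun j hj => ⟨(hk.2.1 j hj).1, hmin.trans (hk.2.1 j hj).2⟩, hk.2.2⟩⟩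
    · simp [resolve, ← hldef, hnu]
    · exact hmin.trans (min_le_right _ _)

/-- What a search from position `i` does. -/
theorem resolve_search {s : S} {i : ℕ} {v : V} (hq : M.query s (w i) = some v)
    (h0 : G.dir = true ∨ (G.cand (w 0)).length ≤ 1) :
    match G.answer (G.letters w i) v with
    | none => ¬ ((M.resolve G).sys w).Live Prod.snd ((s, 0, []), i)
    | some t => ∃ n, ((M.resolve G).sys w).Seg Prod.snd
        (min i (G.place i (G.depth (G.letters w i) v))) (n + 1) ((s, 0, []), i)
        ((M.resume s t, 0, []), i) [] := by
  classical
  by_cases hex : ∃ n, Uniform (G.layer (G.letters w i) v n)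
  · have hdepth : G.depth (G.letters w i) v = Nat.find hex := by
      rw [Resolver.depth, dif_pos hex]
    have hans : G.answer (G.letters w i) v =
        (G.layer (G.letters w i) v (Nat.find hex)).head?.map Prod.snd := by
      rw [Resolver.answer, dif_pos hex]
    rw [hdepth, hans]
    have hspec := Nat.find_spec hex
    have hmin : ∀ m < Nat.find hex, ¬ Uniform (G.layer (G.letters w i) v m) :=
      fun m hm => Nat.find_min hex hm
    have hle : G.dir = true ∨ Nat.find hex ≤ i := by
      rcases h0 with h0 | h0
      · exact .inl h0
      · cases hd : G.dir
        · exact .inr (Nat.find_min' hex (Resolver.uniform_layer_left hd h0 i v))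
        · exact .inl rfl
    have hseg := resolve_conf (M := M) hq hmin hle
    generalize Nat.find hex = n at hspec hmin hle hseg
    cases n with
    | zero =>
      have hl : G.layer (G.letters w i) v 0 = G.init (w i) v := by
        simp [Resolver.layer, Resolver.letters, Resolver.place_zero]
      rw [hl] at hspec ⊢
      cases hh : (G.init (w i) v).head? with
      | none =>
        intro hlive
        have := hlive.1 0
        simp [DetSys.conf, Mach.sys, resolve, hq, hspec, hh] at this
      | some z =>
        refine ⟨0, DetSys.Seg.single (Mach.sys_eq_some (d := none) ?_ rfl) (min_le_left _ _)⟩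
        simp [resolve, hq, hspec, hh]
    | succ n =>
      have hl : G.layer (G.letters w i) v (n + 1) =
          G.next (w (G.place i (n + 1))) (G.layer (G.letters w i) v n) := rfl
      rw [hl] at hspec ⊢
      cases hh : (G.next (w (G.place i (n + 1))) (G.layer (G.letters w i) v n)).head? with
      | none =>
        intro hlive
        have := (hseg.live hlive).1 0
        simp [searchConf, DetSys.conf, Mach.sys, resolve, hspec, hh] at this
      | some z =>
        have hzl : (Option.map Prod.snd (some z)) = some z.2 := rfl
        rw [hzl]
        have hstep : (M.resolve G).sys w
            ((s, 1, G.layer (G.letters w i) v n), G.place i (n + 1)) =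
            some (((s, 2, (G.layer (G.letters w i) v n).map fun x => (z.2, x.1)), G.place i n),
              []) := by
          refine Mach.sys_eq_some (d := some !G.dir) ?_ (Resolver.movePos_not_dir hle)
          simp [resolve, hspec, hh]
        have hw0 : G.letters w i 0 = w i := by simp [Resolver.letters, Resolver.place_zero]
        obtain ⟨k, hk⟩ := resolve_back (M := M) (s := s) (v := v) (t := z.2) n
          ((G.layer (G.letters w i) v n).map fun x => (z.2, x.1)) (by
            intro y hy
            obtain ⟨x, hx, rfl⟩ := List.mem_map.1 hy
            have := Resolver.mem_layer hx
            rw [hw0] at this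
            exact ⟨rfl, x.2, this⟩) (by
            have := hmin n (by omega)
            rw [uniform_iff] at this
            push Not at this
            obtain ⟨x, hx, x', hx', h⟩ := this
            refine ⟨_, List.mem_map.2 ⟨x, hx, rfl⟩, _, List.mem_map.2 ⟨x', hx', rfl⟩, ?_⟩
            rw [(Resolver.mem_layer hx).1, (Resolver.mem_layer hx').1]
            exact fun e => h (Option.some.inj e)) hle
        have := hseg.trans (DetSys.Seg.cons hstep (min_le_right _ _) hk)
        exact ⟨n + 1 + k, this⟩
  · have hans : G.answer (G.letters w i) v = none := by rw [Resolver.answer, dif_neg hex]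
    rw [hans]
    push Not at hex
    -- A search to the left would have found a uniform layer at position `0` at the latest.
    have hdir : G.dir = true := by
      rcases h0 with h0 | h0
      · exact h0
      · by_contra hd
        exact hex i (Resolver.uniform_layer_left (by simpa using hd) h0 i v)
    -- An endless search has no output at all, whereas a live run has infinitely many nonempty
    -- outputs.
    intro hlive
    obtain ⟨m, -, hm⟩ := hlive.2.2 0
    have hseg := resolve_conf (M := M) hq (n := m + 1) (fun k _ => hex k) (.inl hdir)
    have h2 := hseg.2.2
    rw [concatPrefix_succ] at h2
    exact hm (List.append_eq_nil_iff.1 h2).2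

/-- The machine `M.resolve G` does the same as `M` with the right answers to its queries. -/
theorem accepts_resolve_iff (M : QMach L S V C) (G : Resolver L V) (w : ℕ → L)
    (h0 : G.dir = true ∨ (G.cand (w 0)).length ≤ 1) (y : ℕ → C) :
    (M.resolve G).Accepts w y ↔
      (M.oracleSys w fun i => G.answer (G.letters w i)).Acc Prod.snd (M.start, 0) y := by
  symm
  -- A search to the left visits positions down to that of its last layer; by `exists_le_sub_depth`
  -- these tend to infinity with the starting position. A search to the right never goes below its
  -- start.
  let low : (S × ℕ × List (V × V)) × ℕ → ℕ := fun c =>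
    match M.query c.1.1 (w c.2) with
    | none => c.2
    | some v => min c.2 (G.place c.2 (G.depth (G.letters w c.2) v))
  refine DetSys.Simulation.acc_iff (R := fun c c' => c' = ((c.1, 0, []), c.2)) (low := low)
    ⟨?_, ?_, ?_, ?_⟩ rfl y
  · rintro ⟨s, i⟩ c' rfl hn
    dsimp only [oracleSys] at hn ⊢
    cases hq : M.query s (w i) with
    | none =>
      rw [hq] at hn
      intro hlive
      have h1 := hlive.1 0
      simp only [Mach.sys, Option.bind_eq_none_iff, Option.map_eq_none_iff] at hn
      have h2 : (M.resolve G).sys w ((s, 0, []), i) = none := by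
        simp only [Mach.sys, resolve, hq, if_true, Option.bind_eq_none_iff, Option.map_eq_none_iff,
          Option.map_eq_some_iff]
        rintro r ⟨r', hr', rfl⟩
        exact hn r' hr'
      simp [DetSys.conf, h2] at h1
    | some v =>
      rw [hq] at hn
      have := resolve_search (M := M) hq h0
      rw [Option.map_eq_none_iff.1 hn] at this
      exact this
  · rintro ⟨s, i⟩ c' ⟨s₁, j⟩ α rfl hs
    dsimp only [oracleSys] at hs
    dsimp only [low]
    cases hq : M.query s (w i) with
    | none =>
      rw [hq] at hs
      obtain ⟨d, h1, h2⟩ := Mach.exists_of_sys hs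
      refine ⟨0, ((s₁, 0, []), j), DetSys.Seg.single (Mach.sys_eq_some (d := d) ?_ h2) le_rfl, rfl⟩
      simp only at h1
      simp [resolve, hq, h1]
    | some v =>
      rw [hq] at hs
      obtain ⟨t, ht, he⟩ := Option.map_eq_some_iff.1 hs
      simp only [Prod.mk.injEq] at he
      obtain ⟨⟨rfl, rfl⟩, rfl⟩ := he
      have := resolve_search (M := M) hq h0
      rw [ht] at this
      obtain ⟨n, hn⟩ := this
      exact ⟨n, _, hn, rfl⟩
  · intro P
    cases hd : G.dir
    · obtain ⟨P', hP'⟩ := Resolver.exists_le_sub_depth hd w P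
      refine ⟨max P P', ?_⟩
      rintro ⟨s, i⟩ c' rfl hi
      simp only at hi
      have h1 : P ≤ i := (le_max_left _ _).trans hi
      dsimp only [low]
      cases hq : M.query s (w i) with
      | none => exact h1
      | some v =>
        refine le_min h1 ?_
        simp only [Resolver.place, hd, Bool.false_eq_true, if_false]
        exact hP' i v ((le_max_right _ _).trans hi)
    · refine ⟨P, ?_⟩
      rintro ⟨s, i⟩ c' rfl hi
      dsimp only [low]
      simp only at hi
      cases hq : M.query s (w i) with
      | none => exact hi
      | some v =>
        refine le_min hi ?_
        simp only [Resolver.place, hd, if_true]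
        omega
  · intro P
    refine ⟨P, ?_⟩
    rintro ⟨s, i⟩ c' rfl hi
    exact hi

end QMach

/-! ### Elimination of stay moves -/

/-- A stay move is replaced by a move to the right and a move to the left. -/
def Mach.toTwoDT {A S C : Type*} (M : Mach (Option A) S C) : TwoDT A C (S × Bool) where
  start := (M.start, false)
  step q l :=
    if q.2 then some ((q.1, false), false, [])
    else (M.step q.1 l).map fun r => ((r.1, r.2.1.isNone), r.2.1.getD true, r.2.2)

theorem Mach.rel_toTwoDT_iff {A S C : Type*} (M : Mach (Option A) S C) (x : ℕ → A) (y : ℕ → C) :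
    M.toTwoDT.Rel x y ↔ M.Accepts (TwoDT.tape x) y := by
  rw [TwoDT.rel_iff]
  symm
  refine DetSys.Simulation.acc_iff (R := fun c c' => c' = ((c.1, false), c.2))
    (low := fun c => c.2) ⟨?_, ?_, ?_, ?_⟩ rfl y
  · rintro ⟨s, i⟩ c' rfl hn hlive
    have h1 := hlive.1 0
    rw [Mach.sys_eq_none] at hn
    simp only at hn
    have h2 : M.toTwoDT.toMach.sys (TwoDT.tape x) ((s, false), i) = none := by
      rw [Mach.sys_eq_none]
      intro s' d α h
      simp only [TwoDT.toMach, Mach.toTwoDT, Bool.false_eq_true, if_false, Option.map_map,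
        Option.map_eq_some_iff, Function.comp, Prod.mk.injEq] at h
      obtain ⟨⟨r, d', β⟩, h, -, rfl, -⟩ := h
      have := hn _ _ _ h
      cases d' with
      | none => simp [movePos] at this
      | some b => exact this
    simp [DetSys.conf, h2] at h1
  · rintro ⟨s, i⟩ c' ⟨s₁, j⟩ α rfl hs
    obtain ⟨d, h1, h2⟩ := Mach.exists_of_sys hs
    simp only at h1 h2
    cases d with
    | none =>
      obtain rfl : i = j := Option.some.inj h2
      refine ⟨1, ((s₁, false), i), ?_, rfl⟩
      have h3 : M.toTwoDT.toMach.sys (TwoDT.tape x) ((s, false), i) =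
          some (((s₁, true), i + 1), α) :=
        Mach.sys_eq_some (d := some true) (by simp [TwoDT.toMach, Mach.toTwoDT, h1]) rfl
      have h4 : M.toTwoDT.toMach.sys (TwoDT.tape x) ((s₁, true), i + 1) =
          some (((s₁, false), i), []) :=
        Mach.sys_eq_some (d := some false) (by simp [TwoDT.toMach, Mach.toTwoDT]) rfl
      have := (DetSys.Seg.single (pos := Prod.snd) h3 (le_refl i)).trans
        (DetSys.Seg.single h4 (Nat.le_succ i))
      rwa [List.append_nil] at this
    | some b =>
      refine ⟨0, ((s₁, false), j), DetSys.Seg.single (Mach.sys_eq_some (d := some b) ?_ h2) le_rfl,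
        rfl⟩
      simp [TwoDT.toMach, Mach.toTwoDT, h1]
  · exact fun P => ⟨P, by rintro ⟨s, i⟩ c' rfl hi; exact hi⟩
  · exact fun P => ⟨P, by rintro ⟨s, i⟩ c' rfl hi; exact hi⟩

/-! ### Machines that see the states of a deterministic automaton -/

/-- The states of the deterministic automaton `δ` on the tape `w`. -/
def autStates {L X : Type*} (δ : X → L → X) (d₀ : X) (w : ℕ → L) : ℕ → X
  | 0 => d₀
  | i + 1 => δ (autStates δ d₀ w i) (w i)

/-- The machine keeps the state of the automaton; after a move to the left it asks for it. -/
def Mach.lookbehind {L S C X : Type*} (M : Mach (L × X) S C) (δ : X → L → X) (d₀ : X) :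
    QMach L (Bool × S × X) X C where
  start := (false, M.start, d₀)
  step q l := (M.step q.2.1 (l, q.2.2)).map fun r =>
    -- After a left move the old automaton state is kept: it is the argument of the query for the
    -- state before it.
    ((r.2.1 == some false, r.1, if r.2.1 = some true then δ q.2.2 l else q.2.2), r.2)
  query q _ := if q.1 then some q.2.2 else none
  resume q t := (false, q.2.1, t)

/-- The states of a deterministic automaton as layers to the left. -/
def autResolver {L X : Type*} (δ : X → L → X) (cand : L → List X) : Resolver L X where
  cand := cand
  parent l d := some (δ d l)
  dir := false

/-- The actual run of the automaton contributes to every layer a node with the tag `autStates δ d₀ w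
i`, and the single candidate at position `0` forces some layer to be uniform. So this tag is the
answer. -/
theorem autResolver_answer {L X : Type*} [DecidableEq X] {δ : X → L → X} {d₀ : X}
    {cand : L → List X} {w : ℕ → L} (h0 : cand (w 0) = [d₀])
    (hc : ∀ i, autStates δ d₀ w i ∈ cand (w i)) (i : ℕ) :
    (autResolver δ cand).answer ((autResolver δ cand).letters w i) (autStates δ d₀ w (i + 1)) =
      some (autStates δ d₀ w i) := by
  refine Resolver.answer_eq_some_of_forall (N := i)
    (Resolver.uniform_layer_left rfl (by simp [autResolver, h0]) i _) fun n hn => ?_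
  refine ⟨autStates δ d₀ w (i - n), ?_⟩
  have hl : ∀ n, (autResolver δ cand).letters w i n = w (i - n) := fun n => by
    simp [Resolver.letters, Resolver.place, autResolver]
  induction n with
  | zero =>
    refine Resolver.mem_layer_zero ?_ ?_
    · rw [hl]; exact hc i
    · rw [hl]; rfl
  | succ n ih =>
    refine Resolver.mem_layer_succ (ih (by omega)) ?_ ?_
    · rw [hl]; exact hc _
    · rw [hl]
      have : i - n = i - (n + 1) + 1 := by omega
      rw [this]
      rfl

theorem Mach.accepts_lookbehind_iff {L S C X : Type*} [DecidableEq X] (M : Mach (L × X) S C)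
    {δ : X → L → X} {d₀ : X} {cand : L → List X} {w : ℕ → L} (h0 : cand (w 0) = [d₀])
    (hc : ∀ i, autStates δ d₀ w i ∈ cand (w i)) (y : ℕ → C) :
    ((M.lookbehind δ d₀).resolve (autResolver δ cand)).Accepts w y ↔
      M.Accepts (fun i => (w i, autStates δ d₀ w i)) y := by
  rw [QMach.accepts_resolve_iff _ _ _ (.inr (by simp [autResolver, h0]))]
  symm
  refine DetSys.Simulation.acc_iff
    (R := fun c c' => c' = ((false, c.1, autStates δ d₀ w c.2), c.2))
    -- A left move is followed by a query at the new position, hence the `- 1`.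
    (low := fun c => c.2 - 1) ⟨?_, ?_, ?_, ?_⟩ rfl y
  · rintro ⟨s, i⟩ c' rfl hn hlive
    have h1 := hlive.1 0
    rw [Mach.sys_eq_none] at hn
    simp only at hn
    have h2 : (M.lookbehind δ d₀).toMach.sys w ((false, s, autStates δ d₀ w i), i) = none := by
      rw [Mach.sys_eq_none]
      intro s' d α h
      simp only [lookbehind, Option.map_eq_some_iff, Prod.mk.injEq] at h
      obtain ⟨⟨r, d', β⟩, h, -, rfl, -⟩ := h
      exact hn _ _ _ h
    simp [DetSys.conf, QMach.oracleSys, lookbehind] at h1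
    simp only [lookbehind] at h2
    rw [h2] at h1
    simp at h1
  · rintro ⟨s, i⟩ c' ⟨s₁, j⟩ α rfl hs
    obtain ⟨d, h1, h2⟩ := Mach.exists_of_sys hs
    simp only at h1 h2
    have h3 : (M.lookbehind δ d₀).oracleSys w
        (fun i => (autResolver δ cand).answer ((autResolver δ cand).letters w i))
        ((false, s, autStates δ d₀ w i), i) =
        some (((d == some false, s₁, if d = some true then autStates δ d₀ w (i + 1) else
          autStates δ d₀ w i), j), α) := by
      have : (M.lookbehind δ d₀).query (false, s, autStates δ d₀ w i) (w i) = none := rfl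
      simp only [QMach.oracleSys, this]
      refine Mach.sys_eq_some (d := d) ?_ h2
      simp [lookbehind, h1, autStates]
    rcases d with _ | _ | _
    · obtain rfl : i = j := Option.some.inj h2
      exact ⟨0, _, DetSys.Seg.single h3 (Nat.sub_le _ _), rfl⟩
    · obtain _ | i := i
      · simp [movePos] at h2
      · obtain rfl : i = j := Option.some.inj h2
        refine ⟨1, ((false, s₁, autStates δ d₀ w i), i), ?_, rfl⟩
        have h4 : (M.lookbehind δ d₀).oracleSys w
            (fun i => (autResolver δ cand).answer ((autResolver δ cand).letters w i))
            ((true, s₁, autStates δ d₀ w (i + 1)), i) =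
            some (((false, s₁, autStates δ d₀ w i), i), []) := by
          have : (M.lookbehind δ d₀).query (true, s₁, autStates δ d₀ w (i + 1)) (w i) =
            some (autStates δ d₀ w (i + 1)) := rfl
          simp only [QMach.oracleSys, this, autResolver_answer h0 hc]
          rfl
        have := (DetSys.Seg.single (pos := Prod.snd) h3 (Nat.le_succ i)).trans
          (DetSys.Seg.single h4 le_rfl)
        rwa [List.append_nil] at this
    · obtain rfl : i + 1 = j := Option.some.inj h2
      exact ⟨0, _, DetSys.Seg.single h3 (Nat.sub_le _ _), rfl⟩
  · exact fun P => ⟨P + 1, by rintro ⟨s, i⟩ c' rfl hi; simp only at hi ⊢; omega⟩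
  · exact fun P => ⟨P, by rintro ⟨s, i⟩ c' rfl hi; exact hi⟩

/-! ### König's lemma -/

/-- There is a path with `m` steps from `u` in level `n`. -/
def HasLongPath {V : Type*} (E : ℕ → V → V → Prop) (D : ℕ → Set V) : ℕ → ℕ → V → Prop
  | 0, n, u => u ∈ D n
  | m + 1, n, u => u ∈ D n ∧ ∃ u', E n u u' ∧ HasLongPath E D m (n + 1) u'

theorem HasLongPath.mem {V : Type*} {E : ℕ → V → V → Prop} {D : ℕ → Set V} {m n : ℕ} {u : V}
    (h : HasLongPath E D m n u) : u ∈ D n := by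
  cases m with
  | zero => exact h
  | succ m => exact h.1

theorem HasLongPath.mono {V : Type*} {E : ℕ → V → V → Prop} {D : ℕ → Set V} {k m n : ℕ} {u : V}
    (h : HasLongPath E D m n u) (hk : k ≤ m) : HasLongPath E D k n u := by
  induction k generalizing m n u with
  | zero => exact h.mem
  | succ k ih =>
    obtain ⟨m, rfl⟩ : ∃ m', m = m' + 1 := ⟨m - 1, by omega⟩
    obtain ⟨h1, u', h2, h3⟩ := h
    exact ⟨h1, u', h2, ih h3 (by omega)⟩

/-- Since all nodes have predecessors, going back from later levels gives paths of every length from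
every level. All levels lie in the finite set `K`, so by the pigeonhole principle some node starts
paths of all lengths, and then so does one of its successors. -/
theorem exists_infinite_path {V : Type*} {K : Set V} (hK : K.Finite) (E : ℕ → V → V → Prop)
    (D : ℕ → Set V) (hD : ∀ n, (D n).Nonempty) (hDK : ∀ n, D n ⊆ K)
    (hpred : ∀ n, ∀ u ∈ D (n + 1), ∃ p ∈ D n, E n p u) :
    ∃ u : ℕ → V, (∀ n, u n ∈ D n) ∧ ∀ n, E n (u n) (u (n + 1)) := by
  have hlong : ∀ m n, ∃ u, HasLongPath E D m n u := by
    have : ∀ k j n u, HasLongPath E D j (n + k) u → ∃ p, HasLongPath E D (j + k) n p := by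
      intro k
      induction k with
      | zero => exact fun j n u h => ⟨u, h⟩
      | succ k ih =>
        intro j n u h
        obtain ⟨p, hp, hE⟩ := hpred (n + k) u h.mem
        obtain ⟨q, hq⟩ := ih (j + 1) n p ⟨hp, u, hE, h⟩
        exact ⟨q, by rwa [show j + (k + 1) = j + 1 + k by omega]⟩
    intro m n
    obtain ⟨u, hu⟩ := hD (n + m)
    obtain ⟨p, hp⟩ := this m 0 n u hu
    exact ⟨p, by rwa [zero_add] at hp⟩
  have hpigeon : ∀ (n : ℕ) (P : V → Prop), (∀ m, ∃ u, P u ∧ HasLongPath E D m n u) →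
      ∃ u, P u ∧ ∀ m, HasLongPath E D m n u := by
    intro n P h
    by_contra! hc
    choose! g hg using hc
    -- `g u` is a length for which there is no path from `u`; the supremum over `K` is too long for
    -- all candidates at once.
    obtain ⟨u, hu, hl⟩ := h (hK.toFinset.sup g)
    refine hg u hu (hl.mono (Finset.le_sup (f := g) ?_))
    exact hK.mem_toFinset.2 (hDK n hl.mem)
  obtain ⟨u₀, -, hu₀⟩ := hpigeon 0 (fun _ => True) fun m =>
    let ⟨u, hu⟩ := hlong m 0
    ⟨u, trivial, hu⟩
  have hstep : ∀ n u, (∀ m, HasLongPath E D m n u) →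
      ∃ u', E n u u' ∧ ∀ m, HasLongPath E D m (n + 1) u' := fun n u h =>
    hpigeon (n + 1) (E n u) fun m => (h (m + 1)).2
  choose g hg using hstep
  let T : (n : ℕ) → {u : V // ∀ m, HasLongPath E D m n u} := fun n =>
    Nat.rec ⟨u₀, hu₀⟩ (fun n u => ⟨g n u.1 u.2, (hg n u.1 u.2).2⟩) n
  exact ⟨fun n => (T n).1, fun n => ((T n).2 0).mem, fun n => (hg n _ (T n).2).1⟩

/-! ### Machines that read the unique infinite path of a layered forest -/

/-- The machine `M` on the letters `(v, l, v')`, where `v` and `v'` are successive nodes of a path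
and `l` is a letter of the tape. In mode `0` the machine asks for the node after `v`, in mode `1`
it makes a step of `M`, in mode `2` it has moved to the left and replaces a node by its parent. -/
def Mach.alongPath {L S C V : Type*} (M : Mach (V × L × V) S C) (parent : L → V → Option V)
    (root : V) : QMach L (ℕ × S × V × V) V C where
  start := (0, M.start, root, root)
  step q l :=
    if q.1 = 1 then
      (M.step q.2.1 (q.2.2.1, l, q.2.2.2)).map fun r =>
        ((if r.2.1 = some false then 2 else 0, r.1,
          if r.2.1 = some true then (q.2.2.2, q.2.2.2) else (q.2.2.1, q.2.2.1)), r.2)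
    else (parent l q.2.2.1).map fun p => ((0, q.2.1, p, p), none, [])
  query q _ := if q.1 = 0 then some q.2.2.1 else none
  resume q t := (1, q.2.1, q.2.2.1, t)

/-! ### Infinite paths in a forest whose layers go to the right. -/

namespace Resolver

variable {L V : Type*} (G : Resolver L V)

/-- The infinite paths from the root. -/
def IsPath (root : V) (w : ℕ → L) (π : ℕ → V) : Prop :=
  π 0 = root ∧ ∀ i, G.parent (w i) (π (i + 1)) = some (π i) ∧ π (i + 1) ∈ G.cand (w i)

variable {G} [DecidableEq V] {root : V} {w : ℕ → L} {π : ℕ → V}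

theorem letters_right (hdir : G.dir = true) (i n : ℕ) : G.letters w i n = w (i + n) := by
  simp [letters, place, hdir]

theorem IsPath.mem_layer (hπ : G.IsPath root w π) (hdir : G.dir = true) (i n : ℕ) :
    (π (i + 1 + n), π (i + 1)) ∈ G.layer (G.letters w i) (π i) n := by
  induction n with
  | zero =>
    refine mem_layer_zero ?_ ?_ <;> rw [letters_right hdir]
    · exact (hπ.2 i).2
    · exact (hπ.2 i).1
  | succ n ih =>
    refine mem_layer_succ ih ?_ ?_ <;> rw [letters_right hdir, ← add_assoc,
      show i + n + 1 = i + 1 + n by omega]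
    · exact (hπ.2 _).2
    · exact (hπ.2 _).1

/-- If no layer were uniform, each would contain a node with a tag other than `π (i + 1)`. The
parent of such a node in the preceding layer has the same tag, so König's lemma yields an infinite
path through another child of `π i`, against uniqueness. -/
theorem IsPath.answer_eq (hπ : G.IsPath root w π) (hdir : G.dir = true)
    (hu : ∀ π', G.IsPath root w π' → π' = π) {K : Set V} (hK : K.Finite)
    (hcand : ∀ i, ∀ u ∈ G.cand (w i), u ∈ K) (i : ℕ) :
    G.answer (G.letters w i) (π i) = some (π (i + 1)) := by
  suffices h : ∃ N, Uniform (G.layer (G.letters w i) (π i) N) by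
    obtain ⟨N, hN⟩ := h
    exact answer_eq_some_of_forall hN fun n _ => ⟨_, hπ.mem_layer hdir i n⟩
  by_contra! hc
  obtain ⟨u, hu1, hu2⟩ := exists_infinite_path hK
    (fun n p q => G.parent (w (i + (n + 1))) q = some p ∧ q ∈ G.cand (w (i + (n + 1))))
    (fun n => {u | ∃ t, t ≠ π (i + 1) ∧ (u, t) ∈ G.layer (G.letters w i) (π i) n})
    (fun n => by
      by_contra he
      refine hc n (uniform_iff.2 ?_)
      have : ∀ z ∈ G.layer (G.letters w i) (π i) n, z.2 = π (i + 1) := by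
        intro z hz
        by_contra hne
        exact he ⟨z.1, z.2, hne, hz⟩
      intro z hz z' hz'
      rw [this z hz, this z' hz'])
    (fun n => by
      rintro u ⟨t, -, hut⟩
      exact hcand _ _ (mem_layer_cand hut))
    (by
      rintro n u ⟨t, hne, hut⟩
      have hcu := mem_layer_cand hut
      simp only [layer, next, List.mem_filterMap, Option.map_eq_some_iff, Option.bind_eq_some_iff,
        letters_right hdir, Prod.mk.injEq] at hut hcu
      obtain ⟨u', -, t', ⟨p, hp, hl⟩, rfl, rfl⟩ := hut
      exact ⟨p, ⟨t', hne, mem_of_lookup_eq_some hl⟩, hp, hcu⟩)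
  obtain ⟨t, hne, ht⟩ := hu1 0
  have ht1 := Resolver.mem_layer ht
  have ht2 := mem_layer_cand ht
  -- A node of layer `0` is its own tag, so the path found leaves `π` right after `π i`.
  obtain rfl : u 0 = t := Option.some.inj ht1.1
  rw [letters_right hdir] at ht1 ht2
  let π' : ℕ → V := fun k => if k ≤ i then π k else u (k - (i + 1))
  have hπ' : G.IsPath root w π' := by
    refine ⟨by simp [π', hπ.1], fun k => ?_⟩
    rcases lt_trichotomy k i with h | h | h
    · simp only [π', if_pos h.le, if_pos (show k + 1 ≤ i from h)]
      exact hπ.2 k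
    · subst h
      simp only [π', if_pos le_rfl, if_neg (show ¬ k + 1 ≤ k by omega), Nat.sub_self]
      exact ⟨ht1.2, ht2⟩
    · obtain ⟨m, rfl⟩ : ∃ m, k = i + (m + 1) := ⟨k - i - 1, by omega⟩
      simp only [π', if_neg (show ¬ i + (m + 1) ≤ i by omega),
        if_neg (show ¬ i + (m + 1) + 1 ≤ i by omega)]
      have := hu2 m
      rwa [show i + (m + 1) + 1 - (i + 1) = m + 1 by omega,
        show i + (m + 1) - (i + 1) = m by omega]
  apply hne
  have := congrFun (hu π' hπ') (i + 1)
  rw [← this]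
  simp [π']

end Resolver

/-- The part of a path that is found by answers to queries. -/
noncomputable def answeredPath {L V : Type*} [DecidableEq V] (G : Resolver L V) (root : V)
    (w : ℕ → L) : ℕ → Option V
  | 0 => some root
  | i + 1 => (answeredPath G root w i).bind (G.answer (G.letters w i))

namespace Mach

variable {L S C V : Type*} [DecidableEq V] {M : Mach (V × L × V) S C}
  {G : Resolver L V} {root : V} {w : ℕ → L}

/-- The run of `M` along the path that is found by answers to queries. -/
def OnPath (G : Resolver L V) (root : V) (w : ℕ → L) (c : (ℕ × S × V × V) × ℕ) : Prop :=
  (c.1.1 = 0 ∧ answeredPath G root w c.2 = some c.1.2.2.1) ∨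
  (c.1.1 = 1 ∧ answeredPath G root w c.2 = some c.1.2.2.1 ∧
    answeredPath G root w (c.2 + 1) = some c.1.2.2.2) ∨
  (c.1.1 = 2 ∧ answeredPath G root w (c.2 + 1) = some c.1.2.2.1)

/-- An answer is a child of the node that was asked about. So in mode `2` the parent of the stored
node is the preceding node of the answered path. No infinite path is presupposed here. -/
theorem OnPath.step {c c' : (ℕ × S × V × V) × ℕ} {α : List C} (h : OnPath G root w c)
    (hs : (M.alongPath G.parent root).oracleSys w (fun i => G.answer (G.letters w i)) c =
      some (c', α)) : OnPath G root w c' := by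
  obtain ⟨⟨m, s, v, t⟩, i⟩ := c
  rcases h with ⟨h1, h2⟩ | ⟨h1, h2, h3⟩ | ⟨h1, h2⟩
  · simp only at h1 h2
    subst h1
    simp only [QMach.oracleSys, alongPath, if_true, Option.map_eq_some_iff, Prod.mk.injEq] at hs
    obtain ⟨t', ht', rfl, -⟩ := hs
    exact .inr (.inl ⟨rfl, h2, by simp [answeredPath, h2, ht']⟩)
  · simp only at h1 h2 h3
    subst h1
    have hq : (M.alongPath G.parent root).query (1, s, v, t) (w i) = none := rfl
    simp only [QMach.oracleSys, hq] at hs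
    obtain ⟨d, h4, h5⟩ := exists_of_sys hs
    simp only [alongPath, if_true, Option.map_eq_some_iff, Prod.mk.injEq] at h4
    obtain ⟨⟨r, d', β⟩, -, h6, rfl, -⟩ := h4
    obtain ⟨⟨m', s', v', t'⟩, j⟩ := c'
    simp only [Prod.mk.injEq] at h5 h6
    obtain ⟨rfl, rfl, h7⟩ := h6
    rcases d with _ | _ | _
    · obtain rfl : i = j := Option.some.inj h5
      simp only [reduceCtorEq, if_false, Prod.mk.injEq] at h7
      obtain ⟨rfl, rfl⟩ := h7
      exact .inl ⟨rfl, h2⟩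
    · obtain _ | i := i
      · simp [movePos] at h5
      · obtain rfl : i = j := Option.some.inj h5
        simp only [Option.some.injEq, Bool.false_eq_true, if_false, Prod.mk.injEq] at h7
        obtain ⟨rfl, rfl⟩ := h7
        exact .inr (.inr ⟨rfl, h2⟩)
    · obtain rfl : i + 1 = j := Option.some.inj h5
      simp only [if_true, Prod.mk.injEq] at h7
      obtain ⟨rfl, rfl⟩ := h7
      exact .inl ⟨rfl, h3⟩
  · simp only at h1 h2
    subst h1
    have hq : (M.alongPath G.parent root).query (2, s, v, t) (w i) = none := rfl
    simp only [QMach.oracleSys, hq] at hs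
    obtain ⟨d, h4, h5⟩ := exists_of_sys hs
    simp only [alongPath, OfNat.ofNat_ne_one, if_false, Option.map_eq_some_iff, Prod.mk.injEq] at h4
    obtain ⟨p, hp, h6, rfl, -⟩ := h4
    obtain ⟨⟨m', s', v', t'⟩, j⟩ := c'
    simp only [Prod.mk.injEq] at h6
    obtain ⟨rfl, rfl, rfl, rfl⟩ := h6
    obtain rfl : i = j := Option.some.inj h5
    simp only [answeredPath, Option.bind_eq_some_iff] at h2
    obtain ⟨p', hp', ha⟩ := h2
    have := (Resolver.answer_eq_some ha).1
    rw [Resolver.letters, Resolver.place_zero, hp] at this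
    obtain rfl : p = p' := Option.some.inj this
    exact .inl ⟨rfl, hp'⟩

/-- The positions of a live run tend to infinity, so the queries along the way have been answered
and the answers form an infinite path. Each answer is the only tag of some layer, so every other
infinite path from the root takes it too. -/
theorem exists_unique_path_of_live (hdir : G.dir = true)
    (h : ((M.alongPath G.parent root).oracleSys w fun i => G.answer (G.letters w i)).Live Prod.snd
      ((0, M.start, root, root), 0)) :
    ∃ π, G.IsPath root w π ∧ ∀ π', G.IsPath root w π' → π' = π := by
  set σ := (M.alongPath G.parent root).oracleSys w fun i => G.answer (G.letters w i)
  have hinv : ∀ n, OnPath G root w (σ.conf ((0, M.start, root, root), 0) n) := by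
    intro n
    induction n with
    | zero => exact .inl ⟨rfl, rfl⟩
    | succ n ih =>
      obtain ⟨⟨c', α⟩, hc⟩ := Option.isSome_iff_exists.1 (h.1 n)
      rw [DetSys.conf_succ, DetSys.next_eq hc]
      exact ih.step hc
  have hdown : ∀ i j, i ≤ j → (answeredPath G root w j).isSome →
      (answeredPath G root w i).isSome := by
    intro i j hij
    induction j, hij using Nat.le_induction with
    | base => exact id
    | succ j _ ih =>
      intro hj
      apply ih
      simp only [answeredPath] at hj
      cases ha : answeredPath G root w j with
      | none => simp [ha] at hj
      | some v => rfl
  have hsome : ∀ i, (answeredPath G root w i).isSome := by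
    intro i
    obtain ⟨n, hn⟩ := (tendsto_atTop.1 h.2.1 i).exists
    rcases hinv n with h1 | h1 | h1
    · exact hdown _ _ hn (by simp [h1.2])
    · exact hdown _ _ hn (by simp [h1.2.1])
    · exact hdown _ _ (hn.trans (Nat.le_succ _)) (by simp [h1.2])
  choose π hπ using fun i => Option.isSome_iff_exists.1 (hsome i)
  have hans : ∀ i, G.answer (G.letters w i) (π i) = some (π (i + 1)) := by
    intro i
    have := hπ (i + 1)
    rwa [answeredPath, hπ i] at this
  have h0 : π 0 = root := (Option.some.inj (hπ 0)).symm
  refine ⟨π, ⟨h0, fun i => ?_⟩, fun π' hπ' => ?_⟩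
  · have := Resolver.answer_eq_some (hans i)
    rw [Resolver.letters, Resolver.place_zero] at this
    exact ⟨this.1, this.2.1⟩
  · funext i
    induction i with
    | zero => rw [h0, hπ'.1]
    | succ i ih =>
      obtain ⟨-, -, n, hn⟩ := Resolver.answer_eq_some (hans i)
      have := hπ'.mem_layer hdir i n
      rw [ih] at this
      exact hn _ this

theorem accepts_alongPath_iff_of_unique (hdir : G.dir = true) {K : Set V} (hK : K.Finite)
    (hcand : ∀ i, ∀ u ∈ G.cand (w i), u ∈ K) {π : ℕ → V} (hπ : G.IsPath root w π)
    (hu : ∀ π', G.IsPath root w π' → π' = π) (y : ℕ → C) :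
    ((M.alongPath G.parent root).resolve G).Accepts w y ↔
      M.Accepts (fun i => (π i, w i, π (i + 1))) y := by
  rw [QMach.accepts_resolve_iff _ _ _ (.inl hdir)]
  symm
  have hans := hπ.answer_eq hdir hu hK hcand
  set σ := (M.alongPath G.parent root).oracleSys w fun i => G.answer (G.letters w i) with hσ
  have hask : ∀ s i, σ ((0, s, π i, π i), i) = some (((1, s, π i, π (i + 1)), i), []) := by
    intro s i
    simp [hσ, QMach.oracleSys, alongPath, hans]
  refine DetSys.Simulation.acc_iff
    (R := fun c c' => c' = ((0, c.1, π c.2, π c.2), c.2))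
    (low := fun c => c.2 - 1) ⟨?_, ?_, ?_, ?_⟩ ?_ y
  · rintro ⟨s, i⟩ c' rfl hn hlive
    obtain ⟨c₁, α, h1, h2⟩ := hlive.exists_step
    rw [hask] at h1
    obtain ⟨rfl, rfl⟩ := Prod.mk.inj (Option.some.inj h1)
    obtain ⟨c₂, α, h3, -⟩ := h2.exists_step
    have hq : (M.alongPath G.parent root).query (1, s, π i, π (i + 1)) (w i) = none := rfl
    simp only [hσ, QMach.oracleSys, hq] at h3
    obtain ⟨d, h4, h5⟩ := exists_of_sys h3
    simp only [alongPath, if_true, Option.map_eq_some_iff, Prod.mk.injEq] at h4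
    obtain ⟨⟨r, d', β⟩, h6, -, rfl, -⟩ := h4
    rw [sys_eq_none] at hn
    rw [hn _ _ _ h6] at h5
    simp at h5
  · rintro ⟨s, i⟩ c' ⟨s₁, j⟩ α rfl hs
    obtain ⟨d, h1, h2⟩ := Mach.exists_of_sys hs
    simp only at h1 h2
    have h3 : σ ((1, s, π i, π (i + 1)), i) =
        some (((if d = some false then 2 else 0, s₁,
          if d = some true then (π (i + 1), π (i + 1)) else (π i, π i)), j), α) := by
      have hq : (M.alongPath G.parent root).query (1, s, π i, π (i + 1)) (w i) = none := rfl
      simp only [hσ, QMach.oracleSys, hq]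
      refine Mach.sys_eq_some (d := d) ?_ h2
      simp [alongPath, h1]
    have h4 : σ.Seg Prod.snd (i - 1) 2 ((0, s, π i, π i), i) _ α :=
      DetSys.Seg.cons (α := []) (hask s i) (Nat.sub_le i 1) (DetSys.Seg.single h3 (Nat.sub_le i 1))
    rcases d with _ | _ | _
    · obtain rfl : i = j := Option.some.inj h2
      exact ⟨1, _, h4, rfl⟩
    · obtain _ | i := i
      · simp [movePos] at h2
      · obtain rfl : i = j := Option.some.inj h2
        have h5 : σ ((2, s₁, π (i + 1), π (i + 1)), i) = some (((0, s₁, π i, π i), i), []) := by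
          have hq : (M.alongPath G.parent root).query (2, s₁, π (i + 1), π (i + 1)) (w i) =
            none := rfl
          simp only [hσ, QMach.oracleSys, hq]
          refine Mach.sys_eq_some (d := none) ?_ rfl
          simp [alongPath, (hπ.2 i).1]
        have := h4.trans (DetSys.Seg.single h5 le_rfl)
        rw [List.append_nil] at this
        exact ⟨2, _, this, rfl⟩
    · obtain rfl : i + 1 = j := Option.some.inj h2
      exact ⟨1, _, h4, rfl⟩
  · exact fun P => ⟨P + 1, by rintro ⟨s, i⟩ c' rfl hi; simp only at hi ⊢; omega⟩
  · exact fun P => ⟨P, by rintro ⟨s, i⟩ c' rfl hi; exact hi⟩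
  · simp [alongPath, hπ.1]

theorem accepts_alongPath_iff (hdir : G.dir = true) {K : Set V} (hK : K.Finite)
    (hcand : ∀ i, ∀ u ∈ G.cand (w i), u ∈ K) (y : ℕ → C) :
    ((M.alongPath G.parent root).resolve G).Accepts w y ↔
      ∃ π, G.IsPath root w π ∧ (∀ π', G.IsPath root w π' → π' = π) ∧
        M.Accepts (fun i => (π i, w i, π (i + 1))) y := by
  constructor
  · intro h
    have h' := (QMach.accepts_resolve_iff _ _ _ (.inl hdir) _).1 h
    obtain ⟨π, hπ, hu⟩ := exists_unique_path_of_live hdir h'.live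
    exact ⟨π, hπ, hu, (accepts_alongPath_iff_of_unique hdir hK hcand hπ hu y).1 h⟩
  · rintro ⟨π, hπ, hu, h⟩
    exact (accepts_alongPath_iff_of_unique hdir hK hcand hπ hu y).2 h

end Mach

/-! ### Machines that read a word given as a sequence of blocks -/

/-- The machine `M` on the concatenation of the blocks `h e`. The state contains the position in
the block, or says that the head enters the block from the right. -/
def Mach.onBlocks {L E S C : Type*} (M : Mach L S C) (h : E → List L) :
    Mach E (S × ℕ × Bool) C where
  start := (M.start, 0, false)
  step q e :=
    if q.2.2 then
      if (h e).length = 0 then some ((q.1, 0, true), some false, [])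
      else some ((q.1, (h e).length - 1, false), none, [])
    else
      match (h e)[q.2.1]? with
      | none => some ((q.1, 0, false), some true, [])
      | some l => (M.step q.1 l).map fun r =>
        if r.2.1 = some true then ((r.1, q.2.1 + 1, false), none, r.2.2)
        else if r.2.1 = none then ((r.1, q.2.1, false), none, r.2.2)
        else if q.2.1 = 0 then ((r.1, 0, true), some false, r.2.2)
        else ((r.1, q.2.1 - 1, false), none, r.2.2)

namespace Mach

variable {L E S C : Type*} {M : Mach L S C} {h : E → List L} {e : ℕ → E}

/-- The position where block `i` begins. -/
def blockStart (h : E → List L) (e : ℕ → E) (i : ℕ) : ℕ :=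
  (concatPrefix (fun j => h (e j)) i).length

theorem blockStart_succ (i : ℕ) :
    blockStart h e (i + 1) = blockStart h e i + (h (e i)).length := by
  simp [blockStart, concatPrefix_succ]

theorem blockStart_mono {i j : ℕ} (hij : i ≤ j) : blockStart h e i ≤ blockStart h e j :=
  (concatPrefix_prefix _ hij).length_le

theorem getElem?_block {z : ℕ → L} (hz : IsInfConcat (fun j => h (e j)) z) {i k : ℕ}
    (hk : k < (h (e i)).length) : (h (e i))[k]? = some (z (blockStart h e i + k)) := by
  obtain ⟨n, hn⟩ := hz (blockStart h e i + k)
  have h1 := getElem?_of_prefix (concatPrefix_prefix _ (le_max_left n (i + 1))) hn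
  have h2 : (concatPrefix (fun j => h (e j)) (i + 1))[blockStart h e i + k]? =
      (h (e i))[k]? := by
    rw [concatPrefix_succ, blockStart, List.getElem?_append_right (by omega)]
    simp
  rw [List.getElem?_eq_getElem hk] at h2 ⊢
  have h3 := getElem?_of_prefix (concatPrefix_prefix _ (le_max_right n (i + 1))) h2
  exact h3.symm.trans h1

theorem onBlocks_forward {i j : ℕ} (s : S) (hij : i < j) {k : ℕ} (hk : (h (e i)).length ≤ k)
    (hempty : ∀ m, i < m → m < j → h (e m) = []) (P : ℕ) (hP : P ≤ i) :
    ∃ n, ((M.onBlocks h).sys e).Seg Prod.snd P n ((s, k, false), i) ((s, 0, false), j) [] := by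
  induction j, hij using Nat.le_induction with
  | base =>
    refine ⟨1, DetSys.Seg.single (sys_eq_some (d := some true) ?_ rfl) hP⟩
    simp [onBlocks, List.getElem?_eq_none hk]
  | succ j hij ih =>
    obtain ⟨n, hn⟩ := ih fun m h1 h2 => hempty m h1 (by omega)
    refine ⟨n + 1, hn.trans (DetSys.Seg.single (sys_eq_some (d := some true) ?_ rfl)
      (show P ≤ j by omega))⟩
    simp [onBlocks, hempty j (by omega) (by omega)]

theorem onBlocks_backward {i j : ℕ} (s : S) (hij : j ≤ i) (hne : h (e j) ≠ [])
    (hempty : ∀ m, j < m → m ≤ i → h (e m) = []) :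
    ∃ n, ((M.onBlocks h).sys e).Seg Prod.snd j n ((s, 0, true), i)
      ((s, (h (e j)).length - 1, false), j) [] := by
  induction i, hij using Nat.le_induction with
  | base =>
    refine ⟨1, DetSys.Seg.single (sys_eq_some (d := none) ?_ rfl) le_rfl⟩
    simp [onBlocks, hne]
  | succ i hij ih =>
    obtain ⟨n, hn⟩ := ih fun m h1 h2 => hempty m h1 (by omega)
    refine ⟨n + 1, DetSys.Seg.cons (α := []) (β := []) (sys_eq_some (d := some false) ?_ rfl)
      (show j ≤ i + 1 by omega) hn⟩
    simp [onBlocks, hempty (i + 1) (by omega) le_rfl]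

/-- On an empty block the machine only moves its head, without output. If all blocks from some point
on were empty, a run whose positions tend to infinity would have finite output. -/
theorem isInfConcat_of_accepts_onBlocks {y : ℕ → C} (hy : (M.onBlocks h).Accepts e y) :
    ∃ z, IsInfConcat (fun j => h (e j)) z := by
  refine exists_isInfConcat fun n => ?_
  by_contra! hc
  obtain ⟨N, hN⟩ := eventually_atTop.1 (tendsto_atTop.1 hy.2.1 n)
  obtain ⟨m, hm, hne⟩ := hy.live.2.2 N
  apply hne
  have hpos := hN m hm
  set c := ((M.onBlocks h).sys e).conf ((M.onBlocks h).start, 0) m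
  obtain ⟨⟨c', α⟩, hs⟩ := Option.isSome_iff_exists.1 (hy.1 m)
  rw [DetSys.out_eq hs]
  obtain ⟨d, h1, -⟩ := exists_of_sys hs
  change (M.onBlocks h).step c.1 (e c.2) = _ at h1
  simp only [onBlocks, hc c.2 hpos, List.length_nil, if_true, List.getElem?_nil] at h1
  split_ifs at h1
  · simp only [Option.some.injEq, Prod.mk.injEq] at h1
    exact h1.2.2.symm
  · simp only [Option.some.injEq, Prod.mk.injEq] at h1
    exact h1.2.2.symm

/-- A position in the concatenation corresponds to a block and an offset below its length. As block
`0` is not empty, the start has such a representation and the left ends of both tapes correspond. -/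
theorem accepts_onBlocks_iff (M : Mach L S C) {z : ℕ → L}
    (hz : IsInfConcat (fun j => h (e j)) z) (h0 : h (e 0) ≠ []) (y : ℕ → C) :
    (M.onBlocks h).Accepts e y ↔ M.Accepts z y := by
  classical
  symm
  have hex := hz.exists_ne_nil
  have hprev : ∀ i, ∃ j ≤ i, h (e j) ≠ [] ∧ (∀ m, j < m → m ≤ i → h (e m) = []) ∧
      Nat.findGreatest (fun j => h (e j) ≠ []) i = j := by
    intro i
    refine ⟨_, Nat.findGreatest_le i, ?_, fun m h1 h2 => ?_, rfl⟩
    · exact Nat.findGreatest_spec (P := fun j => h (e j) ≠ []) (Nat.zero_le i) h0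
    · by_contra hne
      exact Nat.findGreatest_is_greatest h1 h2 hne
  have hstart : ∀ i j, i ≤ j → (∀ m, i ≤ m → m < j → h (e m) = []) →
      blockStart h e j = blockStart h e i := by
    intro i j hij hem
    induction j, hij using Nat.le_induction with
    | base => rfl
    | succ j hij ih =>
      rw [blockStart_succ, hem j hij (by omega), ih fun m h1 h2 => hem m h1 (by omega)]
      rfl
  refine DetSys.Simulation.acc_iff
    (R := fun c c' => ∃ i k, c' = ((c.1, k, false), i) ∧ k < (h (e i)).length ∧
      c.2 = blockStart h e i + k)
    -- A left move from the first letter of a block goes back over empty blocks to the last nonempty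
    -- one. Infinitely many blocks are nonempty, so this bound tends to infinity.
    (low := fun c => Nat.findGreatest (fun j => h (e j) ≠ []) (c.2 - 1)) ⟨?_, ?_, ?_, ?_⟩ ?_ y
  · rintro ⟨s, p⟩ c' ⟨i, k, rfl, hk, hp⟩ hn hlive
    simp only at hp
    subst hp
    have hl := getElem?_block hz hk
    obtain ⟨c₁, α, h1, -⟩ := hlive.exists_step
    obtain ⟨d, h2, h3⟩ := exists_of_sys h1
    rw [sys_eq_none] at hn
    simp only [onBlocks, Bool.false_eq_true, if_false, hl, Option.map_eq_some_iff] at h2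
    obtain ⟨⟨s', d', β⟩, hs, he⟩ := h2
    have hnone := hn _ _ _ hs
    rcases d' with _ | _ | _
    · simp [movePos] at hnone
    · have hk0 : blockStart h e i + k = 0 := by
        by_contra hne
        obtain ⟨m, hm⟩ := Nat.exists_eq_succ_of_ne_zero hne
        simp [hm, movePos] at hnone
      -- Later blocks begin at positive positions, so a left move is impossible only at the
      -- beginning of block `0`.
      have hi0 : i = 0 := by
        by_contra hne
        have := blockStart_mono (h := h) (e := e) (show 1 ≤ i by omega)
        rw [blockStart_succ] at this
        have := List.length_pos_iff.2 h0
        omega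
      obtain rfl : k = 0 := by omega
      simp only [reduceCtorEq, if_false, if_true, Option.some.injEq, Bool.false_eq_true,
        Prod.mk.injEq] at he
      obtain ⟨-, rfl, -⟩ := he
      subst hi0
      simp [movePos] at h3
    · simp [movePos] at hnone
  · rintro ⟨s, p⟩ c' ⟨s₁, p₁⟩ α ⟨i, k, rfl, hk, hp⟩ hs
    simp only at hp
    subst hp
    have hl := getElem?_block hz hk
    obtain ⟨d, h1, h2⟩ := exists_of_sys hs
    simp only at h1 h2 ⊢
    have hlow : Nat.findGreatest (fun j => h (e j) ≠ []) (i - 1) ≤ i :=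
      (Nat.findGreatest_le _).trans (Nat.sub_le _ _)
    rcases d with _ | _ | _
    · refine ⟨0, _, DetSys.Seg.single (sys_eq_some (d := none) ?_ rfl) hlow, i, k, rfl, hk, ?_⟩
      · simp [onBlocks, hl, h1]
      · exact (Option.some.inj h2).symm
    · by_cases hk0 : k = 0
      · subst hk0
        obtain ⟨i', rfl⟩ : ∃ i', i = i' + 1 := by
          rcases i with _ | i
          · simp [blockStart, concatPrefix, movePos] at h2
          · exact ⟨i, rfl⟩
        obtain ⟨j, hj, hne, hem, hfind⟩ := hprev i'
        obtain ⟨n, hn⟩ := onBlocks_backward (M := M) s₁ hj hne hem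
        simp only [Nat.add_sub_cancel, hfind]
        refine ⟨n, _, ?_, j, (h (e j)).length - 1, rfl, ?_, ?_⟩
        · have := DetSys.Seg.cons (α := α) (sys_eq_some (M := M.onBlocks h) (w := e)
            (s := (s, 0, false)) (s' := (s₁, 0, true)) (i := i' + 1)
            (d := some false) (p := i') ?_ rfl) (show j ≤ i' + 1 by omega) hn
          · rwa [List.append_nil] at this
          · rw [add_zero] at hl h1
            simp [onBlocks, hl, h1]
        · have := List.length_pos_iff.2 hne
          omega
        · have h3 := hstart (j + 1) (i' + 1) (by omega) fun m h4 h5 =>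
            hem m (by omega) (by omega)
          rw [blockStart_succ j] at h3
          rw [h3] at h2
          have := List.length_pos_iff.2 hne
          obtain ⟨q, hq⟩ : ∃ q, blockStart h e j + (h (e j)).length = q + 1 :=
            ⟨blockStart h e j + (h (e j)).length - 1, by omega⟩
          rw [add_zero, hq, movePos, Option.some.injEq] at h2
          omega
      · refine ⟨0, _, DetSys.Seg.single (sys_eq_some (s' := (s₁, k - 1, false)) (d := none) ?_ rfl)
          hlow, i, k - 1, rfl, by omega, ?_⟩
        · simp [onBlocks, hl, h1, hk0]
        · obtain ⟨q, hq⟩ : ∃ q, blockStart h e i + k = q + 1 :=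
            ⟨blockStart h e i + k - 1, by omega⟩
          rw [hq, movePos, Option.some.injEq] at h2
          omega
    · have h3 : (M.onBlocks h).sys e ((s, k, false), i) = some (((s₁, k + 1, false), i), α) :=
        sys_eq_some (d := none) (by simp [onBlocks, hl, h1]) rfl
      have h2' : p₁ = blockStart h e i + (k + 1) := (Option.some.inj h2).symm
      by_cases hk1 : k + 1 < (h (e i)).length
      · exact ⟨0, _, DetSys.Seg.single h3 hlow, i, k + 1, rfl, hk1, h2'⟩
      · have hex' : ∃ j, i < j ∧ h (e j) ≠ [] := by
          obtain ⟨j, hj, hne⟩ := hex (i + 1)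
          exact ⟨j, hj, hne⟩
        obtain ⟨hj1, hj2⟩ := Nat.find_spec hex'
        have hmin : ∀ m, i < m → m < Nat.find hex' → h (e m) = [] := by
          intro m h4 h5
          by_contra hne
          exact Nat.find_min hex' h5 ⟨h4, hne⟩
        generalize Nat.find hex' = j at hj1 hj2 hmin
        obtain ⟨n, hn⟩ := onBlocks_forward (M := M) s₁ hj1 (k := k + 1) (by omega) hmin _ hlow
        have := DetSys.Seg.cons h3 hlow hn
        rw [List.append_nil] at this
        refine ⟨n, _, this, j, 0, rfl, List.length_pos_iff.2 hj2, ?_⟩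
        have h6 := hstart (i + 1) j hj1 fun m h4 h5 => hmin m h4 h5
        rw [blockStart_succ] at h6
        omega
  · intro P
    obtain ⟨j, hj, hne⟩ := hex P
    refine ⟨blockStart h e (j + 1), ?_⟩
    rintro ⟨s, p⟩ c' ⟨i, k, rfl, hk, hp⟩ hP
    simp only at hp hP ⊢
    have hij : j < i := by
      by_contra hle
      have := blockStart_mono (h := h) (e := e) (show i + 1 ≤ j + 1 by omega)
      rw [blockStart_succ] at this
      omega
    exact hj.trans (Nat.le_findGreatest (by omega) hne)
  · intro P
    obtain ⟨n, hn⟩ := hz P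
    refine ⟨n, ?_⟩
    rintro ⟨s, p⟩ c' ⟨i, k, rfl, hk, hp⟩ hP
    simp only at hp hP
    have h1 := (List.getElem?_eq_some_iff.1 hn).1
    have h2 := blockStart_mono (h := h) (e := e) hP
    unfold blockStart at h2 hp
    simp only
    omega
  · exact ⟨0, 0, rfl, List.length_pos_iff.2 h0, rfl⟩

end Mach

/-! ### Unique paths in layered graphs -/

/-- A layered graph on the nodes in `nodes`: the edges between two layers are determined by a
letter. The node `ghost` is an additional one. -/
structure LayeredGraph (L V : Type*) where
  edge : L → V → V → Bool
  nodes : List V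
  root : V
  ghost : V

namespace LayeredGraph

variable {L V : Type*} [DecidableEq V] (H : LayeredGraph L V)

/-- The infinite paths from the root. -/
def IsPath (w : ℕ → L) (σ : ℕ → V) : Prop :=
  σ 0 = H.root ∧ ∀ i, H.edge (w i) (σ i) (σ (i + 1)) = true ∧ σ (i + 1) ∈ H.nodes

def preds (l : L) (s : List V) (v : V) : List V := s.filter fun u => H.edge l u v

/-- The nodes with exactly one path from the root, given those of the preceding layer with exactly
one and with several. -/
def singleNext (l : L) (c₁ c₂ : List V) : List V :=
  H.nodes.filter fun v => (H.preds l c₁ v).length = 1 ∧ (H.preds l c₂ v).length = 0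

/-- The nodes with several paths from the root. -/
def multiNext (l : L) (c₁ c₂ : List V) : List V :=
  H.nodes.filter fun v => 2 ≤ (H.preds l c₁ v).length ∨ (H.preds l c₂ v).length ≠ 0

/-- The successors of the nodes in `b`, or all nodes with several paths if there are none in `b`. -/
def trackNext (l : L) (c₁ c₂ b : List V) : List V :=
  if b.length = 0 then H.multiNext l c₁ c₂ else H.nodes.filter fun v => (H.preds l b v).length ≠ 0

/-- A subset automaton with a breakpoint: the third component restarts with all nodes of the second
kind after it has died out. It is nonempty from some layer on if and only if an infinite path from
the root reaches a node with several paths. -/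
def autStep (d : List V × List V × List V) (l : L) : List V × List V × List V :=
  (H.singleNext l d.1 d.2.1, H.multiNext l d.1 d.2.1, H.trackNext l d.1 d.2.1 d.2.2)

def autStart : List V × List V × List V := ([H.root], [], [])

/-- The parents in a forest that consists of the nodes with exactly one path from the root and of
the ghost, which represents the tracked nodes. -/
def forestParent (l : L × (List V × List V × List V)) (v : V) : Option V :=
  if v = H.ghost then
    if (H.autStep l.2 l.1).2.2.length = 0 then none
    else if l.2.2.2.length = 0 then l.2.1.head? else some H.ghost
  else if v ∈ (H.autStep l.2 l.1).1 then (H.preds l.1 l.2.1 v).head? else none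

/-- All nodes may be candidates in every layer, because those outside the current layer have the
parent `none` and are dropped by the search. -/
def forest : Resolver (L × (List V × List V × List V)) V where
  cand _ := H.ghost :: H.nodes
  parent := H.forestParent
  dir := true

def states (w : ℕ → L) : ℕ → List V × List V × List V := autStates H.autStep H.autStart w

def single (w : ℕ → L) (i : ℕ) : List V := (H.states w i).1
def multi (w : ℕ → L) (i : ℕ) : List V := (H.states w i).2.1
def tracked (w : ℕ → L) (i : ℕ) : List V := (H.states w i).2.2

variable {H} {w : ℕ → L} {σ : ℕ → V}

theorem single_succ (i : ℕ) :
    H.single w (i + 1) = H.singleNext (w i) (H.single w i) (H.multi w i) := rfl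

theorem multi_succ (i : ℕ) :
    H.multi w (i + 1) = H.multiNext (w i) (H.single w i) (H.multi w i) := rfl

theorem tracked_succ (i : ℕ) : H.tracked w (i + 1) =
    H.trackNext (w i) (H.single w i) (H.multi w i) (H.tracked w i) := rfl

theorem mem_preds {l : L} {s : List V} {u v : V} :
    u ∈ H.preds l s v ↔ u ∈ s ∧ H.edge l u v = true := by simp [preds]

theorem length_preds_ne_zero {l : L} {s : List V} {v : V} :
    (H.preds l s v).length ≠ 0 ↔ ∃ u ∈ s, H.edge l u v = true := by
  rw [Ne, List.length_eq_zero_iff, List.eq_nil_iff_forall_not_mem]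
  simp [mem_preds]

theorem mem_single_succ {i : ℕ} {v : V} : v ∈ H.single w (i + 1) ↔ v ∈ H.nodes ∧
    (H.preds (w i) (H.single w i) v).length = 1 ∧ (H.preds (w i) (H.multi w i) v).length = 0 := by
  simp [single_succ, singleNext]

theorem mem_multi_succ {i : ℕ} {v : V} : v ∈ H.multi w (i + 1) ↔ v ∈ H.nodes ∧
    (2 ≤ (H.preds (w i) (H.single w i) v).length ∨
      (H.preds (w i) (H.multi w i) v).length ≠ 0) := by
  rw [multi_succ, multiNext, List.mem_filter, decide_eq_true_iff]

theorem mem_tracked_succ {i : ℕ} {v : V} (h : H.tracked w i ≠ []) :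
    v ∈ H.tracked w (i + 1) ↔ v ∈ H.nodes ∧ ∃ u ∈ H.tracked w i, H.edge (w i) u v = true := by
  rw [tracked_succ, trackNext, if_neg (by simpa using h), List.mem_filter, decide_eq_true_iff,
    length_preds_ne_zero]

theorem tracked_succ_of_nil {i : ℕ} (h : H.tracked w i = []) :
    H.tracked w (i + 1) = H.multi w (i + 1) := by
  rw [tracked_succ, trackNext, if_pos (by simp [h])]; rfl

theorem tracked_subset (i : ℕ) : ∀ v ∈ H.tracked w i, v ∈ H.multi w i := by
  induction i with
  | zero => simp [tracked, states, autStates, autStart]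
  | succ i ih =>
    intro v hv
    by_cases h : H.tracked w i = []
    · rwa [tracked_succ_of_nil h] at hv
    · obtain ⟨h1, u, hu, he⟩ := (mem_tracked_succ h).1 hv
      exact mem_multi_succ.2 ⟨h1, .inr (length_preds_ne_zero.2 ⟨u, ih u hu, he⟩)⟩

theorem not_mem_multi {i : ℕ} {v : V} (h : v ∈ H.single w i) : v ∉ H.multi w i := by
  cases i with
  | zero => simp [multi, states, autStates, autStart]
  | succ i =>
    rw [mem_single_succ] at h
    rw [mem_multi_succ]
    rintro ⟨-, h2 | h2⟩
    · omega
    · exact h2 h.2.2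

theorem multi_subset (i : ℕ) : ∀ v ∈ H.multi w i, v ∈ H.nodes := by
  cases i with
  | zero => simp [multi, states, autStates, autStart]
  | succ i => exact fun v hv => (mem_multi_succ.1 hv).1

theorem single_subset (hroot : H.root ∈ H.nodes) (i : ℕ) : ∀ v ∈ H.single w i, v ∈ H.nodes := by
  cases i with
  | zero => simpa [single, states, autStates, autStart] using hroot
  | succ i => exact fun v hv => (mem_single_succ.1 hv).1

theorem single_nodup (hnd : H.nodes.Nodup) (i : ℕ) : (H.single w i).Nodup := by
  cases i with
  | zero => simp [single, states, autStates, autStart]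
  | succ i => exact hnd.filter _

theorem head?_preds {i : ℕ} {u v : V} (hv : v ∈ H.single w (i + 1)) (hu : u ∈ H.single w i)
    (he : H.edge (w i) u v = true) : (H.preds (w i) (H.single w i) v).head? = some u := by
  obtain ⟨-, h1, -⟩ := mem_single_succ.1 hv
  obtain ⟨a, ha⟩ := List.length_eq_one_iff.1 h1
  have := mem_preds.2 ⟨hu, he⟩
  rw [ha, List.mem_singleton] at this
  rw [ha, this]
  rfl

theorem exists_pred_of_mem_single {i : ℕ} {v : V} (hv : v ∈ H.single w (i + 1)) :
    ∃ u ∈ H.single w i, H.edge (w i) u v = true :=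
  length_preds_ne_zero.1 (by rw [(mem_single_succ.1 hv).2.1]; exact one_ne_zero)

theorem IsPath.mem_or (hσ : H.IsPath w σ) (i : ℕ) : σ i ∈ H.single w i ∨ σ i ∈ H.multi w i := by
  induction i with
  | zero => left; simp [single, states, autStates, autStart, hσ.1]
  | succ i ih =>
    obtain ⟨he, hn⟩ := hσ.2 i
    by_cases h2 : σ i ∈ H.multi w i
    · exact .inr (mem_multi_succ.2 ⟨hn, .inr (length_preds_ne_zero.2 ⟨_, h2, he⟩)⟩)
    · have h3 := length_preds_ne_zero.2 ⟨σ i, ih.resolve_right h2, he⟩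
      rw [mem_single_succ, mem_multi_succ]
      by_cases h4 : (H.preds (w i) (H.multi w i) (σ (i + 1))).length = 0
      · by_cases h5 : (H.preds (w i) (H.single w i) (σ (i + 1))).length = 1
        · exact .inl ⟨hn, h5, h4⟩
        · exact .inr ⟨hn, .inl (by omega)⟩
      · exact .inr ⟨hn, .inr h4⟩

theorem IsPath.mem_multi_of_le (hσ : H.IsPath w σ) {i j : ℕ} (hij : i ≤ j)
    (h : σ i ∈ H.multi w i) : σ j ∈ H.multi w j := by
  induction j, hij using Nat.le_induction with
  | base => exact h
  | succ j _ ih =>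
    exact mem_multi_succ.2 ⟨(hσ.2 j).2, .inr (length_preds_ne_zero.2 ⟨_, ih, (hσ.2 j).1⟩)⟩

/-! ### Finite paths to a layer, and the comparison of the graph with its forest. -/

variable (H) in
/-- The paths from the root to layer `i`. -/
def IsPathTo (w : ℕ → L) (i : ℕ) (σ : ℕ → V) : Prop :=
  σ 0 = H.root ∧ ∀ j < i, H.edge (w j) (σ j) (σ (j + 1)) = true ∧ σ (j + 1) ∈ H.nodes

/-- The word that agrees with `σ` up to `i` and with `τ` after it. -/
def glue (σ τ : ℕ → V) (i : ℕ) : ℕ → V := fun k => if k ≤ i then σ k else τ k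

theorem glue_of_le {σ τ : ℕ → V} {i k : ℕ} (h : k ≤ i) : glue σ τ i k = σ k := if_pos h

theorem glue_of_lt {σ τ : ℕ → V} {i k : ℕ} (h : i < k) : glue σ τ i k = τ k :=
  if_neg (by omega)

theorem IsPathTo.glue {τ : ℕ → V} {i : ℕ} (hσ : H.IsPathTo w i σ)
    (hτ : ∀ j, i < j → H.edge (w j) (τ j) (τ (j + 1)) = true ∧ τ (j + 1) ∈ H.nodes)
    (h : H.edge (w i) (σ i) (τ (i + 1)) = true ∧ τ (i + 1) ∈ H.nodes) :
    H.IsPath w (glue σ τ i) := by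
  refine ⟨by rw [glue_of_le (Nat.zero_le i)]; exact hσ.1, fun j => ?_⟩
  rcases lt_trichotomy j i with hj | hj | hj
  · rw [glue_of_le hj.le, glue_of_le hj]; exact hσ.2 j hj
  · subst hj
    rw [glue_of_le le_rfl, glue_of_lt (Nat.lt_succ_self j)]; exact h
  · rw [glue_of_lt hj, glue_of_lt (by omega)]; exact hτ j hj

theorem IsPathTo.snoc {i : ℕ} {v : V} (hσ : H.IsPathTo w i σ) (hv : v ∈ H.nodes)
    (he : H.edge (w i) (σ i) v = true) :
    H.IsPathTo w (i + 1) (LayeredGraph.glue σ (fun _ => v) i) := by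
  refine ⟨by rw [glue_of_le (Nat.zero_le i)]; exact hσ.1, fun j hj => ?_⟩
  rcases Nat.lt_succ_iff_lt_or_eq.1 hj with hj | hj
  · rw [glue_of_le hj.le, glue_of_le hj]; exact hσ.2 j hj
  · subst hj
    rw [glue_of_le le_rfl, glue_of_lt (Nat.lt_succ_self j)]; exact ⟨he, hv⟩

theorem exists_pathTo_of_mem_single {i : ℕ} {v : V} (hv : v ∈ H.single w i) :
    ∃ τ, H.IsPathTo w i τ ∧ τ i = v ∧ ∀ j ≤ i, τ j ∈ H.single w j := by
  induction i generalizing v with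
  | zero =>
    refine ⟨fun _ => v, ⟨?_, by simp⟩, rfl, fun j hj => ?_⟩
    · simpa [single, states, autStates, autStart] using hv
    · rwa [Nat.le_zero.1 hj]
  | succ i ih =>
    obtain ⟨u, hu, he⟩ := exists_pred_of_mem_single hv
    obtain ⟨τ, h1, rfl, h3⟩ := ih hu
    refine ⟨_, h1.snoc (mem_single_succ.1 hv).1 he, glue_of_lt (Nat.lt_succ_self i),
      fun j hj => ?_⟩
    rcases Nat.le_succ_iff.1 hj with hj | rfl
    · rw [glue_of_le hj]; exact h3 j hj
    · rw [glue_of_lt (Nat.lt_succ_self i)]; exact hv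

/-- Either two nodes with one path lead to `v`, and the paths differ in the last layer but one, or a
predecessor has several paths already. -/
theorem exists_pathTo_of_mem_multi (hnd : H.nodes.Nodup) {i : ℕ} {v : V} (hv : v ∈ H.multi w i) :
    ∃ τ τ', H.IsPathTo w i τ ∧ H.IsPathTo w i τ' ∧ τ i = v ∧ τ' i = v ∧ ∃ j ≤ i, τ j ≠ τ' j := by
  induction i generalizing v with
  | zero => simp [multi, states, autStates, autStart] at hv
  | succ i ih =>
    obtain ⟨hn, h | h⟩ := mem_multi_succ.1 hv
    -- Without duplicates in the list, two entries among the predecessors are two different nodes.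
    · have hnd' : (H.preds (w i) (H.single w i) v).Nodup := (single_nodup hnd i).filter _
      rcases hp : H.preds (w i) (H.single w i) v with _ | ⟨a, _ | ⟨b, t⟩⟩
      · simp [hp] at h
      · simp [hp] at h
      · rw [hp] at hnd'
        have hab : a ≠ b := by
          rintro rfl
          simp at hnd'
        obtain ⟨ha, hea⟩ := mem_preds.1 (show a ∈ H.preds (w i) (H.single w i) v by simp [hp])
        obtain ⟨hb, heb⟩ := mem_preds.1 (show b ∈ H.preds (w i) (H.single w i) v by simp [hp])
        obtain ⟨τ, h1, rfl, -⟩ := exists_pathTo_of_mem_single ha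
        obtain ⟨τ', h1', rfl, -⟩ := exists_pathTo_of_mem_single hb
        refine ⟨_, _, h1.snoc hn hea, h1'.snoc hn heb, glue_of_lt (Nat.lt_succ_self i),
          glue_of_lt (Nat.lt_succ_self i), i, Nat.le_succ i, ?_⟩
        rwa [glue_of_le le_rfl, glue_of_le le_rfl]
    · obtain ⟨u, hu, he⟩ := length_preds_ne_zero.1 h
      obtain ⟨τ, τ', h1, h1', rfl, h2', j, hj, hne⟩ := ih hu
      refine ⟨_, _, h1.snoc hn he, h1'.snoc hn (h2' ▸ he), glue_of_lt (Nat.lt_succ_self i),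
        glue_of_lt (Nat.lt_succ_self i), j, by omega, ?_⟩
      rwa [glue_of_le hj, glue_of_le hj]

/-- If two finite paths led to `σ i`, then each could replace the beginning of `σ`, and the two
resulting infinite paths would differ. -/
theorem IsPath.mem_single (hnd : H.nodes.Nodup) (hσ : H.IsPath w σ)
    (hu : ∀ σ', H.IsPath w σ' → σ' = σ) (i : ℕ) : σ i ∈ H.single w i := by
  refine (hσ.mem_or i).resolve_right fun hm => ?_
  obtain ⟨τ, τ', h1, h1', h2, h2', j, hj, hne⟩ := exists_pathTo_of_mem_multi hnd hm
  have e := hu _ (h1.glue (fun j _ => hσ.2 j) (h2 ▸ hσ.2 i))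
  have e' := hu _ (h1'.glue (fun j _ => hσ.2 j) (h2' ▸ hσ.2 i))
  have := congrFun (e.trans e'.symm) j
  rw [glue_of_le hj, glue_of_le hj] at this
  exact hne this

theorem forestParent_of_mem_single (hg : H.ghost ∉ H.nodes) {i : ℕ} {u v : V}
    (hv : v ∈ H.single w (i + 1)) (hu : u ∈ H.single w i) (he : H.edge (w i) u v = true) :
    H.forest.parent (w i, H.states w i) v = some u ∧
      v ∈ H.forest.cand (w i, H.states w i) := by
  have hvn := (mem_single_succ.1 hv).1
  have hvg : v ≠ H.ghost := fun e => hg (e ▸ hvn)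
  refine ⟨?_, List.mem_cons_of_mem _ hvn⟩
  simp only [forest, forestParent, if_neg hvg]
  rw [if_pos (show v ∈ (H.autStep (H.states w i) (w i)).1 from hv)]
  exact head?_preds hv hu he

/-- A path that does not leave the nodes with one path is a path in the forest. -/
theorem IsPath.isPath_forest (hg : H.ghost ∉ H.nodes) (hσ : H.IsPath w σ)
    (hs : ∀ i, σ i ∈ H.single w i) :
    H.forest.IsPath H.root (fun i => (w i, H.states w i)) σ :=
  ⟨hσ.1, fun i => forestParent_of_mem_single hg (hs (i + 1)) (hs i) (hσ.2 i).1⟩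

theorem mem_single_of_forestParent {i : ℕ} {u v : V} (hv : v ≠ H.ghost)
    (h : H.forest.parent (w i, H.states w i) v = some u) :
    v ∈ H.single w (i + 1) ∧ u ∈ H.single w i ∧ H.edge (w i) u v = true := by
  simp only [forest, forestParent, if_neg hv] at h
  split_ifs at h with hm
  exact ⟨hm, mem_preds.1 (List.mem_of_mem_head? h)⟩

theorem isPath_of_forest (hroot : H.root ∈ H.nodes) {π : ℕ → V}
    (hπ : H.forest.IsPath H.root (fun i => (w i, H.states w i)) π) (hne : ∀ i, π i ≠ H.ghost) :
    H.IsPath w π ∧ ∀ i, π i ∈ H.single w i := by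
  have h := fun i => mem_single_of_forestParent (hne (i + 1)) (hπ.2 i).1
  exact ⟨⟨hπ.1, fun i => ⟨(h i).2.2, single_subset hroot _ _ (h i).1⟩⟩, fun i => (h i).2.1⟩

theorem tracked_ne_nil_of_ghost {i : ℕ} {u : V}
    (h : H.forest.parent (w i, H.states w i) H.ghost = some u) :
    H.tracked w (i + 1) ≠ [] := by
  intro he
  simp only [forest, forestParent, if_true] at h
  rw [if_pos (show (H.autStep (H.states w i) (w i)).2.2.length = 0 from by
    rw [show (H.autStep (H.states w i) (w i)).2.2 = [] from he]; rfl)] at h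
  simp at h

/-- Another path of the forest would have to end in the ghost. The tracked set would then be
nonempty in all later layers, and König's lemma would give an infinite path of the graph through a
node with several paths, against `IsPath.mem_single`. -/
theorem forest_unique_of_unique (hnd : H.nodes.Nodup) (hroot : H.root ∈ H.nodes)
    (hg : H.ghost ∉ H.nodes) (hσ : H.IsPath w σ) (hu : ∀ σ', H.IsPath w σ' → σ' = σ) {π : ℕ → V}
    (hπ : H.forest.IsPath H.root (fun i => (w i, H.states w i)) π) : π = σ := by
  by_cases hne : ∀ i, π i ≠ H.ghost
  · exact hu _ (isPath_of_forest hroot hπ hne).1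
  exfalso
  push Not at hne
  obtain ⟨j, hj⟩ := hne
  -- A node other than the ghost has its parent among the nodes of the graph, so a path never leaves
  -- the ghost.
  have hghost : ∀ k, j ≤ k → π k = H.ghost := by
    intro k hk
    induction k, hk using Nat.le_induction with
    | base => exact hj
    | succ k _ ih =>
      by_contra hc
      have := (mem_single_of_forestParent hc (hπ.2 k).1).2.1
      rw [ih] at this
      exact hg (single_subset hroot _ _ this)
  have htr : ∀ k, j < k → H.tracked w k ≠ [] := by
    intro k hk
    obtain ⟨k, rfl⟩ : ∃ k', k = k' + 1 := ⟨k - 1, by omega⟩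
    have := (hπ.2 k).1
    rw [hghost (k + 1) (by omega)] at this
    exact tracked_ne_nil_of_ghost this
  obtain ⟨u, hu1, hu2⟩ := exists_infinite_path (List.finite_toSet H.nodes)
    (fun n p q => H.edge (w (j + 1 + n)) p q = true)
    (fun n => {u | u ∈ H.tracked w (j + 1 + n)})
    (fun n => by
      obtain ⟨a, ha⟩ := List.exists_mem_of_ne_nil _ (htr (j + 1 + n) (by omega))
      exact ⟨a, ha⟩)
    (fun n u hun => multi_subset _ _ (tracked_subset _ _ hun))
    (fun n u hun => by
      obtain ⟨-, p, hp, he⟩ := (mem_tracked_succ (htr (j + 1 + n) (by omega))).1 hun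
      exact ⟨p, hp, he⟩)
  have h0 := tracked_subset _ _ (hu1 0)
  obtain ⟨τ, -, hτ, -, hτ2, -⟩ := exists_pathTo_of_mem_multi hnd h0
  have hnode : ∀ n, u n ∈ H.nodes := fun n => multi_subset _ _ (tracked_subset _ _ (hu1 n))
  have hpath : H.IsPath w (glue τ (fun k => u (k - (j + 1))) (j + 1)) := by
    refine hτ.glue (fun k hk => ?_) ?_
    · have := hu2 (k - (j + 1))
      rw [show j + 1 + (k - (j + 1)) = k by omega,
        show k - (j + 1) + 1 = k + 1 - (j + 1) by omega] at this
      exact ⟨this, hnode _⟩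
    · have := hu2 0
      rw [Nat.add_zero] at this hτ2
      rw [hτ2, show j + 1 + 1 - (j + 1) = 0 + 1 by omega]
      exact ⟨this, hnode _⟩
  have h1 := congrFun (hu _ hpath) (j + 1)
  rw [glue_of_le le_rfl] at h1
  have h2 := hσ.mem_single hnd hu (j + 1)
  rw [← h1] at h2
  rw [Nat.add_zero] at hτ2 h0
  rw [hτ2] at h2
  exact not_mem_multi h2 h0

/-- A path `σ` that leaves the nodes with one path stays among those with several, so the tracked
set is finally never empty. From then on the ghost continues a node with one path forever, which is
a second path of the forest. -/
theorem unique_of_forest_unique (hroot : H.root ∈ H.nodes)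
    (hg : H.ghost ∉ H.nodes) {π : ℕ → V}
    (hπ : H.forest.IsPath H.root (fun i => (w i, H.states w i)) π) (hne : ∀ i, π i ≠ H.ghost)
    (hu : ∀ π', H.forest.IsPath H.root (fun i => (w i, H.states w i)) π' → π' = π)
    (hσ : H.IsPath w σ) : σ = π := by
  obtain ⟨hπ1, hπ2⟩ := isPath_of_forest hroot hπ hne
  by_cases hs : ∀ i, σ i ∈ H.single w i
  · exact hu _ (hσ.isPath_forest hg hs)
  exfalso
  push Not at hs
  obtain ⟨n, hn⟩ := hs
  have hmulti := fun k (hk : n ≤ k) =>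
    hσ.mem_multi_of_le hk ((hσ.mem_or n).resolve_left hn)
  -- If the tracked set is ever empty after layer `n`, it restarts with the current node of `σ` in
  -- it and follows `σ` from there.
  have hex : ∃ N, ∀ k, N ≤ k → H.tracked w k ≠ [] := by
    by_cases hall : ∃ m, n ≤ m ∧ H.tracked w m = []
    · obtain ⟨m, hm, hnil⟩ := hall
      refine ⟨m + 1, fun k hk => List.ne_nil_of_mem (a := σ k) ?_⟩
      induction k, hk using Nat.le_induction with
      | base => rw [tracked_succ_of_nil hnil]; exact hmulti _ (by omega)
      | succ k _ ih =>
        rw [mem_tracked_succ (List.ne_nil_of_mem ih)]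
        exact ⟨(hσ.2 k).2, _, ih, (hσ.2 k).1⟩
    · push Not at hall
      exact ⟨n, hall⟩
  classical
  have hspec := Nat.find_spec hex
  have hmin := fun m => Nat.find_min (H := hex) (m := m)
  generalize Nat.find hex = N at hspec hmin
  obtain _ | j := N
  · exact hspec 0 le_rfl rfl
  -- By minimality of `j + 1` the tracked set is empty in layer `j`. Hence the ghost in layer `j +
  -- 1` has as its parent the head of `H.single w j`, a list that contains `π j` and so is not
  -- empty.
  have hj : H.tracked w j = [] := by
    by_contra hc
    refine hmin j (Nat.lt_succ_self j) fun k hk => ?_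
    rcases Nat.eq_or_lt_of_le hk with rfl | hk
    · exact hc
    · exact hspec k hk
  obtain ⟨u, hhead⟩ : ∃ u, (H.single w j).head? = some u := by
    have := hπ2 j
    cases hc : H.single w j with
    | nil => simp [hc] at this
    | cons a t => exact ⟨a, rfl⟩
  obtain ⟨τ, h1, h2, h3⟩ := exists_pathTo_of_mem_single (List.mem_of_mem_head? hhead)
  have hpath : H.forest.IsPath H.root (fun i => (w i, H.states w i))
      (glue τ (fun _ => H.ghost) j) := by
    refine ⟨by rw [glue_of_le (Nat.zero_le j)]; exact h1.1, fun k => ?_⟩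
    rcases Nat.lt_or_ge k j with hk | hk
    · rw [glue_of_le hk.le, glue_of_le hk]
      exact forestParent_of_mem_single hg (h3 _ hk) (h3 _ hk.le) (h1.2 k hk).1
    · rw [glue_of_lt (show j < k + 1 by omega)]
      refine ⟨?_, List.mem_cons_self⟩
      have htr : (H.autStep (H.states w k) (w k)).2.2.length ≠ 0 := by
        have := hspec (k + 1) (by omega)
        rwa [← List.length_pos_iff, Nat.pos_iff_ne_zero] at this
      simp only [forest, forestParent, if_true, if_neg htr]
      rcases Nat.eq_or_lt_of_le hk with rfl | hk
      · rw [if_pos (by rw [show (H.states w j).2.2 = [] from hj]; rfl), glue_of_le le_rfl, h2]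
        exact hhead
      · have := hspec k hk
        rw [if_neg (by rwa [← List.length_pos_iff, Nat.pos_iff_ne_zero] at this), glue_of_lt hk]
  have := congrFun (hu _ hpath) (j + 1)
  rw [glue_of_lt (Nat.lt_succ_self j)] at this
  exact hne _ this.symm

/-- The forest has a unique infinite path, which does not contain the ghost, if and only if the
graph has a unique infinite path. -/
theorem forest_unique_iff (hnd : H.nodes.Nodup) (hroot : H.root ∈ H.nodes)
    (hg : H.ghost ∉ H.nodes) (π : ℕ → V) :
    (H.forest.IsPath H.root (fun i => (w i, H.states w i)) π ∧
      (∀ π', H.forest.IsPath H.root (fun i => (w i, H.states w i)) π' → π' = π) ∧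
      ∀ i, π i ≠ H.ghost) ↔ H.IsPath w π ∧ ∀ σ, H.IsPath w σ → σ = π := by
  constructor
  · rintro ⟨h1, h2, h3⟩
    exact ⟨(isPath_of_forest hroot h1 h3).1, fun σ hσ =>
      unique_of_forest_unique hroot hg h1 h3 h2 hσ⟩
  · rintro ⟨h1, h2⟩
    have h3 := h1.mem_single hnd h2
    exact ⟨h1.isPath_forest hg h3,
      fun π' hπ' => forest_unique_of_unique hnd hroot hg h1 h2 hπ',
      fun i e => hg (e ▸ single_subset hroot _ _ (h3 i))⟩

end LayeredGraph

/-! ### Renaming letters and states -/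

theorem concatPrefix_map {B B' : Type*} (f : B → B') (w : ℕ → List B) (n : ℕ) :
    concatPrefix (fun i => (w i).map f) n = (concatPrefix w n).map f := by
  induction n with
  | zero => rfl
  | succ n ih => rw [concatPrefix_succ, concatPrefix_succ, ih, List.map_append]

theorem isInfConcat_map_iff {B B' : Type*} (f : B → B') (w : ℕ → List B) (y' : ℕ → B') :
    IsInfConcat (fun i => (w i).map f) y' ↔ ∃ y, IsInfConcat w y ∧ y' = fun i => f (y i) := by
  constructor
  · intro h
    have h' : ∀ i, ∃ b n, (concatPrefix w n)[i]? = some b ∧ f b = y' i := by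
      intro i
      obtain ⟨n, hn⟩ := h i
      rw [concatPrefix_map, List.getElem?_map, Option.map_eq_some_iff] at hn
      obtain ⟨b, h1, h2⟩ := hn
      exact ⟨b, n, h1, h2⟩
    choose y n h1 h2 using h'
    exact ⟨y, fun i => ⟨n i, h1 i⟩, funext fun i => (h2 i).symm⟩
  · rintro ⟨y, h, rfl⟩ i
    obtain ⟨n, hn⟩ := h i
    exact ⟨n, by rw [concatPrefix_map, List.getElem?_map, hn]; rfl⟩

theorem tape_map {A A' : Type*} (f : A → A') (x : ℕ → A) (i : ℕ) :
    TwoDT.tape (fun j => f (x j)) i = (TwoDT.tape x i).map f := by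
  cases i <;> rfl

/-- The effect of renaming letters and states on the relation computed by a transducer. -/
theorem TwoDT.rel_map_iff {A A' B B' Q Q' : Type*} {T : TwoDT A B Q} {T' : TwoDT A' B' Q'}
    {f : A → A'} {g : B → B'} {k : Q → Q'} {x : ℕ → A} (hstart : T'.start = k T.start)
    -- The renaming has to be faithful only on a closed set of states; other states may behave
    -- differently in the two machines.
    {K : Set Q} (hK : T.start ∈ K)
    (hKs : ∀ q ∈ K, ∀ i r, T.step q (tape x i) = some r → r.1 ∈ K)
    (hstep : ∀ q ∈ K, ∀ i, T'.step (k q) ((tape x i).map f) =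
      (T.step q (tape x i)).map fun r => (k r.1, r.2.1, r.2.2.map g))
    (y' : ℕ → B') :
    T'.Rel (fun i => f (x i)) y' ↔ ∃ y, T.Rel x y ∧ y' = fun i => g (y i) := by
  simp only [rel_iff]
  set σ := T.toMach.sys (tape x) with hσ
  set σ' := T'.toMach.sys (tape fun i => f (x i)) with hσ'
  let F : Q × ℕ → Q' × ℕ := fun c => (k c.1, c.2)
  have hF : ∀ c : Q × ℕ, c.1 ∈ K →
      σ' (F c) = (σ c).map fun r => (F r.1, r.2.map g) := by
    intro c hc
    simp only [hσ, hσ', Mach.sys, toMach, F, tape_map, hstep c.1 hc]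
    cases T.step c.1 (tape x c.2) with
    | none => rfl
    | some r =>
      simp only [Option.map_some, Option.bind_some]
      cases movePos (some r.2.1) c.2 <;> rfl
  have hKnext : ∀ c : Q × ℕ, c.1 ∈ K → (σ.next c).1 ∈ K := by
    intro c hc
    cases hs : σ c with
    | none => simpa [DetSys.next, hs] using hc
    | some r =>
      obtain ⟨c', α⟩ := r
      rw [DetSys.next_eq hs]
      obtain ⟨d, h1, -⟩ := Mach.exists_of_sys hs
      simp only [toMach, Option.map_eq_some_iff] at h1
      obtain ⟨r, hr, he⟩ := h1
      have := hKs c.1 hc _ _ hr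
      rwa [show r.1 = c'.1 from congrArg Prod.fst he] at this
  have hnext : ∀ c : Q × ℕ, c.1 ∈ K → σ'.next (F c) = F (σ.next c) := by
    intro c hc
    rw [DetSys.next, DetSys.next, hF c hc]
    cases σ c <;> rfl
  have hout : ∀ c : Q × ℕ, c.1 ∈ K → σ'.out (F c) = (σ.out c).map g := by
    intro c hc
    rw [DetSys.out, DetSys.out, hF c hc]
    cases σ c <;> rfl
  have hconf : ∀ n, (σ.conf (T.start, 0) n).1 ∈ K ∧
      σ'.conf (T'.start, 0) n = F (σ.conf (T.start, 0) n) := by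
    intro n
    induction n with
    | zero => exact ⟨hK, by simp [DetSys.conf, F, hstart]⟩
    | succ n ih =>
      rw [DetSys.conf_succ, DetSys.conf_succ, ih.2]
      exact ⟨hKnext _ ih.1, hnext _ ih.1⟩
  have hout' : (fun n => σ'.out (σ'.conf (T'.start, 0) n)) =
      fun n => (σ.out (σ.conf (T.start, 0) n)).map g := by
    funext n
    rw [(hconf n).2, hout _ (hconf n).1]
  have hacc : T'.toMach.Accepts (tape fun i => f (x i)) y' ↔
      (∀ n, (σ (σ.conf (T.start, 0) n)).isSome) ∧
      Tendsto (fun n => (σ.conf (T.start, 0) n).2) atTop atTop ∧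
      IsInfConcat (fun n => (σ.out (σ.conf (T.start, 0) n)).map g) y' := by
    change σ'.Acc Prod.snd (T'.start, 0) y' ↔ _
    rw [DetSys.Acc, hout']
    refine and_congr (forall_congr' fun n => ?_) (and_congr_left' ?_)
    · rw [(hconf n).2, hF _ (hconf n).1, Option.isSome_map]
    · simp only [(hconf _).2, F]
  rw [hacc, isInfConcat_map_iff]
  constructor
  · rintro ⟨h1, h2, y, h3, h4⟩
    exact ⟨y, ⟨h1, h2, h3⟩, h4⟩
  · rintro ⟨y, ⟨h1, h2, h3⟩, h4⟩
    exact ⟨h1, h2, y, h3, h4⟩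

theorem isInfConcat_succ_iff {B : Type*} {w : ℕ → List B} {c : B} (h0 : w 0 = [c]) (Z : ℕ → B) :
    IsInfConcat w Z ↔ Z 0 = c ∧ IsInfConcat (fun i => w (i + 1)) fun i => Z (i + 1) := by
  have hpre : ∀ n, concatPrefix w (n + 1) = c :: concatPrefix (fun i => w (i + 1)) n := by
    intro n
    rw [add_comm, concatPrefix_add]
    simp [concatPrefix, h0, add_comm]
  constructor
  · intro h
    have h' : ∀ i, ∃ n, (concatPrefix w (n + 1))[i]? = some (Z i) := fun i => by
      obtain ⟨n, hn⟩ := h i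
      exact ⟨n, getElem?_of_prefix (concatPrefix_prefix _ (Nat.le_succ n)) hn⟩
    simp only [hpre] at h'
    refine ⟨?_, fun i => ?_⟩
    · obtain ⟨n, hn⟩ := h' 0
      simpa using hn.symm
    · obtain ⟨n, hn⟩ := h' (i + 1)
      exact ⟨n, by simpa using hn⟩
  · rintro ⟨rfl, h⟩ i
    cases i with
    | zero => exact ⟨1, by rw [hpre 0]; rfl⟩
    | succ i =>
      obtain ⟨n, hn⟩ := h i
      exact ⟨n + 1, by rw [hpre]; simpa using hn⟩

/-! ### The machines given by descriptions -/

/-- The value of a key in an association list. -/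
def assoc {α β : Type*} [DecidableEq α] (l : List (α × β)) (a : α) : Option β := l.lookup a

theorem mem_of_assoc_eq_some {α β : Type*} [DecidableEq α] {l : List (α × β)} {a : α} {b : β}
    (h : assoc l a = some b) : (a, b) ∈ l := mem_of_lookup_eq_some h

/-- The two-way transducer with a given description. -/
def TwoDT.ofCode (c : TwoDTCode) : TwoDT ℕ ℕ ℕ where
  start := c.2.1
  step q l := assoc c.2.2 (q, l)

/-- The list in a code may have repetitions, but its entries form the graph of a function, so the
first entry found is the right one. -/
theorem TwoDT.IsCode.ofCode_step {a b n : ℕ} {T : TwoDT (Fin a) (Fin b) (Fin n)} {c : TwoDTCode}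
    (h : T.IsCode c) (q : Fin n) (s : Option (Fin a)) :
    (ofCode c).step q.val (s.map Fin.val) =
      (T.step q s).map fun r => (r.1.val, r.2.1, r.2.2.map Fin.val) := by
  have hmem : ∀ r, ((q.val, s.map Fin.val), r) ∈ c.2.2 ↔
      (T.step q s).map (fun r => (r.1.val, r.2.1, r.2.2.map Fin.val)) = some r := by
    intro r
    rw [h.2.2, Option.map_eq_some_iff]
    constructor
    · rintro ⟨q', s', q₁, d, α, h1, h2⟩
      simp only [Prod.mk.injEq] at h2
      obtain ⟨⟨h3, h4⟩, h5⟩ := h2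
      obtain rfl := Fin.val_injective h3
      obtain rfl := Option.map_injective Fin.val_injective h4
      exact ⟨_, h1, h5.symm⟩
    · rintro ⟨⟨q₁, d, α⟩, h1, rfl⟩
      exact ⟨q, s, q₁, d, α, h1, rfl⟩
  ext r
  rw [← hmem]
  refine ⟨mem_of_assoc_eq_some, fun hr => ?_⟩
  obtain ⟨b', hb'⟩ := exists_lookup_of_mem hr
  have := (hmem _).1 (mem_of_lookup_eq_some hb')
  rw [(hmem _).1 hr] at this
  obtain rfl := Option.some.inj this
  exact hb'

theorem TwoDT.IsCode.rel_ofCode_iff {a b n : ℕ} {T : TwoDT (Fin a) (Fin b) (Fin n)}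
    {c : TwoDTCode} (h : T.IsCode c) (x : ℕ → Fin a) (y' : ℕ → ℕ) :
    (ofCode c).Rel (fun i => (x i).val) y' ↔ ∃ y, T.Rel x y ∧ y' = fun i => (y i).val :=
  rel_map_iff (k := Fin.val) h.2.1 (Set.mem_univ _) (fun _ _ _ _ _ => Set.mem_univ _)
    (fun q _ _ => h.ofCode_step q _) y'

/-- The graph of the runs of a one-way transducer: node `0` is the root, before the end marker is
read, node `1` is the ghost and node `q + 2` is the state `q`. -/
def OneNTCode.graph (c : OneNTCode) : LayeredGraph (Option ℕ) ℕ where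
  edge l v v' :=
    match l with
    | none => decide (v = 0 ∧ 2 ≤ v' ∧ v' - 2 ∈ c.2.1)
    | some a => decide (2 ≤ v ∧ 2 ≤ v' ∧ (assoc c.2.2 (v - 2, a, v' - 2)).isSome)
  nodes := 0 :: (List.range c.1.2.2).map (· + 2)
  root := 0
  ghost := 1

/-- The part of the tape of the second transducer that belongs to a step of the first one. -/
def OneNTCode.block {X : Type*} (c : OneNTCode) (e : ℕ × (Option ℕ × X) × ℕ) : List (Option ℕ) :=
  match e.2.1.1 with
  | none => [none]
  -- A step into the ghost has an empty block, so a path that ends in the ghost has only finitely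
  -- many letters.
  | some a => if e.2.2 = 1 then [] else ((assoc c.2.2 (e.1 - 2, a, e.2.2 - 2)).getD []).map some

/-- The nodes on the path of a run. -/
def nodePath {n : ℕ} (ρ : ℕ → Fin n) : ℕ → ℕ
  | 0 => 0
  | i + 1 => (ρ i).val + 2

namespace OneNT

variable {a b n : ℕ} {N : OneNT (Fin a) (Fin b) (Fin n)} {c : OneNTCode}

theorem IsCode.assoc_eq (h : N.IsCode c) (q : Fin n) (s : Fin a) (q' : Fin n) :
    assoc c.2.2 (q.val, s.val, q'.val) = (N.trans q s q').map (List.map Fin.val) := by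
  have hmem : ∀ r, ((q.val, s.val, q'.val), r) ∈ c.2.2 ↔
      (N.trans q s q').map (List.map Fin.val) = some r := by
    intro r
    rw [h.2.2.2, Option.map_eq_some_iff]
    constructor
    · rintro ⟨q₁, s₁, q₁', α, h1, h2⟩
      simp only [Prod.mk.injEq] at h2
      obtain ⟨⟨h3, h4, h5⟩, h6⟩ := h2
      obtain rfl := Fin.val_injective h3
      obtain rfl := Fin.val_injective h4
      obtain rfl := Fin.val_injective h5
      exact ⟨_, h1, h6.symm⟩
    · rintro ⟨α, h1, rfl⟩
      exact ⟨q, s, q', α, h1, rfl⟩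
  ext r
  rw [← hmem]
  refine ⟨mem_of_assoc_eq_some, fun hr => ?_⟩
  obtain ⟨b', hb'⟩ := exists_lookup_of_mem hr
  have := (hmem _).1 (mem_of_lookup_eq_some hb')
  rw [(hmem _).1 hr] at this
  obtain rfl := Option.some.inj this
  exact hb'

theorem IsCode.mem_nodes_iff (h : N.IsCode c) (v : ℕ) :
    v ∈ c.graph.nodes ↔ v = 0 ∨ ∃ q : Fin n, v = q.val + 2 := by
  have hn : c.1.2.2 = n := by rw [h.2.1]
  simp only [OneNTCode.graph, List.mem_cons, List.mem_map, List.mem_range, hn]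
  refine or_congr_right ⟨?_, ?_⟩
  · rintro ⟨q, hq, rfl⟩; exact ⟨⟨q, hq⟩, rfl⟩
  · rintro ⟨q, rfl⟩; exact ⟨q.val, q.isLt, rfl⟩

theorem IsCode.isPath_nodePath (h : N.IsCode c) {x : ℕ → Fin a} {ρ : ℕ → Fin n}
    (hρ : N.IsAccepting x ρ) :
    c.graph.IsPath (TwoDT.tape fun i => (x i).val) (nodePath ρ) := by
  refine ⟨rfl, fun i => ⟨?_, (h.mem_nodes_iff _).2 (.inr ⟨ρ i, rfl⟩)⟩⟩
  cases i with
  | zero =>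
    simp only [OneNTCode.graph, TwoDT.tape, nodePath, decide_eq_true_eq]
    refine ⟨trivial, by omega, ?_⟩
    rw [Nat.add_sub_cancel, h.2.2.1]
    exact ⟨ρ 0, hρ.2.1, rfl⟩
  | succ i =>
    simp only [OneNTCode.graph, TwoDT.tape, nodePath, decide_eq_true_eq, Nat.add_sub_cancel,
      h.assoc_eq, Option.isSome_map]
    exact ⟨by omega, by omega, hρ.1 i⟩

/-- Here the transducer has to be restricted: any infinite path from the root is an accepting run
because all states are final. -/
theorem IsCode.exists_of_isPath (h : N.IsCode c) {x : ℕ → Fin a} {σ : ℕ → ℕ}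
    (hσ : c.graph.IsPath (TwoDT.tape fun i => (x i).val) σ) :
    ∃ ρ, N.IsAccepting x ρ ∧ σ = nodePath ρ := by
  have hnode : ∀ i, ∃ q : Fin n, σ (i + 1) = q.val + 2 := by
    intro i
    obtain ⟨he, hm⟩ := hσ.2 i
    refine ((h.mem_nodes_iff _).1 hm).resolve_left fun h0 => ?_
    rw [h0] at he
    cases i <;> simp [OneNTCode.graph, TwoDT.tape] at he
  choose ρ hρ using hnode
  have hpath : σ = nodePath ρ := by
    funext i
    cases i with
    | zero => exact hσ.1
    | succ i => exact hρ i
  refine ⟨ρ, ⟨fun i => ?_, ?_, fun i => ⟨i, le_rfl, h.1 _⟩⟩, hpath⟩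
  · have := (hσ.2 (i + 1)).1
    rw [hpath] at this
    simp only [OneNTCode.graph, TwoDT.tape, nodePath, decide_eq_true_eq, Nat.add_sub_cancel,
      h.assoc_eq, Option.isSome_map] at this
    exact this.2.2
  · have := (hσ.2 0).1
    rw [hpath] at this
    simp only [OneNTCode.graph, TwoDT.tape, nodePath, decide_eq_true_eq, Nat.add_sub_cancel] at this
    obtain ⟨q, hq, he⟩ := (h.2.2.1 _).1 this.2.2
    rwa [← Fin.val_injective he] at hq

theorem nodePath_injective : Function.Injective (nodePath (n := n)) := by
  intro ρ ρ' h
  funext i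
  have := congrFun h (i + 1)
  simp only [nodePath] at this
  exact Fin.val_injective (by omega)

theorem IsCode.unique_iff (h : N.IsCode c) (x : ℕ → Fin a) (σ : ℕ → ℕ) :
    (c.graph.IsPath (TwoDT.tape fun i => (x i).val) σ ∧
      ∀ σ', c.graph.IsPath (TwoDT.tape fun i => (x i).val) σ' → σ' = σ) ↔
    ∃ ρ, σ = nodePath ρ ∧ N.IsAccepting x ρ ∧ ∀ ρ', N.IsAccepting x ρ' → ρ' = ρ := by
  constructor
  · rintro ⟨h1, h2⟩
    obtain ⟨ρ, h3, rfl⟩ := h.exists_of_isPath h1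
    exact ⟨ρ, rfl, h3, fun ρ' hρ' => nodePath_injective (h2 _ (h.isPath_nodePath hρ'))⟩
  · rintro ⟨ρ, rfl, h1, h2⟩
    refine ⟨h.isPath_nodePath h1, fun σ' hσ' => ?_⟩
    obtain ⟨ρ', h3, rfl⟩ := h.exists_of_isPath hσ'
    rw [h2 _ h3]

theorem IsCode.block_succ (h : N.IsCode c) {X : Type*} (x : ℕ → Fin a) (ρ : ℕ → Fin n) (d : X)
    (i : ℕ) : c.block (nodePath ρ (i + 1), (TwoDT.tape (fun i => (x i).val) (i + 1), d),
      nodePath ρ (i + 2)) = (N.runOutput x ρ i).map fun s => some s.val := by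
  simp only [OneNTCode.block, TwoDT.tape, nodePath, runOutput, Nat.add_sub_cancel, h.assoc_eq]
  rw [if_neg (by omega)]
  cases N.trans (ρ i) (x i) (ρ (i + 1)) <;> simp

/-- The edge that leaves the root contributes the end marker of the second tape, the later edges
contribute the outputs of the run. -/
theorem IsCode.isInfConcat_block_iff (h : N.IsCode c) {X : Type*} (x : ℕ → Fin a) (ρ : ℕ → Fin n)
    (d : ℕ → X) (Z : ℕ → Option ℕ) :
    IsInfConcat (fun i => c.block (nodePath ρ i, (TwoDT.tape (fun i => (x i).val) i, d i),
      nodePath ρ (i + 1))) Z ↔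
    ∃ z, IsInfConcat (N.runOutput x ρ) z ∧ Z = TwoDT.tape fun i => (z i).val := by
  rw [isInfConcat_succ_iff (c := none) rfl]
  simp only [h.block_succ]
  rw [isInfConcat_map_iff]
  constructor
  · rintro ⟨h0, z, hz, he⟩
    refine ⟨z, hz, ?_⟩
    funext i
    cases i with
    | zero => exact h0
    | succ i => exact congrFun he i
  · rintro ⟨z, hz, rfl⟩
    exact ⟨rfl, z, hz, rfl⟩

end OneNT

/-! ### The machine for the composition -/

/-- All sublists. -/
def allSublists (l : List ℕ) : List (List ℕ) :=
  l.foldr (fun a s => s ++ s.map (List.cons a)) [[]]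

theorem filter_mem_allSublists (p : ℕ → Bool) (l : List ℕ) : l.filter p ∈ allSublists l := by
  induction l with
  | nil => simp [allSublists]
  | cons a l ih =>
    simp only [allSublists, List.foldr_cons] at ih ⊢
    rw [List.filter_cons, List.mem_append]
    split_ifs
    · exact .inr (List.mem_map.2 ⟨_, ih, rfl⟩)
    · exact .inl ih

/-- All triples of sublists. -/
def allStates (l : List ℕ) : List (List ℕ × List ℕ × List ℕ) :=
  (allSublists l).flatMap fun u => (allSublists l).flatMap fun v =>
    (allSublists l).map fun t => (u, v, t)

theorem mem_allStates {l : List ℕ} {d : List ℕ × List ℕ × List ℕ} : d ∈ allStates l ↔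
    d.1 ∈ allSublists l ∧ d.2.1 ∈ allSublists l ∧ d.2.2 ∈ allSublists l := by
  obtain ⟨u, v, t⟩ := d
  simp [allStates]

/-- The states that the automaton may have before a letter is read. -/
def OneNTCode.candStates (c : OneNTCode) (l : Option ℕ) : List (List ℕ × List ℕ × List ℕ) :=
  -- The end marker occurs only at position `0`, where the state of the automaton is known; this
  -- single candidate ends every search to the left.
  if l = none then [c.graph.autStart] else allStates c.graph.nodes

/-- The second transducer on the sequence of transitions of the first one. -/
def transitionMach (c : OneNTCode × TwoDTCode) :
    Mach (ℕ × (Option ℕ × (List ℕ × List ℕ × List ℕ)) × ℕ) (ℕ × ℕ × Bool) ℕ :=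
  (TwoDT.ofCode c.2).toMach.onBlocks c.1.block

def pathMach (c : OneNTCode × TwoDTCode) :
    Mach (Option ℕ × (List ℕ × List ℕ × List ℕ))
      ((ℕ × (ℕ × ℕ × Bool) × ℕ × ℕ) × ℕ × List (ℕ × ℕ)) ℕ :=
  ((transitionMach c).alongPath c.1.graph.forestParent 0).resolve c.1.graph.forest

/-- The states of the machine for the composition, apart from stay moves. -/
abbrev CompState : Type :=
  (Bool × ((ℕ × (ℕ × ℕ × Bool) × ℕ × ℕ) × ℕ × List (ℕ × ℕ)) × (List ℕ × List ℕ × List ℕ)) × ℕ ×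
    List ((List ℕ × List ℕ × List ℕ) × (List ℕ × List ℕ × List ℕ))

def compMach (c : OneNTCode × TwoDTCode) : Mach (Option ℕ) CompState ℕ :=
  ((pathMach c).lookbehind c.1.graph.autStep c.1.graph.autStart).resolve
    (autResolver c.1.graph.autStep c.1.candStates)

theorem OneNTCode.states_mem_candStates (c : OneNTCode) (x : ℕ → ℕ) (i : ℕ) :
    autStates c.graph.autStep c.graph.autStart (TwoDT.tape x) i ∈
      c.candStates (TwoDT.tape x i) := by
  cases i with
  | zero => simp [candStates, TwoDT.tape, autStates]
  | succ i =>
    rw [candStates, if_neg (by simp [TwoDT.tape]), mem_allStates]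
    refine ⟨filter_mem_allSublists _ _, filter_mem_allSublists _ _, ?_⟩
    simp only [autStates, LayeredGraph.autStep, LayeredGraph.trackNext, LayeredGraph.multiNext]
    split_ifs <;> exact filter_mem_allSublists _ _

/-- The machine is taken apart from outside: stay moves, automaton states, path of the forest,
blocks. What remains is a unique path of the forest along which the blocks form a tape that the
second transducer accepts. -/
theorem rel_compMach_iff {a b c n m : ℕ} {N : OneNT (Fin a) (Fin b) (Fin n)}
    {T : TwoDT (Fin b) (Fin c) (Fin m)} {cN : OneNTCode} {cT : TwoDTCode} (hN : N.IsCode cN)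
    (hT : T.IsCode cT) (x : ℕ → Fin a) (y' : ℕ → ℕ) :
    (compMach (cN, cT)).toTwoDT.Rel (fun i => (x i).val) y' ↔
      ∃ y, (∃ z, N.RestrictedRel x z ∧ T.Rel z y) ∧ y' = fun i => (y i).val := by
  set w := TwoDT.tape fun i => (x i).val with hw
  have hnd : cN.graph.nodes.Nodup := by
    simp only [OneNTCode.graph, List.nodup_cons, List.mem_map, not_exists, not_and]
    exact ⟨fun _ _ => by omega, List.nodup_range.map (add_left_injective 2)⟩
  have hroot : cN.graph.root ∈ cN.graph.nodes := by simp [OneNTCode.graph]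
  have hg : cN.graph.ghost ∉ cN.graph.nodes := by
    simp only [OneNTCode.graph, List.mem_cons, List.mem_map, not_or, not_exists, not_and]
    exact ⟨one_ne_zero, fun _ _ => by omega⟩
  rw [Mach.rel_toTwoDT_iff, compMach,
    Mach.accepts_lookbehind_iff _ rfl (cN.states_mem_candStates _)]
  change (pathMach (cN, cT)).Accepts (fun i => (w i, cN.graph.states w i)) y' ↔ _
  have hfin : ∀ i, ∀ u ∈ cN.graph.forest.cand (w i, cN.graph.states w i),
    u ∈ {u | u ∈ cN.graph.ghost :: cN.graph.nodes} := fun i u hu => hu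
  rw [show pathMach (cN, cT) = ((transitionMach (cN, cT)).alongPath cN.graph.forest.parent
    cN.graph.root).resolve cN.graph.forest from rfl,
    Mach.accepts_alongPath_iff rfl (List.finite_toSet _) hfin]
  have hblock0 : ∀ π : ℕ → ℕ, cN.block (π 0, (w 0, cN.graph.states w 0), π 1) ≠ [] := by
    intro π
    simp [OneNTCode.block, hw, TwoDT.tape]
  constructor
  · rintro ⟨π, h1, h2, h3⟩
    obtain ⟨Z, hZ⟩ := Mach.isInfConcat_of_accepts_onBlocks h3
    rw [transitionMach, Mach.accepts_onBlocks_iff _ hZ (hblock0 π)] at h3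
    -- The unique path of the forest might be that of the ghost, but infinitely many blocks on `π`
    -- are nonempty.
    have hne : ∀ i, π i ≠ cN.graph.ghost := by
      intro i hi
      have hghost : ∀ k, i ≤ k → π k = cN.graph.ghost := by
        intro k hk
        induction k, hk using Nat.le_induction with
        | base => exact hi
        | succ k _ ih =>
          by_contra hc
          have := (LayeredGraph.mem_single_of_forestParent hc (h1.2 k).1).2.1
          rw [ih] at this
          exact hg (LayeredGraph.single_subset hroot _ _ this)
      obtain ⟨k, hk, hk'⟩ := hZ.exists_ne_nil (i + 1)
      apply hk'
      obtain ⟨k, rfl⟩ : ∃ k', k = k' + 1 := ⟨k - 1, by omega⟩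
      have := hghost (k + 1 + 1) (by omega)
      simp only [OneNTCode.block, hw, TwoDT.tape]
      exact if_pos this
    obtain ⟨ρ, rfl, h4, h5⟩ := (hN.unique_iff x π).1
      ((LayeredGraph.forest_unique_iff hnd hroot hg π).1 ⟨h1, h2, hne⟩)
    obtain ⟨z, hz, rfl⟩ := (hN.isInfConcat_block_iff x ρ _ Z).1 hZ
    rw [← TwoDT.rel_iff, hT.rel_ofCode_iff] at h3
    obtain ⟨y, hy, rfl⟩ := h3
    exact ⟨y, ⟨z, ⟨⟨ρ, h4, h5⟩, ρ, h4, hz⟩, hy⟩, rfl⟩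
  · rintro ⟨y, ⟨z, ⟨hu, ρ, hρ, hz⟩, hy⟩, rfl⟩
    obtain ⟨h1, h2, -⟩ := (LayeredGraph.forest_unique_iff hnd hroot hg (nodePath ρ)).2
      ((hN.unique_iff x _).2 ⟨ρ, rfl, hρ, fun ρ' hρ' => hu.unique hρ' hρ⟩)
    refine ⟨nodePath ρ, h1, h2, ?_⟩
    have hZ := (hN.isInfConcat_block_iff x ρ (cN.graph.states w) _).2 ⟨z, hz, rfl⟩
    rw [transitionMach, Mach.accepts_onBlocks_iff _ hZ (hblock0 _), ← TwoDT.rel_iff,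
      hT.rel_ofCode_iff]
    exact ⟨y, hy, rfl⟩

/-! ### Finite sets of states -/

theorem finite_lists {α : Type*} {K : Set α} (hK : K.Finite) (n : ℕ) :
    {l : List α | l.length ≤ n ∧ ∀ a ∈ l, a ∈ K}.Finite := by
  have := hK.to_subtype
  refine ((List.finite_length_le K n).image (List.map Subtype.val)).subset ?_
  rintro l ⟨h1, h2⟩
  exact ⟨l.attach.map fun a => ⟨a.1, h2 a.1 a.2⟩, by simpa using h1, by simp⟩

/-- `K` is a finite set of states that contains the initial state and is closed under the steps on
letters in `Λ`, and the output of these steps is in `Γ`. -/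
def Mach.ClosedOn {L S C : Type*} (M : Mach L S C) (Λ : Set L) (Γ : Set C) (K : Set S) : Prop :=
  K.Finite ∧ M.start ∈ K ∧
    ∀ s ∈ K, ∀ l ∈ Λ, ∀ r, M.step s l = some r → r.1 ∈ K ∧ ∀ c ∈ r.2.2, c ∈ Γ

theorem TwoDT.closedOn_ofCode (c : TwoDTCode) {Γ : Set ℕ}
    (h : ∀ t ∈ c.2.2, ∀ o ∈ t.2.2.2, o ∈ Γ) :
    ∃ K, (ofCode c).toMach.ClosedOn Set.univ Γ K := by
  refine ⟨insert c.2.1 ((fun t : (ℕ × Option ℕ) × ℕ × Bool × List ℕ => t.2.1) '' {t | t ∈ c.2.2}),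
    ((List.finite_toSet _).image _).insert _, Set.mem_insert _ _, fun s _ l _ r hr => ?_⟩
  simp only [toMach, ofCode, Option.map_eq_some_iff] at hr
  obtain ⟨r', hr', rfl⟩ := hr
  have := mem_of_assoc_eq_some hr'
  exact ⟨.inr ⟨_, this, rfl⟩, h _ this⟩

theorem Mach.ClosedOn.onBlocks {L E S C : Type*} {M : Mach L S C} {Γ : Set C} {K : Set S}
    (hM : M.ClosedOn Set.univ Γ K) {h : E → List L} {B : ℕ} (hB : ∀ e, (h e).length ≤ B) :
    ∃ K', (M.onBlocks h).ClosedOn Set.univ Γ K' := by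
  obtain ⟨hK, hs, hstep⟩ := hM
  refine ⟨K ×ˢ Set.Iic B ×ˢ Set.univ, hK.prod ((Set.finite_Iic B).prod Set.finite_univ),
    ⟨hs, Nat.zero_le B, trivial⟩, ?_⟩
  rintro ⟨s, k, b⟩ ⟨hsK, hk, -⟩ e - r hr
  simp only [Set.mem_Iic] at hk
  simp only [Mach.onBlocks] at hr
  cases b
  · simp only [Bool.false_eq_true, if_false] at hr
    cases hl : (h e)[k]? with
    | none =>
      rw [hl] at hr
      obtain rfl := Option.some.inj hr
      exact ⟨⟨hsK, Nat.zero_le B, trivial⟩, by simp⟩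
    | some l =>
      rw [hl] at hr
      obtain ⟨r', hr', rfl⟩ := Option.map_eq_some_iff.1 hr
      obtain ⟨h3, h4⟩ := hstep s hsK l trivial _ hr'
      have h5 : k < B := (List.getElem?_eq_some_iff.1 hl).1.trans_le (hB e)
      split_ifs
      · exact ⟨⟨h3, h5, trivial⟩, h4⟩
      · exact ⟨⟨h3, hk, trivial⟩, h4⟩
      · exact ⟨⟨h3, Nat.zero_le B, trivial⟩, h4⟩
      · exact ⟨⟨h3, (Nat.sub_le _ _).trans hk, trivial⟩, h4⟩
  · simp only [if_true] at hr
    split_ifs at hr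
    · obtain rfl := Option.some.inj hr
      exact ⟨⟨hsK, Nat.zero_le B, trivial⟩, by simp⟩
    · obtain rfl := Option.some.inj hr
      exact ⟨⟨hsK, (Nat.sub_le _ _).trans (hB e), trivial⟩, by simp⟩

/-- Closed sets of states for machines with queries whose answers are in `Kv`. -/
def QMach.ClosedOn {L S V C : Type*} (M : QMach L S V C) (Λ : Set L) (Γ : Set C) (Kv : Set V)
    (K : Set S) : Prop :=
  M.toMach.ClosedOn Λ Γ K ∧ ∀ s ∈ K, ∀ t ∈ Kv, M.resume s t ∈ K

theorem Mach.ClosedOn.alongPath {L S C V : Type*} {M : Mach (V × L × V) S C} {Γ : Set C}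
    {K : Set S} (hM : M.ClosedOn Set.univ Γ K) {parent : L → V → Option V} {root : V} {Λ : Set L}
    {Kv : Set V} (hKv : Kv.Finite) (hroot : root ∈ Kv)
    (hparent : ∀ l ∈ Λ, ∀ v p, parent l v = some p → p ∈ Kv) :
    ∃ K', (M.alongPath parent root).ClosedOn Λ Γ Kv K' := by
  obtain ⟨hK, hs, hstep⟩ := hM
  refine ⟨Set.Iic 2 ×ˢ K ×ˢ Kv ×ˢ Kv, ⟨(Set.finite_Iic 2).prod (hK.prod (hKv.prod hKv)),
    ⟨Nat.zero_le 2, hs, hroot, hroot⟩, ?_⟩, ?_⟩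
  · rintro ⟨m, s, v, t⟩ ⟨hm, hsK, hv, ht⟩ l hl r hr
    simp only [Mach.alongPath] at hr
    split_ifs at hr
    · obtain ⟨r', hr', rfl⟩ := Option.map_eq_some_iff.1 hr
      obtain ⟨h3, h4⟩ := hstep s hsK _ trivial _ hr'
      refine ⟨⟨?_, h3, ?_⟩, h4⟩
      · dsimp only
        split_ifs <;> simp
      · dsimp only
        split_ifs
        · exact ⟨ht, ht⟩
        · exact ⟨hv, hv⟩
    · obtain ⟨p, hp, rfl⟩ := Option.map_eq_some_iff.1 hr
      have := hparent l hl _ _ hp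
      exact ⟨⟨Nat.zero_le 2, hsK, this, this⟩, by simp⟩
  · rintro ⟨m, s, v, t⟩ ⟨hm, hsK, hv, -⟩ t' ht'
    exact ⟨by simp [Mach.alongPath], hsK, hv, ht'⟩

/-- The lists in the states of a search stay bounded: each is filtered from the candidates of one
letter or arises from such a list by taking parents. -/
theorem QMach.ClosedOn.resolve {L S V C : Type*} [DecidableEq V] {M : QMach L S V C} {Λ : Set L}
    {Γ : Set C} {Kv : Set V} {K : Set S} (hM : M.ClosedOn Λ Γ Kv K) {G : Resolver L V}
    (hKv : Kv.Finite) {B : ℕ} (hcand : ∀ l ∈ Λ, (G.cand l).length ≤ B ∧ ∀ u ∈ G.cand l, u ∈ Kv)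
    (hparent : ∀ l ∈ Λ, ∀ v p, G.parent l v = some p → p ∈ Kv) :
    ∃ K', (M.resolve G).ClosedOn Λ Γ K' := by
  obtain ⟨⟨hK, hs, hstep⟩, hres⟩ := hM
  set W : Set (List (V × V)) := {φ | φ.length ≤ B ∧ ∀ z ∈ φ, z ∈ Kv ×ˢ Kv} with hW
  have hinit : ∀ l ∈ Λ, ∀ v, G.init l v ∈ W := by
    intro l hl v
    refine ⟨(List.length_filterMap_le _ _).trans (hcand l hl).1, fun z hz => ?_⟩
    simp only [Resolver.init, List.mem_filterMap] at hz
    obtain ⟨u, hu, h⟩ := hz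
    split_ifs at h
    obtain rfl := Option.some.inj h
    exact ⟨(hcand l hl).2 u hu, (hcand l hl).2 u hu⟩
  have hnext : ∀ l ∈ Λ, ∀ φ ∈ W, G.next l φ ∈ W := by
    intro l hl φ hφ
    refine ⟨(List.length_filterMap_le _ _).trans (hcand l hl).1, fun z hz => ?_⟩
    simp only [Resolver.next, List.mem_filterMap, Option.map_eq_some_iff,
      Option.bind_eq_some_iff] at hz
    obtain ⟨u, hu, t, ⟨p, -, hp⟩, rfl⟩ := hz
    exact ⟨(hcand l hl).2 u hu, (hφ.2 _ (mem_of_lookup_eq_some hp)).2⟩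
  have hback : ∀ l ∈ Λ, ∀ φ ∈ W, G.back l φ ∈ W := by
    intro l hl φ hφ
    refine ⟨(List.length_filterMap_le _ _).trans hφ.1, fun z hz => ?_⟩
    obtain ⟨u, hu, hp⟩ := Resolver.back_mem.1 hz
    exact ⟨(hφ.2 _ hu).1, hparent l hl _ _ hp⟩
  have hnil : ([] : List (V × V)) ∈ W := ⟨Nat.zero_le B, by simp⟩
  refine ⟨K ×ˢ Set.Iic 2 ×ˢ W, hK.prod ((Set.finite_Iic 2).prod (finite_lists (hKv.prod hKv) B)),
    ⟨hs, Nat.zero_le 2, hnil⟩, ?_⟩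
  rintro ⟨s, m, φ⟩ ⟨hsK, hm, hφ⟩ l hl r hr
  simp only [QMach.resolve] at hr
  simp only at hsK hφ
  split_ifs at hr with h1 h2 h3 h4
  · cases hq : M.query s l with
    | none =>
      rw [hq] at hr
      obtain ⟨r', hr', rfl⟩ := Option.map_eq_some_iff.1 hr
      obtain ⟨h3, h4⟩ := hstep s hsK l hl _ hr'
      exact ⟨⟨h3, Nat.zero_le 2, hnil⟩, h4⟩
    | some v =>
      rw [hq] at hr
      simp only at hr
      split_ifs at hr
      · obtain ⟨z, hz, rfl⟩ := Option.map_eq_some_iff.1 hr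
        have := (hinit l hl v).2 _ (List.mem_of_mem_head? hz)
        exact ⟨⟨hres s hsK _ this.2, Nat.zero_le 2, hnil⟩, by simp⟩
      · obtain rfl := Option.some.inj hr
        exact ⟨⟨hsK, by simp, hinit l hl v⟩, by simp⟩
  · obtain ⟨z, hz, rfl⟩ := Option.map_eq_some_iff.1 hr
    have hz' := (hnext l hl φ hφ).2 _ (List.mem_of_mem_head? hz)
    refine ⟨⟨hsK, by simp, ?_, ?_⟩, by simp⟩
    · simpa using hφ.1
    · intro y hy
      obtain ⟨x, hx, rfl⟩ := List.mem_map.1 hy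
      exact ⟨hz'.2, (hφ.2 x hx).1⟩
  · obtain rfl := Option.some.inj hr
    exact ⟨⟨hsK, by simp, hnext l hl φ hφ⟩, by simp⟩
  · obtain ⟨z, hz, rfl⟩ := Option.map_eq_some_iff.1 hr
    have hz' := (hback l hl φ hφ).2 _ (List.mem_of_mem_head? hz)
    exact ⟨⟨hres s hsK _ hz'.1, Nat.zero_le 2, hnil⟩, by simp⟩
  · obtain rfl := Option.some.inj hr
    exact ⟨⟨hsK, by simp, hback l hl φ hφ⟩, by simp⟩

/-- `M` reads the stored automaton state, which never leaves `Kx`, so it suffices that `M` is closed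
on letters with second component in `Kx`. -/
theorem Mach.ClosedOn.lookbehind {L S C X : Type*} {M : Mach (L × X) S C} {Γ : Set C}
    {K : Set S} {Kx : Set X} (hM : M.ClosedOn {l | l.2 ∈ Kx} Γ K) {δ : X → L → X} {d₀ : X}
    (hKx : Kx.Finite) (hd₀ : d₀ ∈ Kx) (hδ : ∀ d l, δ d l ∈ Kx) :
    ∃ K', (M.lookbehind δ d₀).ClosedOn Set.univ Γ Kx K' := by
  obtain ⟨hK, hs, hstep⟩ := hM
  refine ⟨Set.univ ×ˢ K ×ˢ Kx, ⟨Set.finite_univ.prod (hK.prod hKx), ⟨trivial, hs, hd₀⟩, ?_⟩, ?_⟩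
  · rintro ⟨b, s, d⟩ ⟨-, hsK, hd⟩ l - r hr
    obtain ⟨r', hr', rfl⟩ := Option.map_eq_some_iff.1 hr
    obtain ⟨h3, h4⟩ := hstep s hsK (l, d) hd _ hr'
    refine ⟨⟨trivial, h3, ?_⟩, h4⟩
    dsimp only
    split_ifs
    · exact hδ d l
    · exact hd
  · rintro ⟨b, s, d⟩ ⟨-, hsK, -⟩ t ht
    exact ⟨trivial, hsK, ht⟩

theorem Mach.ClosedOn.toTwoDT {A S C : Type*} {M : Mach (Option A) S C} {Γ : Set C}
    {K : Set S} (hM : M.ClosedOn Set.univ Γ K) :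
    ∃ K' : Set (S × Bool), K'.Finite ∧ M.toTwoDT.start ∈ K' ∧ ∀ s ∈ K', ∀ l r,
      M.toTwoDT.step s l = some r → r.1 ∈ K' ∧ ∀ c ∈ r.2.2, c ∈ Γ := by
  obtain ⟨hK, hs, hstep⟩ := hM
  refine ⟨K ×ˢ Set.univ, hK.prod Set.finite_univ, ⟨hs, trivial⟩, ?_⟩
  rintro ⟨s, b⟩ ⟨hsK, -⟩ l r hr
  simp only [Mach.toTwoDT] at hr
  split_ifs at hr
  · obtain rfl := Option.some.inj hr
    exact ⟨⟨hsK, trivial⟩, by simp⟩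
  · obtain ⟨r', hr', rfl⟩ := Option.map_eq_some_iff.1 hr
    obtain ⟨h3, h4⟩ := hstep s hsK l trivial _ hr'
    exact ⟨⟨h3, trivial⟩, h4⟩

theorem OneNTCode.exists_block_le {X : Type*} (c : OneNTCode) :
    ∃ B, ∀ e : ℕ × (Option ℕ × X) × ℕ, (c.block e).length ≤ B := by
  obtain ⟨B, hB⟩ := ((List.finite_toSet c.2.2).image
    fun t : (ℕ × ℕ × ℕ) × List ℕ => t.2.length).bddAbove
  refine ⟨B + 1, ?_⟩
  rintro ⟨v, ⟨l, d⟩, v'⟩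
  simp only [block]
  cases l with
  | none => simp
  | some a =>
    simp only
    split_ifs
    · simp
    · cases h : assoc c.2.2 (v - 2, a, v' - 2) with
      | none => simp
      | some α =>
        have := hB ⟨_, mem_of_assoc_eq_some h, rfl⟩
        simp only [Option.getD_some, List.length_map]
        exact Nat.le_succ_of_le this

theorem mem_of_mem_allSublists {l u : List ℕ} (h : u ∈ allSublists l) : ∀ v ∈ u, v ∈ l := by
  induction l generalizing u with
  | nil => simp [allSublists] at h; simp [h]
  | cons a l ih =>
    simp only [allSublists, List.foldr_cons, List.mem_append, List.mem_map] at h ih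
    intro v hv
    rcases h with h | ⟨t, ht, rfl⟩
    · exact List.mem_cons_of_mem _ (ih h v hv)
    · rcases List.mem_cons.1 hv with rfl | hv
      · exact List.mem_cons_self
      · exact List.mem_cons_of_mem _ (ih ht v hv)

theorem OneNTCode.autStep_mem (c : OneNTCode) (d : List ℕ × List ℕ × List ℕ) (l : Option ℕ) :
    c.graph.autStep d l ∈ allStates c.graph.nodes := by
  rw [mem_allStates]
  refine ⟨filter_mem_allSublists _ _, filter_mem_allSublists _ _, ?_⟩
  simp only [LayeredGraph.autStep, LayeredGraph.trackNext, LayeredGraph.multiNext]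
  split_ifs <;> exact filter_mem_allSublists _ _

/-- `CompState` is infinite because it serves all codes. For given codes, nodes and automaton states
come from finite lists, and both blocks and search lists have bounded length. The codes need not
describe actual transducers. -/
theorem exists_closed_compMach (cN : OneNTCode) (cT : TwoDTCode) {Γ : Set ℕ}
    (h : ∀ t ∈ cT.2.2, ∀ o ∈ t.2.2.2, o ∈ Γ) :
    ∃ K : Set (CompState × Bool), K.Finite ∧ (compMach (cN, cT)).toTwoDT.start ∈ K ∧
      ∀ s ∈ K, ∀ l r, (compMach (cN, cT)).toTwoDT.step s l = some r →
        r.1 ∈ K ∧ ∀ c ∈ r.2.2, c ∈ Γ := by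
  obtain ⟨K₀, h₀⟩ := TwoDT.closedOn_ofCode cT h
  obtain ⟨B, hB⟩ := cN.exists_block_le (X := List ℕ × List ℕ × List ℕ)
  obtain ⟨K₁, h₁⟩ := h₀.onBlocks hB
  set Kv : Set ℕ := {v | v ∈ cN.graph.ghost :: cN.graph.nodes} with hKv
  set Kx : Set (List ℕ × List ℕ × List ℕ) :=
    {d | d ∈ cN.graph.autStart :: allStates cN.graph.nodes} with hKx
  have hroot : cN.graph.root ∈ cN.graph.nodes := by simp [OneNTCode.graph]
  have hKxv : ∀ d ∈ Kx, ∀ v ∈ d.1, v ∈ Kv := by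
    intro d hd v hv
    rcases List.mem_cons.1 hd with rfl | hd
    · simp only [LayeredGraph.autStart, List.mem_singleton] at hv
      exact List.mem_cons_of_mem _ (hv ▸ hroot)
    · exact List.mem_cons_of_mem _ (mem_of_mem_allSublists (mem_allStates.1 hd).1 v hv)
  have hparent : ∀ l ∈ {l : Option ℕ × (List ℕ × List ℕ × List ℕ) | l.2 ∈ Kx}, ∀ v p,
      cN.graph.forestParent l v = some p → p ∈ Kv := by
    intro l hl v p hp
    simp only [LayeredGraph.forestParent] at hp
    split_ifs at hp
    · exact hKxv _ hl _ (List.mem_of_mem_head? hp)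
    · obtain rfl := Option.some.inj hp
      exact List.mem_cons_self
    · exact hKxv _ hl _ (LayeredGraph.mem_preds.1 (List.mem_of_mem_head? hp)).1
  have hfin : Kv.Finite := List.finite_toSet _
  have hfinx : Kx.Finite := List.finite_toSet _
  obtain ⟨K₂, h₂⟩ := h₁.alongPath hfin
    (show (0 : ℕ) ∈ Kv from List.mem_cons_of_mem _ hroot) hparent
  obtain ⟨K₃, h₃⟩ := h₂.resolve (G := cN.graph.forest) hfin
    (fun l _ => ⟨le_rfl, fun u hu => hu⟩) hparent
  obtain ⟨K₄, h₄⟩ := h₃.lookbehind (δ := cN.graph.autStep) (d₀ := cN.graph.autStart) hfinx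
    List.mem_cons_self (fun d l => List.mem_cons_of_mem _ (cN.autStep_mem d l))
  obtain ⟨K₅, h₅⟩ := h₄.resolve (G := autResolver cN.graph.autStep cN.candStates) hfinx
    (B := 1 + (allStates cN.graph.nodes).length)
    (fun l _ => by
      simp only [autResolver, OneNTCode.candStates]
      split_ifs
      · exact ⟨by simp, fun u hu => by rw [List.mem_singleton.1 hu]; exact List.mem_cons_self⟩
      · exact ⟨by omega, fun u hu => List.mem_cons_of_mem _ hu⟩)
    (fun l _ v p hp => by
      obtain rfl := Option.some.inj hp
      exact List.mem_cons_of_mem _ (cN.autStep_mem v l))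
  exact h₅.toTwoDT

/-! ### Computability of the machines -/

section Primrec

open Primrec

variable {α L S V C E X : Type*} [Primcodable α] [Primcodable L] [Primcodable S] [Primcodable V]
  [Primcodable C] [Primcodable E] [Primcodable X]

theorem primrec_assoc {β : Type*} [Primcodable β] [DecidableEq α] :
    Primrec₂ (assoc : List (α × β) → α → Option β) :=
  Primrec.listLookup.comp Primrec.snd Primrec.fst

/-- The step functions of a family of machines form a primitive recursive function. -/
def PrimrecStep (M : α → Mach L S C) : Prop :=
  Primrec fun z : α × S × L => (M z.1).step z.2.1 z.2.2

/-- The parameter `a : α` stands for the given codes. Each construction is shown to be primitive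
recursive in parameter, state and letter jointly, since effectiveness requires uniformity in the
codes. -/
theorem primrecStep_ofCode {f : α → TwoDTCode} (hf : Primrec f) :
    PrimrecStep fun a => (TwoDT.ofCode (f a)).toMach := by
  have h1 : Primrec fun z : α × ℕ × Option ℕ => assoc (f z.1).2.2 z.2 :=
    primrec_assoc.comp (snd.comp (snd.comp (hf.comp fst))) snd
  refine option_map h1 (Primrec₂.mk ?_)
  have h2 : Primrec fun p : (α × ℕ × Option ℕ) × (ℕ × Bool × List ℕ) => p.2 := snd
  exact (fst.comp h2).pair ((option_some.comp (fst.comp (snd.comp h2))).pair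
    (snd.comp (snd.comp h2)))

theorem PrimrecStep.onBlocks {M : α → Mach L S C} (hM : PrimrecStep M) {h : α → E → List L}
    (hh : Primrec fun z : α × E => h z.1 z.2) :
    PrimrecStep fun a => (M a).onBlocks (h a) := by
  have ha : Primrec fun z : α × (S × ℕ × Bool) × E => z.1 := fst
  have hs : Primrec fun z : α × (S × ℕ × Bool) × E => z.2.1.1 := fst.comp (fst.comp snd)
  have hk : Primrec fun z : α × (S × ℕ × Bool) × E => z.2.1.2.1 :=
    fst.comp (snd.comp (fst.comp snd))
  have hb : Primrec fun z : α × (S × ℕ × Bool) × E => z.2.1.2.2 :=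
    snd.comp (snd.comp (fst.comp snd))
  have he : Primrec fun z : α × (S × ℕ × Bool) × E => h z.1 z.2.2 :=
    hh.comp (fst.pair (snd.comp snd))
  have hl := list_length.comp he
  have hnil : Primrec fun _ : α × (S × ℕ × Bool) × E => ([] : List C) := const []
  have hget : Primrec fun z : α × (S × ℕ × Bool) × E => (h z.1 z.2.2)[z.2.1.2.1]? :=
    list_getElem?.comp he hk
  have hstep : Primrec fun p : (α × (S × ℕ × Bool) × E) × L => (M p.1.1).step p.1.2.1.1 p.2 :=
    hM.comp ((ha.comp fst).pair ((hs.comp fst).pair snd))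
  refine Primrec.ite (Primrec.eq.comp hb (const true))
    (Primrec.ite (Primrec.eq.comp hl (const 0)) ?_ ?_) ?_
  · exact option_some.comp ((hs.pair ((const 0).pair (const true))).pair
      ((const (some false)).pair hnil))
  · exact option_some.comp ((hs.pair ((nat_sub.comp hl (const 1)).pair (const false))).pair
      ((const none).pair hnil))
  · refine (option_casesOn hget (f := fun z => some ((z.2.1.1, 0, false), some true, []))
      (g := fun z l => ((M z.1).step z.2.1.1 l).map fun r =>
        if r.2.1 = some true then ((r.1, z.2.1.2.1 + 1, false), none, r.2.2)
        else if r.2.1 = none then ((r.1, z.2.1.2.1, false), none, r.2.2)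
        else if z.2.1.2.1 = 0 then ((r.1, 0, true), some false, r.2.2)
        else ((r.1, z.2.1.2.1 - 1, false), none, r.2.2)) ?_ ?_).of_eq fun z => by
          cases (h z.1 z.2.2)[z.2.1.2.1]? <;> rfl
    · exact option_some.comp ((hs.pair ((const 0).pair (const false))).pair
        ((const (some true)).pair hnil))
    · refine Primrec₂.mk (option_map hstep (Primrec₂.mk ?_))
      have hr : Primrec fun p : ((α × (S × ℕ × Bool) × E) × L) × (S × Option Bool × List C) =>
        p.2.1 := fst.comp snd
      have hd : Primrec fun p : ((α × (S × ℕ × Bool) × E) × L) × (S × Option Bool × List C) =>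
        p.2.2.1 := fst.comp (snd.comp snd)
      have ho : Primrec fun p : ((α × (S × ℕ × Bool) × E) × L) × (S × Option Bool × List C) =>
        p.2.2.2 := snd.comp (snd.comp snd)
      have hk' : Primrec fun p : ((α × (S × ℕ × Bool) × E) × L) × (S × Option Bool × List C) =>
        p.1.1.2.1.2.1 := hk.comp (fst.comp fst)
      exact Primrec.ite (Primrec.eq.comp hd (const (some true)))
        ((hr.pair ((succ.comp hk').pair (const false))).pair ((const none).pair ho))
        (Primrec.ite (Primrec.eq.comp hd (const none))
          ((hr.pair (hk'.pair (const false))).pair ((const none).pair ho))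
          (Primrec.ite (Primrec.eq.comp hk' (const 0))
            ((hr.pair ((const 0).pair (const true))).pair ((const (some false)).pair ho))
            ((hr.pair ((nat_sub.comp hk' (const 1)).pair (const false))).pair
              ((const none).pair ho))))

/-- The functions of a family of machines with queries are primitive recursive. -/
structure PrimrecQuery (M : α → QMach L S V C) : Prop where
  step : PrimrecStep fun a => (M a).toMach
  query : Primrec fun z : α × S × L => (M z.1).query z.2.1 z.2.2
  resume : Primrec fun z : α × S × V => (M z.1).resume z.2.1 z.2.2

theorem PrimrecStep.alongPath {M : α → Mach (V × L × V) S C} (hM : PrimrecStep M)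
    {parent : α → L → V → Option V} (hp : Primrec fun z : α × L × V => parent z.1 z.2.1 z.2.2)
    (root : V) : PrimrecQuery fun a => (M a).alongPath (parent a) root := by
  have hm : Primrec fun z : α × (ℕ × S × V × V) × L => z.2.1.1 := fst.comp (fst.comp snd)
  have hs : Primrec fun z : α × (ℕ × S × V × V) × L => z.2.1.2.1 :=
    fst.comp (snd.comp (fst.comp snd))
  have hv : Primrec fun z : α × (ℕ × S × V × V) × L => z.2.1.2.2.1 :=
    fst.comp (snd.comp (snd.comp (fst.comp snd)))
  have ht : Primrec fun z : α × (ℕ × S × V × V) × L => z.2.1.2.2.2 :=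
    snd.comp (snd.comp (snd.comp (fst.comp snd)))
  have hl : Primrec fun z : α × (ℕ × S × V × V) × L => z.2.2 := snd.comp snd
  refine ⟨?_, ?_, ?_⟩
  · refine Primrec.ite (Primrec.eq.comp hm (const 1)) ?_ ?_
    · refine option_map (hM.comp (fst.pair (hs.pair (hv.pair (hl.pair ht))))) (Primrec₂.mk ?_)
      have hr : Primrec fun p : (α × (ℕ × S × V × V) × L) × (S × Option Bool × List C) =>
        p.2.1 := fst.comp snd
      have hd : Primrec fun p : (α × (ℕ × S × V × V) × L) × (S × Option Bool × List C) =>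
        p.2.2.1 := fst.comp (snd.comp snd)
      have hv' := hv.comp (fst : Primrec fun p : (α × (ℕ × S × V × V) × L) ×
        (S × Option Bool × List C) => p.1)
      have ht' := ht.comp (fst : Primrec fun p : (α × (ℕ × S × V × V) × L) ×
        (S × Option Bool × List C) => p.1)
      exact ((Primrec.ite (Primrec.eq.comp hd (const (some false))) (const 2) (const 0)).pair
        (hr.pair (Primrec.ite (Primrec.eq.comp hd (const (some true))) (ht'.pair ht')
          (hv'.pair hv')))).pair (snd.comp snd)
    · refine option_map (hp.comp (fst.pair (hl.pair hv))) (Primrec₂.mk ?_)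
      have hv' : Primrec fun p : (α × (ℕ × S × V × V) × L) × V => p.2 := snd
      exact ((const 0).pair ((hs.comp fst).pair (hv'.pair hv'))).pair
        ((const none).pair (const []))
  · exact Primrec.ite (Primrec.eq.comp hm (const 0)) (option_some.comp hv) (const none)
  · exact (const 1).pair ((fst.comp (snd.comp (fst.comp snd))).pair
      ((fst.comp (snd.comp (snd.comp (fst.comp snd)))).pair (snd.comp snd)))

theorem PrimrecStep.lookbehind {M : α → Mach (L × X) S C} (hM : PrimrecStep M)
    {δ : α → X → L → X} (hδ : Primrec fun z : α × X × L => δ z.1 z.2.1 z.2.2) (d₀ : α → X) :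
    PrimrecQuery fun a => (M a).lookbehind (δ a) (d₀ a) := by
  have hb : Primrec fun z : α × (Bool × S × X) × L => z.2.1.1 := fst.comp (fst.comp snd)
  have hs : Primrec fun z : α × (Bool × S × X) × L => z.2.1.2.1 :=
    fst.comp (snd.comp (fst.comp snd))
  have hx : Primrec fun z : α × (Bool × S × X) × L => z.2.1.2.2 :=
    snd.comp (snd.comp (fst.comp snd))
  have hl : Primrec fun z : α × (Bool × S × X) × L => z.2.2 := snd.comp snd
  refine ⟨?_, ?_, ?_⟩
  · refine option_map (hM.comp (fst.pair (hs.pair (hl.pair hx)))) (Primrec₂.mk ?_)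
    have hr : Primrec fun p : (α × (Bool × S × X) × L) × (S × Option Bool × List C) =>
      p.2.1 := fst.comp snd
    have hd : Primrec fun p : (α × (Bool × S × X) × L) × (S × Option Bool × List C) =>
      p.2.2.1 := fst.comp (snd.comp snd)
    have hq : Primrec fun p : (α × (Bool × S × X) × L) × (S × Option Bool × List C) =>
      p.2.2.1 == some false := (Primrec.dom_finite fun o : Option Bool => o == some false).comp hd
    exact (hq.pair (hr.pair
      (Primrec.ite (Primrec.eq.comp hd (const (some true)))
        (hδ.comp ((fst.comp fst).pair ((hx.comp fst).pair (hl.comp fst)))) (hx.comp fst)))).pair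
      (snd.comp snd)
  · exact Primrec.ite (Primrec.eq.comp hb (const true)) (option_some.comp hx) (const none)
  · exact (const false).pair ((fst.comp (snd.comp (fst.comp snd))).pair (snd.comp snd))

/-- The functions of a family of resolvers are primitive recursive. -/
structure PrimrecResolver (G : α → Resolver L V) (dir : Bool) : Prop where
  cand : Primrec fun z : α × L => (G z.1).cand z.2
  parent : Primrec fun z : α × L × V => (G z.1).parent z.2.1 z.2.2
  dir_eq : ∀ a, (G a).dir = dir

variable [DecidableEq V]

theorem primrecPred_uniform : PrimrecPred fun φ : List (V × V) => Uniform φ := by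
  have hR : PrimrecRel fun (z : V × V) (o : Option V) => o = some z.2 :=
    Primrec.eq.comp snd (option_some.comp (snd.comp fst))
  exact (hR.forall_mem_list.comp .id (option_map list_head? (Primrec₂.mk (snd.comp snd)))).of_eq
    fun φ => Iff.rfl

theorem PrimrecResolver.init {G : α → Resolver L V} {dir : Bool} (hG : PrimrecResolver G dir) :
    Primrec fun z : α × L × V => (G z.1).init z.2.1 z.2.2 := by
  have hc : Primrec fun z : α × L × V => (G z.1).cand z.2.1 :=
    hG.cand.comp (fst.pair (fst.comp snd))
  refine listFilterMap hc (Primrec₂.mk ?_)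
  have hp : Primrec fun p : (α × L × V) × V => (G p.1.1).parent p.1.2.1 p.2 :=
    hG.parent.comp ((fst.comp fst).pair ((fst.comp (snd.comp fst)).pair snd))
  exact Primrec.ite (Primrec.eq.comp hp (option_some.comp (snd.comp (snd.comp fst))))
    (option_some.comp (snd.pair snd)) (const none)

theorem PrimrecResolver.next {G : α → Resolver L V} {dir : Bool} (hG : PrimrecResolver G dir) :
    Primrec fun z : α × L × List (V × V) => (G z.1).next z.2.1 z.2.2 := by
  have hc : Primrec fun z : α × L × List (V × V) => (G z.1).cand z.2.1 :=
    hG.cand.comp (fst.pair (fst.comp snd))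
  refine listFilterMap hc (Primrec₂.mk ?_)
  have hp : Primrec fun p : (α × L × List (V × V)) × V => (G p.1.1).parent p.1.2.1 p.2 :=
    hG.parent.comp ((fst.comp fst).pair ((fst.comp (snd.comp fst)).pair snd))
  refine option_map (option_bind hp (Primrec₂.mk ?_)) (Primrec₂.mk ((snd.comp fst).pair snd))
  exact Primrec.listLookup.comp snd (snd.comp (snd.comp (fst.comp fst)))

theorem PrimrecResolver.back {G : α → Resolver L V} {dir : Bool} (hG : PrimrecResolver G dir) :
    Primrec fun z : α × L × List (V × V) => (G z.1).back z.2.1 z.2.2 := by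
  refine listFilterMap (snd.comp snd) (Primrec₂.mk ?_)
  have hp : Primrec fun p : (α × L × List (V × V)) × (V × V) =>
      (G p.1.1).parent p.1.2.1 p.2.2 :=
    hG.parent.comp ((fst.comp fst).pair ((fst.comp (snd.comp fst)).pair (snd.comp snd)))
  exact option_map hp (Primrec₂.mk ((fst.comp (snd.comp fst)).pair snd))

theorem PrimrecQuery.resolve {M : α → QMach L S V C} (hM : PrimrecQuery M)
    {G : α → Resolver L V} {dir : Bool} (hG : PrimrecResolver G dir) :
    PrimrecStep fun a => (M a).resolve (G a) := by
  have hs : Primrec fun z : α × (S × ℕ × List (V × V)) × L => z.2.1.1 := fst.comp (fst.comp snd)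
  have hm : Primrec fun z : α × (S × ℕ × List (V × V)) × L => z.2.1.2.1 :=
    fst.comp (snd.comp (fst.comp snd))
  have hφ : Primrec fun z : α × (S × ℕ × List (V × V)) × L => z.2.1.2.2 :=
    snd.comp (snd.comp (fst.comp snd))
  have hl : Primrec fun z : α × (S × ℕ × List (V × V)) × L => z.2.2 := snd.comp snd
  have hnext : Primrec fun z : α × (S × ℕ × List (V × V)) × L =>
    (G z.1).next z.2.2 z.2.1.2.2 := hG.next.comp (fst.pair (hl.pair hφ))
  have hback : Primrec fun z : α × (S × ℕ × List (V × V)) × L =>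
    (G z.1).back z.2.2 z.2.1.2.2 := hG.back.comp (fst.pair (hl.pair hφ))
  have hdir : Primrec fun z : α × (S × ℕ × List (V × V)) × L => (G z.1).dir :=
    (const dir).of_eq fun z => (hG.dir_eq z.1).symm
  have hnil : Primrec fun _ : α × (S × ℕ × List (V × V)) × L => ([] : List C) := const []
  refine Primrec.ite (Primrec.eq.comp hm (const 0)) ?_
    (Primrec.ite (Primrec.eq.comp hm (const 1))
      (Primrec.ite (primrecPred_uniform.comp hnext) ?_ ?_)
      (Primrec.ite (primrecPred_uniform.comp hback) ?_ ?_))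
  · refine (option_casesOn (o := fun z : α × (S × ℕ × List (V × V)) × L =>
        (M z.1).query z.2.1.1 z.2.2)
      (f := fun z => ((M z.1).step z.2.1.1 z.2.2).map fun r => ((r.1, 0, []), r.2))
      (g := fun z v => if Uniform ((G z.1).init z.2.2 v) then
        ((G z.1).init z.2.2 v).head?.map fun t =>
          (((M z.1).resume z.2.1.1 t.2, 0, []), none, [])
        else some ((z.2.1.1, 1, (G z.1).init z.2.2 v), some (G z.1).dir, []))
      (hM.query.comp (fst.pair (hs.pair hl))) ?_ ?_).of_eq fun z => by
        cases hq : (M z.1).query z.2.1.1 z.2.2 <;> rfl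
    · exact option_map (hM.step.comp (fst.pair (hs.pair hl)))
        (Primrec₂.mk (((fst.comp snd).pair ((const 0).pair (const []))).pair (snd.comp snd)))
    · have hinit : Primrec fun p : (α × (S × ℕ × List (V × V)) × L) × V =>
        (G p.1.1).init p.1.2.2 p.2 :=
        hG.init.comp ((fst.comp fst).pair ((hl.comp fst).pair snd))
      refine Primrec₂.mk (Primrec.ite (primrecPred_uniform.comp hinit)
        (option_map (list_head?.comp hinit) (Primrec₂.mk ?_)) ?_)
      · exact ((hM.resume.comp ((fst.comp (fst.comp fst)).pair ((hs.comp (fst.comp fst)).pair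
          (snd.comp snd)))).pair ((const 0).pair (const []))).pair ((const none).pair (const []))
      · exact option_some.comp (((hs.comp fst).pair ((const 1).pair hinit)).pair
          ((option_some.comp (hdir.comp fst)).pair (const [])))
  · refine option_map (list_head?.comp hnext) (Primrec₂.mk ?_)
    refine Primrec.pair ((hs.comp fst).pair ((const 2).pair ?_))
      ((option_some.comp (Primrec.not.comp (hdir.comp fst))).pair (const []))
    exact list_map (hφ.comp fst) (Primrec₂.mk ((snd.comp (snd.comp fst)).pair (fst.comp snd)))
  · exact option_some.comp ((hs.pair ((const 1).pair hnext)).pair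
      ((option_some.comp hdir).pair hnil))
  · refine option_map (list_head?.comp hback) (Primrec₂.mk ?_)
    exact ((hM.resume.comp ((fst.comp fst).pair ((hs.comp fst).pair (fst.comp snd)))).pair
      ((const 0).pair (const []))).pair ((const none).pair (const []))
  · exact option_some.comp ((hs.pair ((const 2).pair hback)).pair
      ((option_some.comp (Primrec.not.comp hdir)).pair hnil))

theorem PrimrecStep.toTwoDT {A : Type*} [Primcodable A] {M : α → Mach (Option A) S C}
    (hM : PrimrecStep M) :
    Primrec fun z : α × (S × Bool) × Option A => (M z.1).toTwoDT.step z.2.1 z.2.2 := by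
  have hs : Primrec fun z : α × (S × Bool) × Option A => z.2.1.1 := fst.comp (fst.comp snd)
  refine Primrec.ite (Primrec.eq.comp (snd.comp (fst.comp snd)) (const true))
    (option_some.comp ((hs.pair (const false)).pair ((const false).pair (const []))))
    (option_map (hM.comp (fst.pair (hs.pair (snd.comp snd)))) (Primrec₂.mk ?_))
  have hd : Primrec fun p : (α × (S × Bool) × Option A) × (S × Option Bool × List C) =>
    p.2.2.1 := fst.comp (snd.comp snd)
  refine ((fst.comp snd).pair ?_).pair ((option_getD.comp hd (const true)).pair
    (snd.comp (snd.comp snd)))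
  exact (Primrec.not.comp (option_isSome.comp hd)).of_eq fun p => by
    cases p.2.2.1 <;> rfl

end Primrec

/-! ### Primitive recursiveness of the graph, its forest and the composed machine. -/

section Primrec

open Primrec

variable {α β L V : Type*} [Primcodable α] [Primcodable β] [Primcodable L] [Primcodable V]

theorem primrec_filter {f : α → List β} {p : α × β → Bool} (hf : Primrec f) (hp : Primrec p) :
    Primrec fun a => (f a).filter fun b => p (a, b) := by
  refine (listFilterMap hf (g := fun a b => if p (a, b) = true then some b else none)
    (Primrec₂.mk ?_)).of_eq fun a => ?_
  · exact Primrec.ite (Primrec.eq.comp hp (const true)) (option_some.comp snd) (const none)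
  · rw [← List.filterMap_eq_filter]
    rfl

/-- The functions of a family of layered graphs are primitive recursive. -/
structure PrimrecGraph (H : α → LayeredGraph L V) : Prop where
  edge : Primrec fun z : α × L × V × V => (H z.1).edge z.2.1 z.2.2.1 z.2.2.2
  nodes : Primrec fun a => (H a).nodes
  ghost : Primrec fun a => (H a).ghost

variable [DecidableEq V]

theorem primrec_mem {f : α → V} {l : α → List V} (hf : Primrec f) (hl : Primrec l) :
    PrimrecPred fun a => f a ∈ l a := by
  have hR : PrimrecRel fun u v : V => u = v := Primrec.eq
  exact (hR.exists_mem_list.comp hl hf).of_eq fun z => by simp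

variable {H : α → LayeredGraph L V}

theorem PrimrecGraph.preds (hH : PrimrecGraph H) :
    Primrec fun z : α × L × List V × V => (H z.1).preds z.2.1 z.2.2.1 z.2.2.2 :=
  primrec_filter (p := fun y : (α × L × List V × V) × V => (H y.1.1).edge y.1.2.1 y.2 y.1.2.2.2)
    (fst.comp (snd.comp snd)) (hH.edge.comp ((fst.comp fst).pair ((fst.comp (snd.comp fst)).pair
      (snd.pair (snd.comp (snd.comp (snd.comp fst)))))))

theorem PrimrecGraph.autStep (hH : PrimrecGraph H) :
    Primrec fun z : α × (List V × List V × List V) × L => (H z.1).autStep z.2.1 z.2.2 := by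
  have hn : Primrec fun z : α × (List V × List V × List V) × L => (H z.1).nodes :=
    hH.nodes.comp fst
  have hlen : ∀ {s : (α × (List V × List V × List V) × L) × V → List V}, Primrec s →
      Primrec fun y : (α × (List V × List V × List V) × L) × V =>
        ((H y.1.1).preds y.1.2.2 (s y) y.2).length := fun hs =>
    list_length.comp (hH.preds.comp ((fst.comp fst).pair ((snd.comp (snd.comp fst)).pair
      (hs.pair snd))))
  have h1 := hlen (fst.comp (fst.comp (snd.comp fst)))
  have h2 := hlen (fst.comp (snd.comp (fst.comp (snd.comp fst))))
  have h3 := hlen (snd.comp (snd.comp (fst.comp (snd.comp fst))))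
  have hmulti := primrec_filter hn
    (PrimrecPred.or (nat_le.comp (const 2) h1)
      (PrimrecPred.not (Primrec.eq.comp h2 (const 0)))).decide
  refine Primrec.pair ?_ (Primrec.pair hmulti ?_)
  · exact primrec_filter hn
      (PrimrecPred.and (Primrec.eq.comp h1 (const 1)) (Primrec.eq.comp h2 (const 0))).decide
  · exact Primrec.ite (Primrec.eq.comp (list_length.comp (snd.comp (snd.comp (fst.comp snd))))
      (const 0)) hmulti
      (primrec_filter hn (PrimrecPred.not (Primrec.eq.comp h3 (const 0))).decide)

theorem PrimrecGraph.forestParent (hH : PrimrecGraph H) :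
    Primrec fun z : α × (L × (List V × List V × List V)) × V =>
      (H z.1).forestParent z.2.1 z.2.2 := by
  have hl : Primrec fun z : α × (L × (List V × List V × List V)) × V => z.2.1.1 :=
    fst.comp (fst.comp snd)
  have hd : Primrec fun z : α × (L × (List V × List V × List V)) × V => z.2.1.2 :=
    snd.comp (fst.comp snd)
  have hg : Primrec fun z : α × (L × (List V × List V × List V)) × V => (H z.1).ghost :=
    hH.ghost.comp fst
  have hv : Primrec fun z : α × (L × (List V × List V × List V)) × V => z.2.2 := snd.comp snd
  have hs := hH.autStep.comp (fst.pair (hd.pair hl))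
  refine Primrec.ite (Primrec.eq.comp hv hg) (Primrec.ite
    (Primrec.eq.comp (list_length.comp (snd.comp (snd.comp hs))) (const 0)) (const none)
    (Primrec.ite (Primrec.eq.comp (list_length.comp (snd.comp (snd.comp hd))) (const 0))
      (list_head?.comp (fst.comp hd)) (option_some.comp hg)))
    (Primrec.ite (primrec_mem hv (fst.comp hs)) ?_ (const none))
  exact list_head?.comp (hH.preds.comp (fst.pair (hl.pair ((fst.comp hd).pair hv))))

theorem PrimrecGraph.forest (hH : PrimrecGraph H) :
    PrimrecResolver (fun a => (H a).forest) true where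
  cand := list_cons.comp (hH.ghost.comp fst) (hH.nodes.comp fst)
  parent := hH.forestParent
  dir_eq _ := rfl

theorem primrecGraph_graph {f : α → OneNTCode} (hf : Primrec f) :
    PrimrecGraph fun a => (f a).graph where
  edge := by
    have hv : Primrec fun z : α × Option ℕ × ℕ × ℕ => z.2.2.1 := fst.comp (snd.comp snd)
    have hv' : Primrec fun z : α × Option ℕ × ℕ × ℕ => z.2.2.2 := snd.comp (snd.comp snd)
    have hc : Primrec fun z : α × Option ℕ × ℕ × ℕ => f z.1 := hf.comp fst
    refine (option_casesOn (o := fun z : α × Option ℕ × ℕ × ℕ => z.2.1)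
      (f := fun z => decide (z.2.2.1 = 0 ∧ 2 ≤ z.2.2.2 ∧ z.2.2.2 - 2 ∈ (f z.1).2.1))
      (g := fun z a => decide (2 ≤ z.2.2.1 ∧ 2 ≤ z.2.2.2 ∧
        (assoc (f z.1).2.2 (z.2.2.1 - 2, a, z.2.2.2 - 2)).isSome)) (fst.comp snd) ?_ ?_).of_eq ?_
    · exact (PrimrecPred.and (Primrec.eq.comp hv (const 0)) (PrimrecPred.and
        (nat_le.comp (const 2) hv')
        (primrec_mem (nat_sub.comp hv' (const 2)) (fst.comp (snd.comp hc))))).decide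
    · refine Primrec₂.mk (PrimrecPred.and (nat_le.comp (const 2) (hv.comp fst)) (PrimrecPred.and
        (nat_le.comp (const 2) (hv'.comp fst)) (Primrec.eq.comp (option_isSome.comp ?_)
          (const true)))).decide
      exact primrec_assoc.comp (snd.comp (snd.comp (hc.comp fst)))
        ((nat_sub.comp (hv.comp fst) (const 2)).pair (snd.pair
          (nat_sub.comp (hv'.comp fst) (const 2))))
    · rintro ⟨a, _ | l, v, v'⟩ <;> rfl
  nodes := list_cons.comp (const 0) (list_map (list_range.comp (snd.comp (snd.comp
    (fst.comp hf)))) (Primrec₂.mk (nat_add.comp snd (const 2))))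
  ghost := const 1

theorem primrec_block {X : Type*} [Primcodable X] {f : α → OneNTCode} (hf : Primrec f) :
    Primrec fun z : α × (ℕ × (Option ℕ × X) × ℕ) => (f z.1).block z.2 := by
  have hv : Primrec fun z : α × (ℕ × (Option ℕ × X) × ℕ) => z.2.1 := fst.comp snd
  have hv' : Primrec fun z : α × (ℕ × (Option ℕ × X) × ℕ) => z.2.2.2 := snd.comp (snd.comp snd)
  refine (option_casesOn (o := fun z : α × (ℕ × (Option ℕ × X) × ℕ) => z.2.2.1.1)
    (f := fun _ => [none]) (g := fun z a => if z.2.2.2 = 1 then [] else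
      ((assoc (f z.1).2.2 (z.2.1 - 2, a, z.2.2.2 - 2)).getD []).map some)
    (fst.comp (fst.comp (snd.comp snd))) (const _) ?_).of_eq ?_
  · refine Primrec₂.mk (Primrec.ite (Primrec.eq.comp (hv'.comp fst) (const 1)) (const [])
      (list_map (option_getD.comp ?_ (const [])) (Primrec₂.mk (option_some.comp snd))))
    exact primrec_assoc.comp (snd.comp (snd.comp (hf.comp (fst.comp fst))))
      ((nat_sub.comp (hv.comp fst) (const 2)).pair (snd.pair
        (nat_sub.comp (hv'.comp fst) (const 2))))
  · rintro ⟨a, v, ⟨_ | l, d⟩, v'⟩ <;> rfl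

theorem primrec_allSublists : Primrec allSublists := by
  refine list_foldr (Primrec.id : Primrec fun l : List ℕ => l) (const [[]])
    (h := fun _ z => z.2 ++ z.2.map (List.cons z.1)) (Primrec₂.mk ?_)
  have hs : Primrec fun z : List ℕ × ℕ × List (List ℕ) => z.2.2 := snd.comp snd
  have hm : Primrec fun z : List ℕ × ℕ × List (List ℕ) => z.2.2.map (List.cons z.2.1) :=
    list_map hs (Primrec₂.mk (list_cons.comp (fst.comp (snd.comp fst))
      (snd : Primrec fun p : (List ℕ × ℕ × List (List ℕ)) × List ℕ => p.2)))
  exact list_append.comp hs hm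

theorem primrec_allStates : Primrec allStates := by
  refine list_flatMap primrec_allSublists (Primrec₂.mk (list_flatMap
    (primrec_allSublists.comp fst) (Primrec₂.mk (list_map
      (primrec_allSublists.comp (fst.comp fst)) (Primrec₂.mk ?_)))))
  exact (snd.comp (fst.comp fst)).pair ((snd.comp fst).pair snd)

theorem primrecResolver_aut {f : α → OneNTCode} (hf : Primrec f) :
    PrimrecResolver (fun a => autResolver (f a).graph.autStep (f a).candStates) false where
  cand := Primrec.ite (Primrec.eq.comp snd (const none))
    -- `([0], [], [])` is `autStart`, as the root is `0` for every code.
    (const [([0], [], [])]) (primrec_allStates.comp ((primrecGraph_graph hf).nodes.comp fst))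
  parent := option_some.comp ((primrecGraph_graph hf).autStep.comp
    (fst.pair ((snd.comp snd).pair (fst.comp snd))))
  dir_eq _ := rfl

theorem primrecStep_transitionMach :
    PrimrecStep fun c : OneNTCode × TwoDTCode => transitionMach c :=
  (primrecStep_ofCode snd).onBlocks (primrec_block fst)

theorem primrecStep_pathMach : PrimrecStep fun c : OneNTCode × TwoDTCode => pathMach c := by
  have hg := primrecGraph_graph (fst : Primrec fun c : OneNTCode × TwoDTCode => c.1)
  have h : PrimrecQuery fun c : OneNTCode × TwoDTCode =>
      (transitionMach c).alongPath c.1.graph.forestParent 0 :=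
    primrecStep_transitionMach.alongPath
      (parent := fun c : OneNTCode × TwoDTCode => c.1.graph.forestParent) hg.forestParent 0
  exact h.resolve hg.forest

theorem primrecStep_compMach : PrimrecStep fun c : OneNTCode × TwoDTCode => compMach c := by
  have hg := primrecGraph_graph (fst : Primrec fun c : OneNTCode × TwoDTCode => c.1)
  have h : PrimrecQuery fun c : OneNTCode × TwoDTCode =>
      (pathMach c).lookbehind c.1.graph.autStep c.1.graph.autStart :=
    primrecStep_pathMach.lookbehind
      (δ := fun c : OneNTCode × TwoDTCode => c.1.graph.autStep) hg.autStep _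
  exact h.resolve (primrecResolver_aut fst)

set_option synthInstance.maxHeartbeats 400000 in
set_option synthInstance.maxSize 1000 in
theorem primrec_compMach_step : Primrec fun z : (OneNTCode × TwoDTCode) × (CompState × Bool) ×
    Option ℕ => (compMach z.1).toTwoDT.step z.2.1 z.2.2 :=
  primrecStep_compMach.toTwoDT

theorem primrec_compMach_start :
    Primrec fun c : OneNTCode × TwoDTCode => (compMach c).toTwoDT.start := by
  have h : Primrec fun c : OneNTCode × TwoDTCode => c.2.2.1 := fst.comp (snd.comp snd)
  exact (((const false).pair ((((const 0).pair ((h.pair (const (0, false))).pair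
    (const (0, 0)))).pair (const (0, []))).pair (const ([0], [], [])))).pair
    (const (0, []))).pair (const false)

end Primrec

/-! ### Numbering the states of a transducer -/

/-- The letters of the tape over the alphabet of the numbers below `a`. -/
def tapeLetters (a : ℕ) : List (Option ℕ) := none :: (List.range a).map some

theorem map_val_mem_tapeLetters {a : ℕ} (s : Option (Fin a)) :
    s.map Fin.val ∈ tapeLetters a := by
  cases s <;> simp [tapeLetters]

theorem exists_of_mem_tapeLetters {a : ℕ} {s' : Option ℕ} (h : s' ∈ tapeLetters a) :
    ∃ s : Option (Fin a), s' = s.map Fin.val := by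
  simp only [tapeLetters, List.mem_cons, List.mem_map, List.mem_range] at h
  obtain rfl | ⟨i, hi, rfl⟩ := h
  · exact ⟨none, rfl⟩
  · exact ⟨some ⟨i, hi⟩, rfl⟩

namespace TwoDT

variable {S : Type*} [DecidableEq S]

/-- The successors of the states in `l` on the given letters. -/
def successors (T : TwoDT ℕ ℕ S) (a : ℕ) (l : List S) : List S :=
  l.flatMap fun q => (tapeLetters a).filterMap fun s => (T.step q s).map fun r => r.1

def IsClosedList (T : TwoDT ℕ ℕ S) (a : ℕ) (l : List S) : Prop :=
  T.start ∈ l ∧ ∀ q ∈ T.successors a l, q ∈ l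

instance (T : TwoDT ℕ ℕ S) (a : ℕ) (l : List S) : Decidable (T.IsClosedList a l) :=
  inferInstanceAs (Decidable (_ ∧ _))

/-- The description of a transducer whose states are listed in `l`, outputs being restricted to the
numbers below `b`. -/
def codeOfList (T : TwoDT ℕ ℕ S) (a b : ℕ) (l : List S) : TwoDTCode :=
  ((a, b, l.length), l.idxOf T.start, (List.range l.length).flatMap fun q =>
    (tapeLetters a).filterMap fun s => (l[q]?.bind fun t => T.step t s).map fun r =>
      ((q, s), l.idxOf r.1, r.2.1, r.2.2.filter (· < b)))

theorem IsClosedList.step_mem {T : TwoDT ℕ ℕ S} {a : ℕ} {l : List S} (h : T.IsClosedList a l)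
    {q : S} (hq : q ∈ l) (s : Option (Fin a)) {r : S × Bool × List ℕ}
    (hr : T.step q (s.map Fin.val) = some r) : r.1 ∈ l := by
  refine h.2 _ (List.mem_flatMap.2 ⟨q, hq, List.mem_filterMap.2
    ⟨_, map_val_mem_tapeLetters s, ?_⟩⟩)
  rw [hr]
  rfl

theorem exists_isClosedList {T : TwoDT ℕ ℕ S} (a : ℕ) {K : Set S} (hK : K.Finite)
    (hstart : T.start ∈ K) (hstep : ∀ q ∈ K, ∀ s r, T.step q s = some r → r.1 ∈ K) :
    ∃ l, T.IsClosedList a l := by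
  refine ⟨hK.toFinset.toList, by simpa, fun q hq => ?_⟩
  simp only [successors, List.mem_flatMap, List.mem_filterMap, Option.map_eq_some_iff,
    Finset.mem_toList, Set.Finite.mem_toFinset] at hq ⊢
  obtain ⟨p, hp, s, -, r, hr, rfl⟩ := hq
  exact hstep p hp s r hr

/-- The list `l` is only known to be closed under steps and may contain unreachable states with
outputs outside the alphabet. Filtering makes all transitions legal, and it changes nothing on `K`,
where the run stays. -/
theorem IsClosedList.exists_isCode {T : TwoDT ℕ ℕ S} {a : ℕ} {l : List S}
    (h : T.IsClosedList a l) (b : ℕ) {K : Set S} (hstart : T.start ∈ K)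
    (hstep : ∀ q ∈ K, ∀ s r, T.step q s = some r → r.1 ∈ K ∧ ∀ o ∈ r.2.2, o < b) :
    ∃ T' : TwoDT (Fin a) (Fin b) (Fin l.length), T'.IsCode (T.codeOfList a b l) ∧
      ∀ (x : ℕ → Fin a) (y' : ℕ → ℕ), T.Rel (fun i => (x i).val) y' ↔
        ∃ y, T'.Rel x y ∧ y' = fun i => (y i).val := by
  have hlift : ∀ (q : Fin l.length) (s : Option (Fin a)),
      ∃ o : Option (Fin l.length × Bool × List (Fin b)),
        o.map (fun r => (r.1.val, r.2.1, r.2.2.map Fin.val)) =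
          (T.step l[q] (s.map Fin.val)).map fun r =>
            (l.idxOf r.1, r.2.1, r.2.2.filter (· < b)) := by
    intro q s
    cases hr : T.step l[q] (s.map Fin.val) with
    | none => exact ⟨none, rfl⟩
    | some r =>
      have hlt := List.idxOf_lt_length_of_mem (h.step_mem (List.getElem_mem _) s hr)
      obtain ⟨w, hw⟩ : ∃ w : List (Fin b), w.map Fin.val = r.2.2.filter (· < b) := by
        have : ∀ o ∈ r.2.2.filter (· < b), o < b := fun o ho => by
          simpa using (List.mem_filter.1 ho).2
        exact ⟨List.pmap Fin.mk _ this, by simp [List.map_pmap]⟩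
      exact ⟨some (⟨_, hlt⟩, r.2.1, w), by simp [hw]⟩
  choose step hs using hlift
  refine ⟨⟨⟨_, List.idxOf_lt_length_of_mem h.1⟩, step⟩, ⟨rfl, rfl, fun t => ?_⟩, ?_⟩
  · simp only [codeOfList, List.mem_flatMap, List.mem_range, List.mem_filterMap,
      Option.map_eq_some_iff]
    constructor
    · rintro ⟨q, hq, s', hs', r, hr, rfl⟩
      obtain ⟨s, rfl⟩ := exists_of_mem_tapeLetters hs'
      rw [List.getElem?_eq_getElem hq, Option.bind_some] at hr
      have := hs ⟨q, hq⟩ s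
      simp only [Fin.getElem_fin, hr, Option.map_some, Option.map_eq_some_iff] at this
      obtain ⟨⟨q', d, w⟩, h1, h2⟩ := this
      exact ⟨⟨q, hq⟩, s, q', d, w, h1, by rw [← h2]⟩
    · rintro ⟨q, s, q', d, w, h1, rfl⟩
      have := hs q s
      rw [h1, Option.map_some, eq_comm, Option.map_eq_some_iff] at this
      obtain ⟨r, hr, h2⟩ := this
      refine ⟨q, q.isLt, _, map_val_mem_tapeLetters s, r, ?_, by rw [h2]⟩
      rw [List.getElem?_eq_getElem q.isLt, Option.bind_some]
      exact hr
  · intro x y'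
    have hget : ∀ t ∈ l, l[l.idxOf t]? = some t := fun t ht => List.getElem?_idxOf ht
    have hmap : ∀ q : Fin l.length, l[q] ∈ K → ∀ s : Option (Fin a),
        T.step l[q] (s.map Fin.val) =
          (step q s).map fun r => (l[r.1], r.2.1, r.2.2.map Fin.val) := by
      intro q hq s
      have h1 := hs q s
      cases hr : T.step l[q] (s.map Fin.val) with
      | none =>
        rw [hr, Option.map_none, Option.map_eq_none_iff] at h1
        rw [h1, Option.map_none]
      | some r =>
        rw [hr, Option.map_some, Option.map_eq_some_iff] at h1
        obtain ⟨⟨q', d, w⟩, h1, h2⟩ := h1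
        simp only [Prod.mk.injEq] at h2
        obtain ⟨h2, h3, h4⟩ := h2
        rw [h1, Option.map_some, Option.some.injEq]
        refine Prod.ext ?_ (Prod.ext h3.symm ?_)
        · have := hget r.1 (h.step_mem (List.getElem_mem _) s hr)
          rw [← h2, List.getElem?_eq_getElem q'.isLt] at this
          exact (Option.some.inj this).symm
        · simp only [h4]
          refine (List.filter_eq_self.2 fun o ho => ?_).symm
          simpa using (hstep _ hq _ _ hr).2 o ho
    refine rel_map_iff (k := fun q : Fin l.length => l[q]) (K := {q | l[q] ∈ K}) ?_ ?_ ?_ ?_ y'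
    · exact (List.getElem_idxOf _).symm
    · simpa [List.getElem_idxOf] using hstart
    · intro q hq i r hr
      have := hmap q hq (tape x i)
      rw [show step q (tape x i) = some r from hr] at this
      exact (hstep _ hq _ _ this).1
    · exact fun q hq i => hmap q hq _

end TwoDT

/-! ### Computability of the search for a closed list of states. -/

section Primrec

open Primrec

variable {α S : Type*} [Primcodable α] [Primcodable S] [DecidableEq S]

theorem primrec_tapeLetters : Primrec tapeLetters :=
  list_cons.comp (const none) (list_map list_range (Primrec₂.mk (option_some.comp snd)))

variable {M : α → TwoDT ℕ ℕ S} {a b : α → ℕ}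

theorem primrecPred_isClosedList
    (hstep : Primrec fun z : α × S × Option ℕ => (M z.1).step z.2.1 z.2.2)
    (hstart : Primrec fun p => (M p).start) (ha : Primrec a) :
    PrimrecPred fun z : α × List S => (M z.1).IsClosedList (a z.1) z.2 := by
  have hsucc : Primrec fun z : α × List S => (M z.1).successors (a z.1) z.2 := by
    refine list_flatMap snd (Primrec₂.mk (listFilterMap
      (primrec_tapeLetters.comp (ha.comp (fst.comp fst))) (Primrec₂.mk ?_)))
    exact option_map (hstep.comp ((fst.comp (fst.comp fst)).pair ((snd.comp fst).pair snd)))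
      (Primrec₂.mk (fst.comp snd))
  have hR : PrimrecRel fun (q : S) (l : List S) => q ∈ l := primrec_mem fst snd
  exact PrimrecPred.and (primrec_mem (hstart.comp fst) snd) (hR.forall_mem_list.comp hsucc snd)

theorem primrec_codeOfList
    (hstep : Primrec fun z : α × S × Option ℕ => (M z.1).step z.2.1 z.2.2)
    (hstart : Primrec fun p => (M p).start) (ha : Primrec a) (hb : Primrec b) :
    Primrec fun z : α × List S => (M z.1).codeOfList (a z.1) (b z.1) z.2 := by
  have hstate : Primrec fun y : ((α × List S) × ℕ) × Option ℕ =>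
      (y.1.1.2[y.1.2]?).bind fun t => (M y.1.1.1).step t y.2 :=
    option_bind (list_getElem?.comp (snd.comp (fst.comp fst)) (snd.comp fst))
      (Primrec₂.mk (hstep.comp ((fst.comp (fst.comp (fst.comp fst))).pair
        (snd.pair (snd.comp fst)))))
  have hentry : Primrec fun y : (((α × List S) × ℕ) × Option ℕ) × (S × Bool × List ℕ) =>
      ((y.1.1.2, y.1.2), y.1.1.1.2.idxOf y.2.1, y.2.2.1,
        y.2.2.2.filter (· < b y.1.1.1.1)) := by
    have hr : Primrec fun y : (((α × List S) × ℕ) × Option ℕ) × (S × Bool × List ℕ) => y.2 := snd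
    refine Primrec.pair ((snd.comp (fst.comp fst)).pair (snd.comp fst)) (Primrec.pair
      (list_idxOf.comp (fst.comp hr) (snd.comp (fst.comp (fst.comp fst))))
      ((fst.comp (snd.comp hr)).pair ?_))
    have ho : Primrec fun y : (((α × List S) × ℕ) × Option ℕ) × (S × Bool × List ℕ) => y.2.2.2 :=
      snd.comp (snd.comp hr)
    have hlt : Primrec fun w : ((((α × List S) × ℕ) × Option ℕ) × (S × Bool × List ℕ)) × ℕ =>
        decide (w.2 < b w.1.1.1.1.1) :=
      (nat_lt.comp snd (hb.comp (fst.comp (fst.comp (fst.comp (fst.comp fst)))))).decide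
    exact primrec_filter
      (p := fun w : ((((α × List S) × ℕ) × Option ℕ) × (S × Bool × List ℕ)) × ℕ =>
        decide (w.2 < b w.1.1.1.1.1)) ho hlt
  have hrow : Primrec fun y : (α × List S) × ℕ => (tapeLetters (a y.1.1)).filterMap fun s =>
      (y.1.2[y.2]?.bind fun t => (M y.1.1).step t s).map fun r =>
        ((y.2, s), y.1.2.idxOf r.1, r.2.1, r.2.2.filter (· < b y.1.1)) :=
    listFilterMap (primrec_tapeLetters.comp (ha.comp (fst.comp fst)))
      (Primrec₂.mk (option_map hstate (Primrec₂.mk hentry)))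
  exact ((ha.comp fst).pair ((hb.comp fst).pair (list_length.comp snd))).pair
    ((list_idxOf.comp (hstart.comp fst) snd).pair
      (list_flatMap (list_range.comp (list_length.comp snd)) (Primrec₂.mk hrow)))

/-- The states of a family of transducers can be numbered effectively. -/
theorem exists_computable_codeOfList
    (hstep : Primrec fun z : α × S × Option ℕ => (M z.1).step z.2.1 z.2.2)
    (hstart : Primrec fun p => (M p).start) (ha : Primrec a) (hb : Primrec b)
    (hclosed : ∀ p, ∃ l, (M p).IsClosedList (a p) l) :
    ∃ F : α → TwoDTCode, Computable F ∧ ∀ p, ∃ l, (M p).IsClosedList (a p) l ∧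
      F p = (M p).codeOfList (a p) (b p) l := by
  -- Numbers are tried until one decodes to a closed list of states. Closedness is primitive
  -- recursive, and `hclosed` makes the search total without any bound on the list.
  let f : α → ℕ → Option TwoDTCode := fun p n => (Encodable.decode n : Option (List S)).bind
    fun l => if (M p).IsClosedList (a p) l then some ((M p).codeOfList (a p) (b p) l) else none
  have hf : Primrec₂ f := Primrec₂.mk (option_bind (Primrec.decode.comp snd) (Primrec₂.mk
    (Primrec.ite ((primrecPred_isClosedList hstep hstart ha).comp ((fst.comp fst).pair snd))
      (option_some.comp ((primrec_codeOfList hstep hstart ha hb).comp ((fst.comp fst).pair snd)))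
      (const none))))
  have hdom : ∀ p, (Nat.rfindOpt (f p)).Dom := fun p => by
    obtain ⟨l, hl⟩ := hclosed p
    exact Nat.rfindOpt_dom.2 ⟨Encodable.encode l, _, by simp [f, hl]; rfl⟩
  refine ⟨fun p => (Nat.rfindOpt (f p)).get (hdom p),
    (Partrec.rfindOpt hf.to_comp).of_eq_tot fun p => Part.get_mem _, fun p => ?_⟩
  obtain ⟨n, hn⟩ := Nat.rfindOpt_spec (Part.get_mem (hdom p))
  simp only [f, Option.mem_def, Option.bind_eq_some_iff, Option.ite_none_right_eq_some,
    Option.some.injEq] at hn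
  obtain ⟨l, -, hl, he⟩ := hn
  exact ⟨l, hl, he.symm⟩

end Primrec

theorem mem_comp_iff {X Y Z : Type*} (g : Y →. Z) (f : X →. Y) (x : X) (z : Z) :
    z ∈ g.comp f x ↔ ∃ y, y ∈ f x ∧ z ∈ g y :=
  Part.mem_bind_iff

/-- The step function of the composed machine is primitive recursive in the two codes; only the
numbering of its states takes an unbounded search. -/
theorem exists_effective_comp : ∃ F : OneNTCode × TwoDTCode → TwoDTCode, Computable F ∧
    ∀ (a b c n m : ℕ) (N : OneNT (Fin a) (Fin b) (Fin n)) (T : TwoDT (Fin b) (Fin c) (Fin m))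
      (cN : OneNTCode) (cT : TwoDTCode), N.IsCode cN → T.IsCode cT →
      ∃ (k : ℕ) (T' : TwoDT (Fin a) (Fin c) (Fin k)), T'.IsCode (F (cN, cT)) ∧
        T'.toFun = T.toFun.comp N.restrictedFun := by
  classical
  obtain ⟨F, hF, h⟩ := exists_computable_codeOfList (α := OneNTCode × TwoDTCode)
    (M := fun c => (compMach c).toTwoDT) (a := fun c => c.1.1.1) (b := fun c => c.2.1.2.1)
    primrec_compMach_step primrec_compMach_start
    (Primrec.fst.comp (Primrec.fst.comp Primrec.fst))
    (Primrec.fst.comp (Primrec.snd.comp (Primrec.fst.comp Primrec.snd))) fun c => by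
      -- The search has to end for all pairs of codes, even those that describe no machines, so
      -- outputs are unrestricted here. For valid codes they are bounded by the alphabet below.
      obtain ⟨K, hK, h1, h2⟩ := exists_closed_compMach c.1 c.2 (Γ := Set.univ)
        fun _ _ _ _ => Set.mem_univ _
      exact TwoDT.exists_isClosedList _ hK h1 fun q hq s r hr => (h2 q hq s r hr).1
  refine ⟨F, hF, fun a b c n m N T cN cT hN hT => ?_⟩
  obtain ⟨l, hl, he⟩ := h (cN, cT)
  have hout : ∀ t ∈ cT.2.2, ∀ o ∈ t.2.2.2, o ∈ {o | o < c} := by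
    intro t ht o ho
    obtain ⟨q, s, q', d, α, -, rfl⟩ := (hT.2.2 t).1 ht
    obtain ⟨i, -, rfl⟩ := List.mem_map.1 ho
    exact i.isLt
  obtain ⟨K, -, h1, h2⟩ := exists_closed_compMach cN cT hout
  have ha : cN.1.1 = a := by rw [hN.2.1]
  have hc : cT.1.2.1 = c := by rw [hT.1]
  rw [he]
  simp only [ha, hc] at hl ⊢
  obtain ⟨T', hT', hrel⟩ := hl.exists_isCode c h1 h2
  refine ⟨_, T', hT', ?_⟩
  funext x
  refine Part.ext fun y => ?_
  have hy := (hrel x fun i => (y i).val).symm.trans (rel_compMach_iff hN hT x _)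
  have hinj : ∀ y' : ℕ → Fin c, (fun i => (y i).val) = (fun i => (y' i).val) ↔ y = y' := fun y' =>
    ⟨fun h => funext fun i => Fin.val_injective (congrFun h i), fun h => h ▸ rfl⟩
  simp only [hinj, exists_eq_right'] at hy
  rw [TwoDT.mem_toFun, hy, mem_comp_iff]
  simp only [OneNT.mem_restrictedFun, TwoDT.mem_toFun]

/-! ### Transport to numbered alphabets and states -/

namespace OneNT

variable {A B Q A' B' Q' : Type*}

/-- Renaming the letters and the states. -/
def rename (N : OneNT A B Q) (eA : A ≃ A') (eB : B ≃ B') (eQ : Q ≃ Q') : OneNT A' B' Q' where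
  initial := {q | eQ.symm q ∈ N.initial}
  final := {q | eQ.symm q ∈ N.final}
  trans q s q' := (N.trans (eQ.symm q) (eA.symm s) (eQ.symm q')).map (List.map eB)

theorem isAccepting_rename_iff (N : OneNT A B Q) (eA : A ≃ A') (eB : B ≃ B') (eQ : Q ≃ Q')
    (x : ℕ → A) (ρ : ℕ → Q) :
    (N.rename eA eB eQ).IsAccepting (fun i => eA (x i)) (fun i => eQ (ρ i)) ↔
      N.IsAccepting x ρ := by
  simp [IsAccepting, IsRun, rename]

theorem restrictedRel_rename_iff (N : OneNT A B Q) (eA : A ≃ A') (eB : B ≃ B') (eQ : Q ≃ Q')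
    (x : ℕ → A) (z' : ℕ → B') : (N.rename eA eB eQ).RestrictedRel (fun i => eA (x i)) z' ↔
      ∃ z, N.RestrictedRel x z ∧ z' = fun i => eB (z i) := by
  have hout : ∀ ρ, (N.rename eA eB eQ).runOutput (fun i => eA (x i)) (fun i => eQ (ρ i)) =
      fun i => (N.runOutput x ρ i).map eB := by
    intro ρ
    funext i
    simp only [runOutput, rename, Equiv.symm_apply_apply]
    cases N.trans (ρ i) (x i) (ρ (i + 1)) <;> rfl
  have hsurj : Function.Bijective fun (ρ : ℕ → Q) i => eQ (ρ i) :=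
    (Equiv.arrowCongr (Equiv.refl ℕ) eQ).bijective
  have hu : (∃! ρ', (N.rename eA eB eQ).IsAccepting (fun i => eA (x i)) ρ') ↔
      ∃! ρ, N.IsAccepting x ρ := by
    rw [hsurj.existsUnique_iff]
    simp only [isAccepting_rename_iff]
  rw [RestrictedRel, hu, hsurj.surjective.exists]
  simp only [isAccepting_rename_iff, hout, isInfConcat_map_iff]
  constructor
  · rintro ⟨h, ρ, hρ, z, hz, rfl⟩
    exact ⟨z, ⟨h, ρ, hρ, hz⟩, rfl⟩
  · rintro ⟨z, ⟨h, ρ, hρ, hz⟩, rfl⟩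
    exact ⟨h, ρ, hρ, z, hz, rfl⟩

theorem exists_isCode {a b n : ℕ} {N : OneNT (Fin a) (Fin b) (Fin n)} (h : N.IsRestricted) :
    ∃ c, N.IsCode c := by
  obtain ⟨l₁, h₁⟩ : ∃ l : List ℕ, ∀ p, p ∈ l ↔ ∃ q ∈ N.initial, p = q.val := by
    have hf : {p : ℕ | ∃ q ∈ N.initial, p = q.val}.Finite :=
      (Set.finite_range Fin.val).subset fun p ⟨q, _, hq⟩ => ⟨q, hq.symm⟩
    exact ⟨hf.toFinset.toList, by simp⟩
  obtain ⟨l₂, h₂⟩ : ∃ l : List ((ℕ × ℕ × ℕ) × List ℕ), ∀ t, t ∈ l ↔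
      ∃ q s q' α, N.trans q s q' = some α ∧
        t = ((q.val, s.val, q'.val), α.map Fin.val) := by
    have hf : {t : (ℕ × ℕ × ℕ) × List ℕ | ∃ q s q' α, N.trans q s q' = some α ∧
        t = ((q.val, s.val, q'.val), α.map Fin.val)}.Finite := by
      refine (Set.finite_range fun e : Fin n × Fin a × Fin n =>
        ((e.1.val, e.2.1.val, e.2.2.val),
          ((N.trans e.1 e.2.1 e.2.2).getD []).map Fin.val)).subset ?_
      rintro t ⟨q, s, q', α, hα, rfl⟩
      exact ⟨(q, s, q'), by simp [hα]⟩
    exact ⟨hf.toFinset.toList, fun t => by simp only [Finset.mem_toList, Set.Finite.mem_toFinset,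
      Set.mem_ofPred_eq]⟩
  exact ⟨((a, b, n), l₁, l₂), h, rfl, h₁, h₂⟩

end OneNT

namespace TwoDT

variable {A B Q A' B' Q' : Type*}

/-- Renaming the letters and the states. -/
def rename (T : TwoDT A B Q) (eA : A ≃ A') (eB : B ≃ B') (eQ : Q ≃ Q') : TwoDT A' B' Q' where
  start := eQ T.start
  step q s := (T.step (eQ.symm q) (s.map eA.symm)).map fun r => (eQ r.1, r.2.1, r.2.2.map eB)

theorem rel_rename_iff (T : TwoDT A B Q) (eA : A ≃ A') (eB : B ≃ B') (eQ : Q ≃ Q')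
    (x : ℕ → A) (y : ℕ → B) :
    (T.rename eA eB eQ).Rel (fun i => eA (x i)) (fun i => eB (y i)) ↔ T.Rel x y := by
  have h := rel_map_iff (T := T) (T' := T.rename eA eB eQ) (k := eQ) (f := eA) (g := eB)
    (K := Set.univ) (x := x) rfl (Set.mem_univ _) (fun _ _ _ _ _ => Set.mem_univ _)
    (fun q _ i => by simp [rename, Option.map_map]) (fun i => eB (y i))
  rw [h]
  refine ⟨?_, fun hy => ⟨y, hy, rfl⟩⟩
  rintro ⟨y₁, hy, he⟩
  obtain rfl : y = y₁ := funext fun i => eB.injective (congrFun he i)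
  exact hy

theorem exists_isCode {a b n : ℕ} (T : TwoDT (Fin a) (Fin b) (Fin n)) : ∃ c, T.IsCode c := by
  have hf : {t : (ℕ × Option ℕ) × ℕ × Bool × List ℕ | ∃ q s q' d α,
      T.step q s = some (q', d, α) ∧
        t = ((q.val, s.map Fin.val), q'.val, d, α.map Fin.val)}.Finite := by
    refine (Set.finite_range fun e : Fin n × Option (Fin a) =>
      ((e.1.val, e.2.map Fin.val), ((T.step e.1 e.2).map fun r =>
        (r.1.val, r.2.1, r.2.2.map Fin.val)).getD (0, false, []))).subset ?_
    rintro t ⟨q, s, q', d, α, hα, rfl⟩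
    exact ⟨(q, s), by simp [hα]⟩
  refine ⟨((a, b, n), T.start.val, hf.toFinset.toList), rfl, rfl, fun t => ?_⟩
  simp only [Finset.mem_toList, Set.Finite.mem_toFinset, Set.mem_ofPred_eq]

end TwoDT

/-- The effective version applies after letters and states have been numbered; every finite machine
has a code, and the result is renamed back. -/
theorem isDetRegular_comp {A B C Q : Type*} [Finite A] [Finite B] [Finite C] [Finite Q]
    (N : OneNT A B Q) (g : (ℕ → B) →. (ℕ → C)) (hN : N.IsRestricted) (hg : IsDetRegular g) :
    IsDetRegular (g.comp N.restrictedFun) := by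
  obtain ⟨Q', _, T, rfl⟩ := hg
  obtain ⟨F, -, hF⟩ := exists_effective_comp
  let eA := Finite.equivFin A
  let eB := Finite.equivFin B
  let eC := Finite.equivFin C
  let eQ := Finite.equivFin Q
  obtain ⟨cN, hcN⟩ := (OneNT.exists_isCode (N := N.rename eA eB eQ) fun q => hN _)
  obtain ⟨cT, hcT⟩ := (T.rename eB eC (Finite.equivFin Q')).exists_isCode
  obtain ⟨k, T', -, hT'⟩ := hF _ _ _ _ _ _ _ cN cT hcN hcT
  refine ⟨Fin k, inferInstance, T'.rename eA.symm eC.symm (Equiv.refl _), ?_⟩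
  funext x
  refine Part.ext fun y => ?_
  have h := TwoDT.rel_rename_iff T' eA.symm eC.symm (Equiv.refl _) (fun i => eA (x i))
    (fun i => eC (y i))
  simp only [Equiv.symm_apply_apply] at h
  rw [TwoDT.mem_toFun, h, ← TwoDT.mem_toFun, hT', mem_comp_iff, mem_comp_iff]
  simp only [OneNT.mem_restrictedFun, TwoDT.mem_toFun, OneNT.restrictedRel_rename_iff]
  constructor
  · rintro ⟨-, ⟨z, hz, rfl⟩, h⟩
    exact ⟨z, hz, (TwoDT.rel_rename_iff _ _ _ _ _ _).1 h⟩
  · rintro ⟨z, hz, h⟩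
    exact ⟨_, ⟨z, hz, rfl⟩, (TwoDT.rel_rename_iff _ _ _ _ _ _).2 h⟩

/-- The first part is the closure property. The second part is its effectiveness: a single
computable function maps the descriptions of the two given machines to a description of a
deterministic two-way transducer for the composition. -/
theorem theorem2 :
    (∀ (A : Type*) (B : Type*) (C : Type*) (Q : Type*) [Finite A] [Finite B] [Finite C] [Finite Q]
      (N : OneNT A B Q) (g : (ℕ → B) →. (ℕ → C)),
      N.IsRestricted → IsDetRegular g → IsDetRegular (g.comp N.restrictedFun)) ∧
    ∃ F : OneNTCode × TwoDTCode → TwoDTCode, Computable F ∧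
      ∀ (a b c n m : ℕ) (N : OneNT (Fin a) (Fin b) (Fin n)) (T : TwoDT (Fin b) (Fin c) (Fin m))
        (cN : OneNTCode) (cT : TwoDTCode), N.IsCode cN → T.IsCode cT →
        ∃ (k : ℕ) (T' : TwoDT (Fin a) (Fin c) (Fin k)), T'.IsCode (F (cN, cT)) ∧
          T'.toFun = T.toFun.comp N.restrictedFun := by
  exact ⟨fun A B C Q _ _ _ _ N g hN hg => isDetRegular_comp N g hN hg, exists_effective_comp⟩
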